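/- **Setting.** Let $n,k\ge 1$ be integers, $M_1\ge M_2\ge 0$, and let $X\in\mathbb R^{n\times n}$ be a symmetric matrix with zero diagonal. Put $b=M_1/4$ if $X\ne 0$ and $b=M_1/3$ if $X=0$. Let $\sigma(x)=1/(1+e^{-x})$ (applied entrywise to matrices), $J=I_n-\frac1n 1_n1_n^\top$, $\langle M,N\rangle=\operatorname{Tr}(M^\top N)$, and let $\|\cdot\|_F$, $\|\cdot\|_{op}$ be the Frobenius and operator norms. For $Z\in\mathbb R^{n\times k}$, $\alpha\in\mathbb R^n$, $\beta\in\mathbb R$ write $\Theta=\alpha 1_n^\top+1_n\alpha^\top+\beta X+ZZ^\top$, and set $$\mathcal C_Z=\{Z: JZ=Z,\ \max_i\|Z_{i*}\|^2\le b\},\quad \mathcal C_\alpha=\{\alpha:\|\alpha\|_\infty\le b\},\quad \mathcal C_\beta=\{\beta: |\beta|\max_{i,j}|X_{ij}|\le b\}.$$ These sets force $|\Theta_{ij}|\le M_1$. Let $\mathcal F(n,k,M_1,M_2,X)$ be the set of all $\Theta$ with $Z\in\mathcal C_Z$, $\alpha\in\mathcal C_\alpha$, $\beta\in\mathcal C_\beta$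 and $\max_{i\ne j}\Theta_{ij}\le -M_2$. The true parameter $\Theta_\star\in\mathcal F(n,k,M_1,M_2,X)$ is given by such $(Z_\star,\alpha_\star,\beta_\star)$, where $Z_\star$ has rank $k$; $\kappa$ is the condition number of $Z_\star$ (ratio of its largest to its smallest singular value), and $P=\sigma(\Theta_\star)$. **Algorithm.** Given the adjacency matrix $A$ of an undirected graph on $n$ nodes without self-loops, a starting point $(Z^0,\alpha^0,\beta^0)$ and $\eta>0$, projected gradient descent iterates $$Z^{t+1}=\mathcal P_{\mathcal C_Z}\big(Z^t+2\eta_Z(A-\sigma(\Theta^t))Z^t\big),\quad \alpha^{t+1}=\mathcal P_{\mathcal C_\alpha}\big(\alpha^t+2\eta_\alpha(A-\sigma(\Theta^t))1_n\big),\quad \beta^{t+1}=\mathcal P_{\mathcal C_\beta}\big(\beta^t+\eta_\beta\langle A-\sigma(\Theta^t),X\rangle\big),$$ with $\eta_Z=\eta/\|Z^0\|_{op}^2$, $\eta_\alpha=\eta/(2n)$, $\eta_\beta=\eta/(2\|X\|_F^2)$, where $\mathcal P$ is Euclidean projection; if $X=0$ the $\beta$-update is skipped. Define $$e_t=\|Z_\star\|_{op}^2\min_{R\in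 O(k)}\|Z^t-Z_\star R\|_F^2+2\|(\alpha^t-\alpha_\star)1_n^\top\|_F^2+\|(\beta^t-\beta_\star)X\|_F^2,$$ $$\zeta_n=\max\{2\|A-P\|_{op},\ |\langle A-P,X/\|X\|_F\rangle|/\sqrt k,\ 1\},\qquad \psi_n^2=e^{2M_1}nk\max\{e^{-M_2},\tfrac{\log n}{n}\}$$ (the middle term of $\zeta_n$ is $0$ if $X=0$), $\Delta_{G^t}=Z^t(Z^t)^\top-Z_\star Z_\star^\top$ and $\Delta_{\Theta^t}=\Theta^t-\Theta_\star$. **Theorem.** There are universal constants $M_0,c,c_\eta>0$ such that the following holds whenever $0<\eta\le c_\eta$, $\|X\|_F^2/\|X\|_{op}^2\ge M_0k$ if $X\ne0$, and the starting point satisfies $e_0\le c\,e^{-2M_1}\|Z_\star\|_{op}^4/\kappa^4$. 1. (Deterministic.) There are universal constants $C_1,\rho,C>0$ with $c_\eta\rho<1$ such that, if $\|Z_\star\|_{op}^2\ge C_1\kappa^2e^{M_1}\zeta_n\max\{\sqrt{\eta ke^{M_1}},1\}$, then for all $t\ge 0$ $$e_t\le 2\Big(1-\frac{\eta\rho}{e^{M_1}\kappa^2}\Big)^te_0+\frac{C\kappa^2}{\rho}e^{2M_1}\zeta_n^2k.$$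 2. (Probabilistic.) There are universal constants $C_1,\rho,c_0,C,C'>0$ with $c_\eta\rho<1$ such that, if $\|Z_\star\|_{op}^2\ge C_1\kappa^2\sqrt n\,e^{M_1-M_2/2}\max\{\sqrt{\eta ke^{M_1}},1\}$ and the edges $A_{ij}=A_{ji}$, $i<j$, are independent $\mathrm{Bernoulli}(P_{ij})$, then, with probability at least $1-n^{-c_0}$, simultaneously for all starting points as above (which may depend on $A$): $$e_t\le 2\Big(1-\frac{\eta\rho}{e^{M_1}\kappa^2}\Big)^te_0+\frac{C\kappa^2}{\rho}\psi_n^2\quad\text{for all }t\ge0,$$ and for every integer $T\ge 0$ with $$T>T_0=\log\Big(\frac{M_1^2}{\kappa^2e^{4M_1-M_2}}\,\frac n{k^2}\Big)\Big/\log\Big(\frac{1}{1-\eta\rho/(e^{M_1}\kappa^2)}\Big)$$ one has $\|\Delta_{G^T}\|_F^2\le C'\kappa^2\psi_n^2$ and $\|\Delta_{\Theta^T}\|_F^2\le C'\kappa^2\psi_n^2$. -/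

import Mathlib

open MeasureTheory ProbabilityTheory
open scoped Matrix

noncomputable section

namespace LatentSpace

/-! ### Matrix norms, singular values -/

/-- Frobenius norm. -/
def frob {m n : ℕ} (M : Matrix (Fin m) (Fin n) ℝ) : ℝ :=
  Real.sqrt (∑ i, ∑ j, M i j ^ 2)

/-- Spectral norm: the norm of `M` as an operator between Euclidean spaces. -/
def opNorm {m n : ℕ} (M : Matrix (Fin m) (Fin n) ℝ) : ℝ :=
  ‖LinearMap.toContinuousLinearMap (Matrix.toEuclideanLin M)‖

/-- Trace inner product `Tr (Mᵀ N)`. -/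
def mInner {m n : ℕ} (M N : Matrix (Fin m) (Fin n) ℝ) : ℝ := Matrix.trace (Mᵀ * N)

/-- Smallest of the `k` singular values of an `n × k` matrix (`k ≥ 1`; Mathlib lists the singular
values in decreasing order, starting with index `0`). -/
def sigmaMin {n k : ℕ} (Z : Matrix (Fin n) (Fin k) ℝ) : ℝ :=
  (Matrix.toEuclideanLin Z).singularValues (k - 1)

/-- Condition number, meaningful when `0 < sigmaMin Z`. -/
def kappa {n k : ℕ} (Z : Matrix (Fin n) (Fin k) ℝ) : ℝ := opNorm Z / sigmaMin Z

/-- Rows of `Z` are centered, `J Z = Z` with `J = I - n⁻¹ 1 1ᵀ`. -/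
def Centered {n k : ℕ} (Z : Matrix (Fin n) (Fin k) ℝ) : Prop :=
  ((1 : Matrix (Fin n) (Fin n) ℝ) - (n : ℝ)⁻¹ • Matrix.of (fun _ _ => (1 : ℝ))) * Z = Z

/-! ### The inner-product model -/

/-- A triple `(Z, α, β)`. -/
structure Params (n k : ℕ) where
  Z : Matrix (Fin n) (Fin k) ℝ
  α : Fin n → ℝ
  β : ℝ

/-- The rank-one matrix `a 1ᵀ`. -/
def colOnes {n : ℕ} (a : Fin n → ℝ) : Matrix (Fin n) (Fin n) ℝ :=
  Matrix.vecMulVec a (fun _ => 1)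

/-- `Θ = α 1ᵀ + 1 αᵀ + β X + Z Zᵀ`. -/
def Params.theta {n k : ℕ} (p : Params n k) (X : Matrix (Fin n) (Fin n) ℝ) :
    Matrix (Fin n) (Fin n) ℝ :=
  colOnes p.α + (colOnes p.α)ᵀ + p.β • X + p.Z * p.Zᵀ

/-- Entrywise sigmoid. -/
def sigmoidM {n : ℕ} (T : Matrix (Fin n) (Fin n) ℝ) : Matrix (Fin n) (Fin n) ℝ :=
  T.map Real.sigmoid

/-- A covariate matrix is symmetric with zero diagonal. -/
def IsCovariate {n : ℕ} (X : Matrix (Fin n) (Fin n) ℝ) : Prop :=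
  X.IsSymm ∧ ∀ i, X i i = 0

/-- Adjacency matrix of an undirected graph without self-loops. -/
def IsAdjacency {n : ℕ} (A : Matrix (Fin n) (Fin n) ℝ) : Prop :=
  A.IsSymm ∧ (∀ i, A i i = 0) ∧ ∀ i j, A i j = 0 ∨ A i j = 1

open Classical in
/-- Common radius of the constraints, chosen so that they force `|Θ i j| ≤ M₁`
(`4 * (M₁ / 4)` with a covariate, `3 * (M₁ / 3)` without). -/
def radius {n : ℕ} (M₁ : ℝ) (X : Matrix (Fin n) (Fin n) ℝ) : ℝ :=
  if X = 0 then M₁ / 3 else M₁ / 4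

/-- Constraint set for `Z`: centered, squared row norms at most the radius. -/
def CZ {n : ℕ} (k : ℕ) (M₁ : ℝ) (X : Matrix (Fin n) (Fin n) ℝ) :
    Set (Matrix (Fin n) (Fin k) ℝ) :=
  {Z | Centered Z ∧ ∀ i, ∑ j, Z i j ^ 2 ≤ radius M₁ X}

/-- Constraint set for `α`. -/
def Cα {n : ℕ} (M₁ : ℝ) (X : Matrix (Fin n) (Fin n) ℝ) : Set (Fin n → ℝ) :=
  {a | ∀ i, |a i| ≤ radius M₁ X}

/-- Constraint set for `β`: `|β| * max |X i j|` is at most the radius. -/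
def Cβ {n : ℕ} (M₁ : ℝ) (X : Matrix (Fin n) (Fin n) ℝ) : Set ℝ :=
  {b | ∀ i j, |b| * |X i j| ≤ radius M₁ X}

/-- `p` parametrizes a member of the parameter space `F(n, k, M₁, M₂, X)`. -/
def Params.InSpace {n k : ℕ} (p : Params n k) (M₁ M₂ : ℝ) (X : Matrix (Fin n) (Fin n) ℝ) : Prop :=
  p.Z ∈ CZ k M₁ X ∧ p.α ∈ Cα M₁ X ∧ p.β ∈ Cβ M₁ X ∧ ∀ i j, i ≠ j → p.theta X i j ≤ -M₂

/-- The random matrix `A` follows the latent space model with logit matrix `T`: it is the adjacency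
matrix of a random graph whose edges `i < j` are independent, present with probability
`sigmoid (T i j)`. -/
structure IsModel {n : ℕ} {Ω : Type*} [MeasurableSpace Ω] (μ : Measure Ω)
    (A : Ω → Matrix (Fin n) (Fin n) ℝ) (T : Matrix (Fin n) (Fin n) ℝ) : Prop where
  adj : ∀ ω, IsAdjacency (A ω)
  meas : ∀ i j, Measurable fun ω => A ω i j
  prob : ∀ i j, i < j → μ {ω | A ω i j = 1} = ENNReal.ofReal (Real.sigmoid (T i j))
  indep : iIndepFun (fun (e : {e : Fin n × Fin n // e.1 < e.2}) ω => A ω e.1.1 e.1.2) μ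

/-! ### Projected gradient descent -/

/-- `x` is the projection of `y` onto `C` for the distance `d`. -/
def IsProj {E : Type*} (d : E → E → ℝ) (C : Set E) (y x : E) : Prop :=
  x ∈ C ∧ ∀ w ∈ C, d y x ≤ d y w

/-- Euclidean distance of vectors. -/
def vecDist {n : ℕ} (a b : Fin n → ℝ) : ℝ := Real.sqrt (∑ i, (a i - b i) ^ 2)

/-- The sequence `p` of iterates is generated by projected gradient descent from `p 0`, with step
sizes `η / ‖Z⁰‖²` for `Z`, `η / (2 n)` for `α` and `η / (2 ‖X‖_F²)` for `β`; when `X = 0` the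
update of `β` is skipped. -/
def IsPGD {n k : ℕ} (A X : Matrix (Fin n) (Fin n) ℝ) (M₁ η : ℝ) (p : ℕ → Params n k) : Prop :=
  ∀ t,
    IsProj (fun V W => frob (V - W)) (CZ k M₁ X)
      ((p t).Z + (2 * (η / opNorm (p 0).Z ^ 2)) • ((A - sigmoidM ((p t).theta X)) * (p t).Z))
      (p (t + 1)).Z ∧
    IsProj vecDist (Cα M₁ X)
      ((p t).α + (2 * (η / (2 * n))) • ((A - sigmoidM ((p t).theta X)) *ᵥ (fun _ => (1 : ℝ))))
      (p (t + 1)).α ∧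
    (X ≠ 0 → IsProj (fun a b => |a - b|) (Cβ M₁ X)
      ((p t).β + (η / (2 * frob X ^ 2)) * mInner (A - sigmoidM ((p t).theta X)) X)
      (p (t + 1)).β) ∧
    (X = 0 → (p (t + 1)).β = (p t).β)

/-! ### Error metric and rates -/

/-- `min_R ‖Z₁ - Z₂ R‖_F` over orthogonal `R`. -/
def procrustes {n k : ℕ} (Z₁ Z₂ : Matrix (Fin n) (Fin k) ℝ) : ℝ :=
  ⨅ R : Matrix.orthogonalGroup (Fin k) ℝ, frob (Z₁ - Z₂ * (R : Matrix (Fin k) (Fin k) ℝ))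

/-- Error metric `e` of `p` relative to the truth `q`. -/
def errMetric {n k : ℕ} (X : Matrix (Fin n) (Fin n) ℝ) (q p : Params n k) : ℝ :=
  opNorm q.Z ^ 2 * procrustes p.Z q.Z ^ 2 + 2 * frob (colOnes (p.α - q.α)) ^ 2
    + frob ((p.β - q.β) • X) ^ 2

/-- `‖Z Zᵀ - Z⋆ Z⋆ᵀ‖_F²`. -/
def errG {n k : ℕ} (q p : Params n k) : ℝ := frob (p.Z * p.Zᵀ - q.Z * q.Zᵀ) ^ 2

/-- `‖Θ - Θ⋆‖_F²`. -/
def errTheta {n k : ℕ} (X : Matrix (Fin n) (Fin n) ℝ) (q p : Params n k) : ℝ :=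
  frob (p.theta X - q.theta X) ^ 2

/-- `ζ = max {2 ‖A - P‖, |⟨A - P, X / ‖X‖_F⟩| / √k, 1}`, the middle term being `0` if `X = 0`. -/
def zeta {n : ℕ} (k : ℕ) (A P X : Matrix (Fin n) (Fin n) ℝ) : ℝ :=
  max (max (2 * opNorm (A - P)) (|mInner (A - P) ((frob X)⁻¹ • X)| / Real.sqrt k)) 1

/-- `ψ² = e^{2 M₁} n k max {e^{-M₂}, log n / n}`. -/
def psiSq (n k : ℕ) (M₁ M₂ : ℝ) : ℝ :=
  Real.exp (2 * M₁) * n * k * max (Real.exp (-M₂)) (Real.log n / n)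

/-- Contraction factor `1 - η ρ / (e^{M₁} κ²)`. -/
def rate (M₁ κ η ρ : ℝ) : ℝ := 1 - η / (Real.exp M₁ * κ ^ 2) * ρ

/-- `T₀ = log (M₁² n / (κ² e^{4 M₁ - M₂} k²)) / log (1 / (1 - η ρ / (e^{M₁} κ²)))`. -/
def iterT0 (n k : ℕ) (M₁ M₂ κ η ρ : ℝ) : ℝ :=
  Real.log (M₁ ^ 2 / (κ ^ 2 * Real.exp (4 * M₁ - M₂)) * (n / (k : ℝ) ^ 2)) /
    Real.log (1 / rate M₁ κ η ρ)

/-- Standing assumptions on the problem, with constants `M₀` (stable rank of `X`) and `cη` (step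
size): `q` is the true parameter, its latent positions having a finite condition number. -/
structure Setting (M₀ cη : ℝ) (n k : ℕ) (M₁ M₂ η : ℝ) (X : Matrix (Fin n) (Fin n) ℝ)
    (q : Params n k) : Prop where
  k_pos : 1 ≤ k
  M₂_nonneg : 0 ≤ M₂
  M₂_le : M₂ ≤ M₁
  η_pos : 0 < η
  η_le : η ≤ cη
  cov : IsCovariate X
  stableRank : X ≠ 0 → M₀ * k ≤ frob X ^ 2 / opNorm X ^ 2
  truth : q.InSpace M₁ M₂ X
  fullRank : 0 < sigmaMin q.Z

/-- The initializer is close to the truth: `e₀ ≤ c e^{-2 M₁} ‖Z⋆‖⁴ / κ⁴`. -/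
def GoodInit {n k : ℕ} (c M₁ : ℝ) (X : Matrix (Fin n) (Fin n) ℝ) (q p₀ : Params n k) : Prop :=
  errMetric X q p₀ ≤ c * Real.exp (-2 * M₁) * opNorm q.Z ^ 4 / kappa q.Z ^ 4

end LatentSpace

end

/-! Write a = ‖Z⋆‖_op, d for the Procrustes distance of Z to Z⋆, W = A − P for the noise, γ =
1/(e^{M₁}κ²) (`conditioning`) and ν = κ² e^{2M₁} ζ² k for the statistical error. The deterministic
analysis sees the noise only through `NoiseLevel`, so it serves both halves of the theorem.

Contraction. The error is measured by `lyap`. With its weights the linear terms of the three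
projected updates add up to the gradient tested against ΔΘ + DDᵀ, where D = Z − Z⋆R at the optimal
rotation R, up to the mismatch between ‖Z⁰‖² and a². On the constraint sets the logits are bounded
by M₁, so the likelihood is strongly convex in Θ with constant e^{−M₁}/4. Centering and the large
stable rank of X make the three components of ΔΘ nearly orthogonal (`compErr_le_errTheta`), and the
low-rank inequality `frob_gram_sub_ge` bounds d by the error of the Gram matrix. Together they give
`WellPosed.contraction`: a factor 1 − ηγ/64 plus noise, as long as 512 e^{M₁} d² ≤ σ_min².

Two obstacles remain. First, the starting point need not satisfy the constraints, so strong
convexity is not available there. The gradient is still monotone and Lipschitz, and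
`WellPosed.first_step` shows that one step inflates the error only slightly; later steps pay for
this, at the price of the weaker rate 1/256. Second, ν may be larger than the basin of attraction,
because the signal condition contains √(ηke^{M₁}) and not √(ke^{M₁}). In that case the contraction
argument is replaced by descent: from the first iterate on the loss never increases
(`IsStep.loss_le`, `WellPosed.loss_le`), and strong convexity turns a small loss into a small error
(`WellPosed.errTheta_le_of_loss`). This gives an error of order ν, which suffices because the
initial error is itself below a multiple of γν then. `WellPosed.iterates` merges the two regimes.

Randomness. It has to be shown that ζ is of order √(np) with p = max(e^{−M₂}, log n / n). The
covariate term is Chebyshev's inequality. For the operator norm, E tr W^{2m} is expanded over closed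
walks, with m of order np. A walk contributes only if it uses each edge at least twice, and then at
most p to the number of its vertices minus one. Grouping walks by their pattern of coincidences
compares this sum with the same moment of a dense 2m × 2m matrix whose entries have all moments of
order at least two bounded below by 1 (`integral_trace_pow_le_comparator`). That dense matrix is
handled by a net and subgaussian tails, and Markov's inequality finishes.

Finally, the signal condition limits how sparse the graph can be: since Z⋆ is centered, M₂ ≤ 7M₁/8,
and since kσ_min² ≤ nM₁/3, e^{M₁} ≤ n; hence log n ≤ 8 n e^{−M₂} (`Setting.log_le`). So √(np) is
comparable with √n e^{−M₂/2}, and the probabilistic signal condition implies the deterministic one.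
T₀ is the time after which the geometric part of the bound drops below κ²ψ²
(`Setting.rate_pow_mul_le`). -/

noncomputable section

namespace LatentSpace

/-! ### Frobenius and spectral norms -/

section Norms

variable {l m n : ℕ}

section
open scoped Matrix.Norms.L2Operator

lemma opNorm_nonneg (M : Matrix (Fin m) (Fin n) ℝ) : 0 ≤ opNorm M := norm_nonneg _

lemma opNorm_add_le (M N : Matrix (Fin m) (Fin n) ℝ) : opNorm (M + N) ≤ opNorm M + opNorm N :=
  norm_add_le (E := Matrix (Fin m) (Fin n) ℝ) M N

lemma opNorm_sub_le (M N : Matrix (Fin m) (Fin n) ℝ) : opNorm (M - N) ≤ opNorm M + opNorm N :=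
  norm_sub_le (E := Matrix (Fin m) (Fin n) ℝ) M N

lemma opNorm_mul_le (M : Matrix (Fin l) (Fin m) ℝ) (N : Matrix (Fin m) (Fin n) ℝ) :
    opNorm (M * N) ≤ opNorm M * opNorm N := Matrix.l2_opNorm_mul M N

lemma opNorm_transpose (M : Matrix (Fin m) (Fin n) ℝ) : opNorm Mᵀ = opNorm M := by
  have := Matrix.l2_opNorm_conjTranspose M
  rwa [Matrix.conjTranspose_eq_transpose_of_trivial] at this

lemma opNorm_mul_transpose_self (M : Matrix (Fin m) (Fin n) ℝ) :
    opNorm (M * Mᵀ) = opNorm M ^ 2 := by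
  have := Matrix.l2_opNorm_conjTranspose_mul_self Mᵀ
  rw [Matrix.conjTranspose_eq_transpose_of_trivial, Matrix.transpose_transpose] at this
  rw [sq, ← opNorm_transpose M]
  exact this

/-- Iterated C*-identity. It reaches only exponents that are powers of two, which is why the moment
method below uses such exponents. -/
lemma opNorm_pow_two_pow {M : Matrix (Fin n) (Fin n) ℝ} (hM : M.IsSymm) (j : ℕ) :
    opNorm (M ^ 2 ^ j) = opNorm M ^ 2 ^ j := by
  have h : IsSelfAdjoint M := by
    rw [IsSelfAdjoint, Matrix.star_eq_conjTranspose,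
      Matrix.conjTranspose_eq_transpose_of_trivial]
    exact hM
  exact h.norm_pow_two_pow j

end

lemma sqrt_sum_sq_eq_norm (x : Fin n → ℝ) :
    Real.sqrt (∑ i, x i ^ 2) = ‖WithLp.toLp 2 x‖ := by
  rw [EuclideanSpace.norm_eq]; simp

lemma sum_mulVec_sq_le (M : Matrix (Fin m) (Fin n) ℝ) (x : Fin n → ℝ) :
    ∑ i, (M *ᵥ x) i ^ 2 ≤ opNorm M ^ 2 * ∑ i, x i ^ 2 := by
  have h := (LinearMap.toContinuousLinearMap (Matrix.toEuclideanLin M)).le_opNorm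
    (WithLp.toLp 2 x)
  have h2 : ‖LinearMap.toContinuousLinearMap (Matrix.toEuclideanLin M) (WithLp.toLp 2 x)‖
      = Real.sqrt (∑ i, (M *ᵥ x) i ^ 2) := by
    rw [sqrt_sum_sq_eq_norm]; rfl
  rw [h2, ← sqrt_sum_sq_eq_norm] at h
  have h3 := pow_le_pow_left₀ (Real.sqrt_nonneg _) h 2
  rw [mul_pow, Real.sq_sqrt (Finset.sum_nonneg fun _ _ => sq_nonneg _),
    Real.sq_sqrt (Finset.sum_nonneg fun _ _ => sq_nonneg _)] at h3
  exact h3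

lemma opNorm_le_of_forall {M : Matrix (Fin m) (Fin n) ℝ} {c : ℝ} (hc : 0 ≤ c)
    (h : ∀ x : Fin n → ℝ, ∑ i, (M *ᵥ x) i ^ 2 ≤ c ^ 2 * ∑ i, x i ^ 2) : opNorm M ≤ c := by
  refine ContinuousLinearMap.opNorm_le_bound _ hc fun x => ?_
  have h2 : ‖LinearMap.toContinuousLinearMap (Matrix.toEuclideanLin M) x‖
      = Real.sqrt (∑ i, (M *ᵥ x.ofLp) i ^ 2) := by
    rw [sqrt_sum_sq_eq_norm]; rfl
  have h3 : ‖x‖ = Real.sqrt (∑ i, x.ofLp i ^ 2) := by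
    rw [sqrt_sum_sq_eq_norm]
  rw [h2, h3, ← Real.sqrt_sq hc, ← Real.sqrt_mul (sq_nonneg c)]
  exact Real.sqrt_le_sqrt (h _)

lemma frob_nonneg (M : Matrix (Fin m) (Fin n) ℝ) : 0 ≤ frob M := Real.sqrt_nonneg _

lemma frob_sq (M : Matrix (Fin m) (Fin n) ℝ) : frob M ^ 2 = ∑ i, ∑ j, M i j ^ 2 :=
  Real.sq_sqrt (Finset.sum_nonneg fun _ _ => Finset.sum_nonneg fun _ _ => sq_nonneg _)

section
open scoped Matrix.Norms.Frobenius

lemma frob_eq_norm (M : Matrix (Fin m) (Fin n) ℝ) : frob M = ‖M‖ := by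
  rw [Matrix.frobenius_norm_def, frob, Real.sqrt_eq_rpow]; simp

lemma frob_add_le (M N : Matrix (Fin m) (Fin n) ℝ) : frob (M + N) ≤ frob M + frob N := by
  simpa only [frob_eq_norm] using norm_add_le M N

lemma frob_sub_le (M N : Matrix (Fin m) (Fin n) ℝ) : frob (M - N) ≤ frob M + frob N := by
  simpa only [frob_eq_norm] using norm_sub_le M N

lemma frob_smul (c : ℝ) (M : Matrix (Fin m) (Fin n) ℝ) : frob (c • M) = |c| * frob M := by
  simpa only [frob_eq_norm, Real.norm_eq_abs] using norm_smul c M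

lemma frob_neg (M : Matrix (Fin m) (Fin n) ℝ) : frob (-M) = frob M := by
  simp only [frob_eq_norm, norm_neg]

lemma frob_eq_zero {M : Matrix (Fin m) (Fin n) ℝ} : frob M = 0 ↔ M = 0 := by
  rw [frob_eq_norm, norm_eq_zero]

end

lemma frob_sub_comm (M N : Matrix (Fin m) (Fin n) ℝ) : frob (M - N) = frob (N - M) := by
  rw [← frob_neg, neg_sub]

lemma frob_transpose (M : Matrix (Fin m) (Fin n) ℝ) : frob Mᵀ = frob M := by
  rw [frob, frob, Finset.sum_comm]; rfl

lemma frob_pos {M : Matrix (Fin m) (Fin n) ℝ} (h : M ≠ 0) : 0 < frob M :=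
  lt_of_le_of_ne (frob_nonneg M) fun h0 => h (frob_eq_zero.1 h0.symm)

lemma mInner_eq (M N : Matrix (Fin m) (Fin n) ℝ) :
    mInner M N = ∑ i, ∑ j, M i j * N i j := by
  simp only [mInner, Matrix.trace, Matrix.diag, Matrix.mul_apply, Matrix.transpose_apply]
  exact Finset.sum_comm

lemma mInner_comm (M N : Matrix (Fin m) (Fin n) ℝ) : mInner M N = mInner N M := by
  simp only [mInner_eq, mul_comm]

lemma mInner_self (M : Matrix (Fin m) (Fin n) ℝ) : mInner M M = frob M ^ 2 := by
  rw [mInner_eq, frob_sq]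
  simp only [sq]

lemma mInner_add_left (M N K : Matrix (Fin m) (Fin n) ℝ) :
    mInner (M + N) K = mInner M K + mInner N K := by
  simp [mInner, Matrix.add_mul]

lemma mInner_add_right (M N K : Matrix (Fin m) (Fin n) ℝ) :
    mInner K (M + N) = mInner K M + mInner K N := by
  simp [mInner, Matrix.mul_add]

lemma mInner_sub_left (M N K : Matrix (Fin m) (Fin n) ℝ) :
    mInner (M - N) K = mInner M K - mInner N K := by
  simp [mInner, Matrix.sub_mul]

lemma mInner_sub_right (M N K : Matrix (Fin m) (Fin n) ℝ) :
    mInner K (M - N) = mInner K M - mInner K N := by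
  simp [mInner, Matrix.mul_sub]

lemma mInner_smul_left (c : ℝ) (M N : Matrix (Fin m) (Fin n) ℝ) :
    mInner (c • M) N = c * mInner M N := by
  simp [mInner]

lemma mInner_smul_right (c : ℝ) (M N : Matrix (Fin m) (Fin n) ℝ) :
    mInner M (c • N) = c * mInner M N := by
  simp [mInner]

lemma mInner_neg_right (M N : Matrix (Fin m) (Fin n) ℝ) :
    mInner M (-N) = -mInner M N := by
  simp [mInner]

lemma mInner_transpose (M N : Matrix (Fin m) (Fin n) ℝ) : mInner Mᵀ Nᵀ = mInner M N := by
  rw [mInner_eq, mInner_eq, Finset.sum_comm]; rfl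

lemma mInner_mul_right (M : Matrix (Fin l) (Fin n) ℝ) (N : Matrix (Fin l) (Fin m) ℝ)
    (K : Matrix (Fin m) (Fin n) ℝ) : mInner M (N * K) = mInner (Nᵀ * M) K := by
  simp [mInner, Matrix.mul_assoc]

lemma mInner_mul_right' (M : Matrix (Fin l) (Fin n) ℝ) (N : Matrix (Fin l) (Fin m) ℝ)
    (K : Matrix (Fin m) (Fin n) ℝ) : mInner M (N * K) = mInner (M * Kᵀ) N := by
  rw [← mInner_transpose, Matrix.transpose_mul, mInner_mul_right, Matrix.transpose_transpose,
    ← mInner_transpose, Matrix.transpose_mul, Matrix.transpose_transpose,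
    Matrix.transpose_transpose]

lemma abs_mInner_le (M N : Matrix (Fin m) (Fin n) ℝ) : |mInner M N| ≤ frob M * frob N := by
  refine abs_le_of_sq_le_sq ?_ (mul_nonneg (frob_nonneg M) (frob_nonneg N))
  rw [mul_pow, frob_sq, frob_sq, mInner_eq]
  simp only [← Finset.sum_product']
  exact Finset.sum_mul_sq_le_sq_mul_sq _ _ _

lemma frob_add_sq (M N : Matrix (Fin m) (Fin n) ℝ) :
    frob (M + N) ^ 2 = frob M ^ 2 + 2 * mInner M N + frob N ^ 2 := by
  simp only [← mInner_self, mInner_add_left, mInner_add_right, mInner_comm N M]; ring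

lemma frob_sub_sq (M N : Matrix (Fin m) (Fin n) ℝ) :
    frob (M - N) ^ 2 = frob M ^ 2 - 2 * mInner M N + frob N ^ 2 := by
  simp only [← mInner_self, mInner_sub_left, mInner_sub_right, mInner_comm N M]; ring

lemma frob_mul_le_left (M : Matrix (Fin l) (Fin m) ℝ) (N : Matrix (Fin m) (Fin n) ℝ) :
    frob (M * N) ≤ opNorm M * frob N := by
  rw [← abs_of_nonneg (mul_nonneg (opNorm_nonneg M) (frob_nonneg N))]
  refine (le_abs_self _).trans (sq_le_sq.1 ?_)
  rw [mul_pow, ← frob_transpose, ← frob_transpose N, frob_sq, frob_sq, Finset.mul_sum]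
  refine Finset.sum_le_sum fun j _ => ?_
  exact sum_mulVec_sq_le M (fun i => N i j)

lemma frob_mul_le_right (M : Matrix (Fin l) (Fin m) ℝ) (N : Matrix (Fin m) (Fin n) ℝ) :
    frob (M * N) ≤ frob M * opNorm N := by
  rw [← frob_transpose, Matrix.transpose_mul, ← frob_transpose M, ← opNorm_transpose N, mul_comm]
  exact frob_mul_le_left _ _

lemma opNorm_le_frob (M : Matrix (Fin m) (Fin n) ℝ) : opNorm M ≤ frob M := by
  refine opNorm_le_of_forall (frob_nonneg M) fun x => ?_
  rw [frob_sq, Finset.sum_mul]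
  exact Finset.sum_le_sum fun i _ =>
    Finset.sum_mul_sq_le_sq_mul_sq Finset.univ (fun j => M i j) x

lemma frob_one : frob (1 : Matrix (Fin n) (Fin n) ℝ) = Real.sqrt n := by
  rw [frob]; congr 1
  simp [Matrix.one_apply, ite_pow]

lemma frob_le_sqrt_mul_opNorm (M : Matrix (Fin m) (Fin n) ℝ) :
    frob M ≤ Real.sqrt n * opNorm M := by
  have := frob_mul_le_left M (1 : Matrix (Fin n) (Fin n) ℝ)
  rwa [Matrix.mul_one, frob_one, mul_comm] at this

lemma abs_quadForm_le (M : Matrix (Fin n) (Fin n) ℝ) (x y : Fin n → ℝ) :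
    |x ⬝ᵥ (M *ᵥ y)| ≤ opNorm M * (Real.sqrt (∑ i, x i ^ 2) * Real.sqrt (∑ i, y i ^ 2)) := by
  have h1 : |x ⬝ᵥ (M *ᵥ y)| ≤ Real.sqrt (∑ i, x i ^ 2) * Real.sqrt (∑ i, (M *ᵥ y) i ^ 2) := by
    rw [← Real.sqrt_sq_eq_abs, ← Real.sqrt_mul (Finset.sum_nonneg fun _ _ => sq_nonneg _)]
    exact Real.sqrt_le_sqrt (Finset.sum_mul_sq_le_sq_mul_sq _ _ _)
  refine h1.trans ?_
  have h2 : Real.sqrt (∑ i, (M *ᵥ y) i ^ 2) ≤ opNorm M * Real.sqrt (∑ i, y i ^ 2) := by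
    rw [← Real.sqrt_sq (opNorm_nonneg M), ← Real.sqrt_mul (sq_nonneg _)]
    exact Real.sqrt_le_sqrt (sum_mulVec_sq_le M y)
  calc _ ≤ Real.sqrt (∑ i, x i ^ 2) * (opNorm M * Real.sqrt (∑ i, y i ^ 2)) :=
        mul_le_mul_of_nonneg_left h2 (Real.sqrt_nonneg _)
    _ = _ := by ring

/-- Trace duality: the nuclear norm of `Q * N` is at most `√rank` times its Frobenius norm. -/
lemma abs_mInner_le_of_mul_eq (M N : Matrix (Fin m) (Fin n) ℝ) (B : Matrix (Fin m) (Fin l) ℝ)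
    (hB : B * Bᵀ * N = N) :
    |mInner M N| ≤ opNorm M * frob B * frob (Bᵀ * N) := by
  rw [← hB, Matrix.mul_assoc B, mInner_mul_right]
  have hNN : Bᵀ * (B * (Bᵀ * N)) = Bᵀ * N := by
    rw [← Matrix.mul_assoc B, hB]
  rw [hNN]
  refine (abs_mInner_le _ _).trans (mul_le_mul_of_nonneg_right ?_ (frob_nonneg _))
  have := frob_mul_le_right Bᵀ M
  rwa [frob_transpose, mul_comm] at this

end Norms

/-! ### Rank and singular values -/

section Rank

variable {m n k : ℕ}

/-- Trace duality: if the columns of `N` lie in a subspace `S`, then the nuclear norm of `N` is at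
most `√dim S` times its Frobenius norm. -/
lemma abs_mInner_le_finrank (M N : Matrix (Fin m) (Fin n) ℝ)
    (S : Submodule ℝ (EuclideanSpace ℝ (Fin m)))
    (hS : ∀ x : Fin n → ℝ, WithLp.toLp 2 (N *ᵥ x) ∈ S) :
    |mInner M N| ≤ opNorm M * Real.sqrt (Module.finrank ℝ S) * frob N := by
  let b := stdOrthonormalBasis ℝ S
  let v : Fin (Module.finrank ℝ S) → EuclideanSpace ℝ (Fin m) := fun a => b a
  -- The columns of B are an orthonormal basis of S, so BBᵀ is the projection onto S, which fixes N,
  -- and ‖B‖_F = √(dim S).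
  let B : Matrix (Fin m) (Fin (Module.finrank ℝ S)) ℝ := Matrix.of fun i a => v a i
  have hin : ∀ x y : EuclideanSpace ℝ (Fin m), inner ℝ x y = ∑ i, x i * y i := fun x y => by
    rw [PiLp.inner_apply]
    exact Finset.sum_congr rfl fun i _ => by rw [RCLike.inner_apply, conj_trivial, mul_comm]
  have hBB : Bᵀ * B = 1 := by
    ext a c
    have h : inner ℝ (v a) (v c) = if a = c then (1 : ℝ) else 0 :=
      orthonormal_iff_ite.1 b.orthonormal a c
    rw [hin] at h
    rw [Matrix.one_apply, ← h]
    rfl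
  have hBN : B * Bᵀ * N = N := by
    ext i j
    have hcol : N *ᵥ (Pi.single j 1) = fun i => N i j := by ext i; simp
    have hmem := hS (Pi.single j 1)
    rw [hcol] at hmem
    have h := congrArg (fun x : S => (x : EuclideanSpace ℝ (Fin m)) i) (b.sum_repr ⟨_, hmem⟩)
    have h3 : ∀ a, b.repr ⟨_, hmem⟩ a = ∑ l, v a l * N l j := fun a => by
      rw [b.repr_apply_apply, Submodule.coe_inner, hin]
    simp only [h3, Submodule.coe_sum, Submodule.coe_smul, WithLp.ofLp_sum, Finset.sum_apply,
      WithLp.ofLp_smul, Pi.smul_apply, smul_eq_mul] at h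
    rw [← h, Matrix.mul_assoc, Matrix.mul_apply]
    refine Finset.sum_congr rfl fun a _ => ?_
    rw [mul_comm]
    rfl
  have hBfrob : frob B = Real.sqrt (Module.finrank ℝ S) := by
    rw [← Real.sqrt_sq (frob_nonneg B), ← mInner_self, mInner, hBB, Matrix.trace_one]
    simp
  have hBNf : frob (Bᵀ * N) = frob N := by
    rw [← Real.sqrt_sq (frob_nonneg (Bᵀ * N)), ← mInner_self, mInner_mul_right,
      Matrix.transpose_transpose, ← Matrix.mul_assoc, hBN, mInner_self,
      Real.sqrt_sq (frob_nonneg _)]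
  have := abs_mInner_le_of_mul_eq M N B hBN
  rwa [hBfrob, hBNf] at this

/-- The columns of the difference lie in the sum of the two column spaces, of dimension at most 2k.
This is where the noise costs √k and not √n. -/
lemma abs_mInner_gram_sub_le (M : Matrix (Fin n) (Fin n) ℝ) (Z V : Matrix (Fin n) (Fin k) ℝ) :
    |mInner M (Z * Zᵀ - V * Vᵀ)| ≤
      opNorm M * Real.sqrt (2 * k) * frob (Z * Zᵀ - V * Vᵀ) := by
  set S := (Matrix.toEuclideanLin Z).range ⊔ (Matrix.toEuclideanLin V).range
  have h1 := abs_mInner_le_finrank M (Z * Zᵀ - V * Vᵀ) S fun x => by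
    have e : WithLp.toLp 2 ((Z * Zᵀ - V * Vᵀ) *ᵥ x) =
        Matrix.toEuclideanLin Z (WithLp.toLp 2 (Zᵀ *ᵥ x)) +
          Matrix.toEuclideanLin V (WithLp.toLp 2 (-(Vᵀ *ᵥ x))) := by
      rw [Matrix.sub_mulVec, ← Matrix.mulVec_mulVec, ← Matrix.mulVec_mulVec, sub_eq_add_neg,
        ← Matrix.mulVec_neg]
      rfl
    rw [e]
    exact Submodule.add_mem_sup (LinearMap.mem_range_self _ _) (LinearMap.mem_range_self _ _)
  refine h1.trans ?_
  have h2 : Module.finrank ℝ S ≤ 2 * k := by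
    have h3 := Submodule.finrank_add_le_finrank_add_finrank (Matrix.toEuclideanLin Z).range
      (Matrix.toEuclideanLin V).range
    have h4 := (Matrix.toEuclideanLin Z).finrank_range_le
    have h5 := (Matrix.toEuclideanLin V).finrank_range_le
    rw [finrank_euclideanSpace_fin] at h4 h5
    exact h3.trans (by omega)
  have h : (Module.finrank ℝ S : ℝ) ≤ 2 * k := by exact_mod_cast h2
  exact mul_le_mul_of_nonneg_right (mul_le_mul_of_nonneg_left (Real.sqrt_le_sqrt h)
    (opNorm_nonneg M)) (frob_nonneg _)

lemma sigmaMin_nonneg (Z : Matrix (Fin n) (Fin k) ℝ) : 0 ≤ sigmaMin Z :=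
  LinearMap.singularValues_nonneg _ _

/-- Expand x in an eigenbasis of ZᵀZ; the eigenvalues are the squares of the first k singular
values, of which the one with index k − 1 is the least. For k = 0 both sides vanish. -/
lemma sigmaMin_sq_mul_le (Z : Matrix (Fin n) (Fin k) ℝ) (x : Fin k → ℝ) :
    sigmaMin Z ^ 2 * ∑ i, x i ^ 2 ≤ ∑ i, (Z *ᵥ x) i ^ 2 := by
  rcases Nat.eq_zero_or_pos k with rfl | hk
  · simp
  set T := Matrix.toEuclideanLin Z with hT
  have hdim : Module.finrank ℝ (EuclideanSpace ℝ (Fin k)) = k := by simp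
  set b := T.isSymmetric_adjoint_comp_self.eigenvectorBasis hdim with hb
  set ev := T.isSymmetric_adjoint_comp_self.eigenvalues hdim with hev
  have hmin : ∀ i, sigmaMin Z ^ 2 ≤ ev i := by
    intro i
    rw [hev, ← T.sq_singularValues_fin hdim i]
    refine pow_le_pow_left₀ (sigmaMin_nonneg Z) ?_ 2
    exact T.singularValues_antitone (by have := i.2; omega)
  have hx : ∑ i, x i ^ 2 = ‖WithLp.toLp 2 x‖ ^ 2 := by
    rw [← sqrt_sum_sq_eq_norm, Real.sq_sqrt (Finset.sum_nonneg fun _ _ => sq_nonneg _)]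
  have hZx : ∑ i, (Z *ᵥ x) i ^ 2 = ‖T (WithLp.toLp 2 x)‖ ^ 2 := by
    have : T (WithLp.toLp 2 x) = WithLp.toLp 2 (Z *ᵥ x) := rfl
    rw [this, ← sqrt_sum_sq_eq_norm, Real.sq_sqrt (Finset.sum_nonneg fun _ _ => sq_nonneg _)]
  set y := WithLp.toLp 2 x
  have h1 : ‖y‖ ^ 2 = ∑ i, inner ℝ (b i) y ^ 2 := by
    rw [← b.sum_sq_norm_inner_right y]; simp
  have h2 : ‖T y‖ ^ 2 = ∑ i, ev i * inner ℝ (b i) y ^ 2 := by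
    rw [← real_inner_self_eq_norm_sq, ← LinearMap.adjoint_inner_left, ← LinearMap.comp_apply,
      ← b.sum_inner_mul_inner]
    refine Finset.sum_congr rfl fun i _ => ?_
    have h3 : inner ℝ ((T.adjoint ∘ₗ T) y) (b i) = ev i * inner ℝ y (b i) := by
      rw [T.isSymmetric_adjoint_comp_self y (b i), hb,
        T.isSymmetric_adjoint_comp_self.apply_eigenvectorBasis hdim i, ← hev, inner_smul_right]
      simp
    rw [h3, real_inner_comm]; ring
  rw [hx, hZx, h1, h2, Finset.mul_sum]
  exact Finset.sum_le_sum fun i _ => mul_le_mul_of_nonneg_right (hmin i) (sq_nonneg _)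

lemma sigmaMin_mul_frob_le (Z : Matrix (Fin n) (Fin k) ℝ) (N : Matrix (Fin k) (Fin m) ℝ) :
    sigmaMin Z * frob N ≤ frob (Z * N) := by
  refine (le_abs_self _).trans ((abs_le_of_sq_le_sq ?_ (frob_nonneg _)))
  rw [mul_pow, ← frob_transpose N, ← frob_transpose (Z * N), frob_sq, frob_sq, Finset.mul_sum]
  exact Finset.sum_le_sum fun j _ => sigmaMin_sq_mul_le Z (fun i => N i j)

lemma sqrt_mul_sigmaMin_le (Z : Matrix (Fin n) (Fin k) ℝ) :
    Real.sqrt k * sigmaMin Z ≤ frob Z := by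
  have := sigmaMin_mul_frob_le Z (1 : Matrix (Fin k) (Fin k) ℝ)
  rwa [Matrix.mul_one, frob_one, mul_comm] at this

lemma sigmaMin_le_opNorm (hk : 1 ≤ k) (Z : Matrix (Fin n) (Fin k) ℝ) :
    sigmaMin Z ≤ opNorm Z := by
  have h := (sqrt_mul_sigmaMin_le Z).trans (frob_le_sqrt_mul_opNorm Z)
  exact le_of_mul_le_mul_left h (Real.sqrt_pos.2 (by exact_mod_cast hk))

end Rank

/-! ### Procrustes alignment -/

section Procrustes

variable {n k : ℕ}

lemma isCompact_orthogonalGroup :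
    IsCompact (Matrix.orthogonalGroup (Fin k) ℝ : Set (Matrix (Fin k) (Fin k) ℝ)) := by
  have hsub : (Matrix.orthogonalGroup (Fin k) ℝ : Set (Matrix (Fin k) (Fin k) ℝ)) ⊆
      Set.pi Set.univ fun _ => Set.pi Set.univ fun _ => Set.Icc (-1 : ℝ) 1 := by
    intro R hR i _ j _
    have h := (Matrix.mem_orthogonalGroup_iff _ _).1 hR
    have h2 := congrFun (congrFun h i) i
    simp only [Matrix.mul_apply, Matrix.transpose_apply, Matrix.one_apply_eq] at h2
    have h3 : R i j * R i j ≤ 1 := by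
      rw [← h2]
      exact Finset.single_le_sum (f := fun j => R i j * R i j)
        (fun j _ => mul_self_nonneg _) (Finset.mem_univ j)
    exact abs_le.1 (abs_le_of_sq_le_sq (by nlinarith) zero_le_one)
  refine IsCompact.of_isClosed_subset (isCompact_univ_pi fun _ => isCompact_univ_pi
    fun _ => isCompact_Icc) ?_ hsub
  have : (Matrix.orthogonalGroup (Fin k) ℝ : Set (Matrix (Fin k) (Fin k) ℝ)) =
      {R | R * Rᵀ = 1} := by
    ext R
    exact Matrix.mem_orthogonalGroup_iff _ _
  rw [this]
  exact isClosed_eq (continuous_id.matrix_mul continuous_id.matrix_transpose) continuous_const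

/-- Householder reflections. One of them, or a product of two, is the only competitor needed to test
optimality of an alignment. -/
lemma reflection_mem_orthogonalGroup (u : Fin k → ℝ) (τ : ℝ) (h : τ * (u ⬝ᵥ u) = 2) :
    (1 - τ • Matrix.vecMulVec u u) ∈ Matrix.orthogonalGroup (Fin k) ℝ := by
  rw [Matrix.mem_orthogonalGroup_iff]
  have ht : (1 - τ • Matrix.vecMulVec u u)ᵀ = 1 - τ • Matrix.vecMulVec u u := by
    rw [Matrix.transpose_sub, Matrix.transpose_smul, Matrix.transpose_vecMulVec]; simp
  rw [ht, sub_mul, mul_sub, mul_sub, one_mul, mul_one, one_mul, Matrix.smul_mul, Matrix.mul_smul,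
    Matrix.vecMulVec_mul_vecMulVec, Matrix.vecMulVec_smul]
  rw [smul_smul τ (u ⬝ᵥ u), h, two_smul, smul_add]
  abel

/-- Maximizers of `tr (O N)` over orthogonal matrices: `N` is symmetric and positive. -/
lemma psd_of_forall_trace_le {N : Matrix (Fin k) (Fin k) ℝ}
    (h : ∀ O ∈ Matrix.orthogonalGroup (Fin k) ℝ, Matrix.trace (O * N) ≤ Matrix.trace N) :
    N.IsSymm ∧ ∀ x : Fin k → ℝ, 0 ≤ x ⬝ᵥ (N *ᵥ x) := by
  have htr : ∀ u v : Fin k → ℝ, ∀ M : Matrix (Fin k) (Fin k) ℝ,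
      Matrix.trace (Matrix.vecMulVec u v * M) = v ⬝ᵥ (M *ᵥ u) := by
    intro u v M
    rw [Matrix.vecMulVec_mul, Matrix.trace_vecMulVec, Matrix.dotProduct_mulVec, dotProduct_comm]
  have key : ∀ (u v : Fin k → ℝ) (τ ρ : ℝ), τ * (u ⬝ᵥ u) = 2 → ρ * (v ⬝ᵥ v) = 2 →
      τ * ρ * (u ⬝ᵥ v) * (v ⬝ᵥ (N *ᵥ u)) ≤
        τ * (u ⬝ᵥ (N *ᵥ u)) + ρ * (v ⬝ᵥ (N *ᵥ v)) := by
    intro u v τ ρ hu hv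
    have h1 := h _ (mul_mem (reflection_mem_orthogonalGroup u τ hu)
      (reflection_mem_orthogonalGroup v ρ hv))
    simp only [sub_mul, mul_sub, one_mul, mul_one, Matrix.smul_mul, Matrix.mul_smul,
      Matrix.vecMulVec_mul_vecMulVec, Matrix.vecMulVec_smul, Matrix.trace_sub,
      Matrix.trace_smul, htr, smul_eq_mul] at h1
    linarith
  constructor
  · ext i j
    rcases eq_or_ne i j with rfl | hij
    · rfl
    -- Product of the reflections along e_i and e_i + t e_j. The antisymmetric part of N enters
    -- linearly in t and the rest quadratically, so small t forces symmetry.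
    have hq : ∀ t : ℝ, t * (N j i - N i j) ≤ t ^ 2 * (N i i + N j j) := by
      intro t
      have e1 : ∀ w : Fin k → ℝ, (Pi.single i 1 : Fin k → ℝ) ⬝ᵥ w = w i := fun w => by simp
      have e2 : ∀ w : Fin k → ℝ, (Pi.single i 1 + t • Pi.single j 1 : Fin k → ℝ) ⬝ᵥ w
          = w i + t * w j := fun w => by simp [add_dotProduct]
      have ht : 0 < 1 + t ^ 2 := by positivity
      have h1 := key (Pi.single i 1) (Pi.single i 1 + t • Pi.single j 1) 2 (2 / (1 + t ^ 2))
        (by simp) (by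
          rw [e2]; simp [hij, hij.symm]; field_simp)
      simp only [e1, e2, Matrix.mulVec_add, Matrix.mulVec_smul, Pi.add_apply, Pi.smul_apply,
        Matrix.mulVec_single_one, Matrix.col_apply, smul_eq_mul, Pi.single_eq_same,
        Pi.single_eq_of_ne hij] at h1
      have h2 := mul_le_mul_of_nonneg_left h1 ht.le
      field_simp at h2
      nlinarith
    have h0 : N j i - N i j = 0 := by
      set A := N j i - N i j
      set B := N i i + N j j
      -- This t makes t²B at most the fraction |B|/(|B|+1) < 1 of tA, so tA ≤ t²B is possible only
      -- for A = 0.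
      have hA := hq (A / (|B| + 1))
      have hB : B ≤ |B| := le_abs_self B
      have hB0 : 0 ≤ |B| := abs_nonneg B
      have hB1 : 0 < |B| + 1 := by linarith
      have e1 : A / (|B| + 1) * A = A ^ 2 / (|B| + 1) := by ring
      have e2 : (A / (|B| + 1)) ^ 2 * B ≤ A ^ 2 / (|B| + 1) * (|B| / (|B| + 1)) := by
        calc (A / (|B| + 1)) ^ 2 * B ≤ (A / (|B| + 1)) ^ 2 * |B| :=
              mul_le_mul_of_nonneg_left hB (sq_nonneg _)
          _ = _ := by field_simp
      rw [e1] at hA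
      have e3 : |B| / (|B| + 1) = 1 - 1 / (|B| + 1) := by field_simp; ring
      rw [e3] at e2
      have e4 : 0 ≤ A ^ 2 / (|B| + 1) := by positivity
      have e5 : 0 < 1 / (|B| + 1) := by positivity
      have e6 : A ^ 2 / (|B| + 1) = 0 := by nlinarith
      have e7 : A ^ 2 = 0 := by
        rcases div_eq_zero_iff.1 e6 with h | h
        · exact h
        · exact absurd h hB1.ne'
      exact pow_eq_zero_iff (two_ne_zero) |>.1 e7
    rw [Matrix.transpose_apply]; linarith
  · intro x
    by_cases hx : x ⬝ᵥ x = 0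
    · rw [dotProduct_self_eq_zero.1 hx]; simp
    have h1 := h _ (reflection_mem_orthogonalGroup x (2 / (x ⬝ᵥ x)) (by field_simp))
    simp only [sub_mul, one_mul, Matrix.smul_mul, Matrix.trace_sub, Matrix.trace_smul, htr,
      smul_eq_mul] at h1
    have h2 : 0 < 2 / (x ⬝ᵥ x) := by
      have : 0 ≤ x ⬝ᵥ x := Finset.sum_nonneg fun i _ => mul_self_nonneg _
      have := lt_of_le_of_ne this (Ne.symm hx)
      positivity
    by_contra hneg
    push Not at hneg
    nlinarith

lemma procrustes_le (Z V : Matrix (Fin n) (Fin k) ℝ) {R : Matrix (Fin k) (Fin k) ℝ}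
    (hR : R ∈ Matrix.orthogonalGroup (Fin k) ℝ) : procrustes Z V ≤ frob (Z - V * R) :=
  ciInf_le (f := fun R : Matrix.orthogonalGroup (Fin k) ℝ =>
    frob (Z - V * (R : Matrix (Fin k) (Fin k) ℝ)))
    ⟨0, by rintro _ ⟨R, rfl⟩; exact frob_nonneg _⟩ ⟨R, hR⟩

lemma procrustes_nonneg (Z V : Matrix (Fin n) (Fin k) ℝ) : 0 ≤ procrustes Z V :=
  Real.iInf_nonneg fun _ => frob_nonneg _

lemma mul_transpose_of_mem {R : Matrix (Fin k) (Fin k) ℝ}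
    (hR : R ∈ Matrix.orthogonalGroup (Fin k) ℝ) : R * Rᵀ = 1 :=
  (Matrix.mem_orthogonalGroup_iff _ _).1 hR

/-- The Procrustes minimum is attained, at an alignment for which `(V R)ᵀ Z` is symmetric and
positive. -/
lemma exists_alignment (Z V : Matrix (Fin n) (Fin k) ℝ) :
    ∃ R ∈ Matrix.orthogonalGroup (Fin k) ℝ, procrustes Z V = frob (Z - V * R) ∧
      ((V * R)ᵀ * Z).IsSymm ∧ ∀ x : Fin k → ℝ, 0 ≤ x ⬝ᵥ (((V * R)ᵀ * Z) *ᵥ x) := by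
  have hcont : ContinuousOn (fun R : Matrix (Fin k) (Fin k) ℝ => frob (Z - V * R))
      (Matrix.orthogonalGroup (Fin k) ℝ : Set (Matrix (Fin k) (Fin k) ℝ)) := by
    apply Continuous.continuousOn
    unfold frob
    refine Real.continuous_sqrt.comp (continuous_finsetSum _ fun i _ =>
      continuous_finsetSum _ fun j _ => Continuous.pow ?_ 2)
    exact (continuous_const.sub (continuous_const.matrix_mul continuous_id)).matrix_elem i j
  obtain ⟨R, hR, hmin⟩ := isCompact_orthogonalGroup.exists_isMinOn ⟨1, one_mem _⟩ hcont
  have hmin' : ∀ Q ∈ Matrix.orthogonalGroup (Fin k) ℝ, frob (Z - V * R) ≤ frob (Z - V * Q) :=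
    fun Q hQ => hmin hQ
  refine ⟨R, hR, le_antisymm (procrustes_le Z V hR) (le_ciInf fun Q => hmin' Q Q.2), ?_⟩
  refine psd_of_forall_trace_le fun O hO => ?_
  -- Since ‖VQ‖_F does not depend on the rotation Q, minimizing the distance is maximizing a trace;
  -- R Oᵀ is the competitor that turns it into tr(O N) with N = (VR)ᵀZ.
  have hQ : R * Oᵀ ∈ Matrix.orthogonalGroup (Fin k) ℝ := by
    refine mul_mem hR ?_
    have : Oᵀ = star O := by
      rw [Matrix.star_eq_conjTranspose, Matrix.conjTranspose_eq_transpose_of_trivial]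
    rw [this]
    exact Unitary.star_mem hO
  have h1 := pow_le_pow_left₀ (frob_nonneg _) (hmin' _ hQ) 2
  have hn : ∀ Q ∈ Matrix.orthogonalGroup (Fin k) ℝ, frob (V * Q) ^ 2 = frob V ^ 2 := by
    intro Q hQ
    rw [← mInner_self, mInner_mul_right', Matrix.mul_assoc, mul_transpose_of_mem hQ,
      Matrix.mul_one, mInner_self]
  rw [frob_sub_sq, frob_sub_sq, hn _ hR, hn _ hQ] at h1
  have e1 : mInner Z (V * R) = Matrix.trace ((V * R)ᵀ * Z) := by
    rw [mInner_comm]; rfl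
  have e2 : mInner Z (V * (R * Oᵀ)) = Matrix.trace (O * ((V * R)ᵀ * Z)) := by
    rw [mInner_comm, mInner, ← Matrix.mul_assoc, Matrix.transpose_mul, Matrix.transpose_transpose,
      Matrix.mul_assoc]
  rw [e1, e2] at h1
  linarith

/-- With D = Z − Y, P = DᵀD and the symmetric matrix H = YᵀD, the right side equals ‖P‖² + 2‖YDᵀ‖² +
2‖H‖² + 4⟨H, P⟩. Positivity of YᵀZ gives ⟨H, P⟩ ≥ −‖YDᵀ‖², and a square absorbs the part of the
cross term that this cannot pay for. No smallness of D is needed. -/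
lemma frob_gram_sub_ge {Z Y : Matrix (Fin n) (Fin k) ℝ} (hs : (Yᵀ * Z).IsSymm)
    (hp : ∀ x : Fin k → ℝ, 0 ≤ x ⬝ᵥ ((Yᵀ * Z) *ᵥ x)) :
    2 / 3 * frob (Y * (Z - Y)ᵀ) ^ 2 ≤ frob (Z * Zᵀ - Y * Yᵀ) ^ 2 := by
  set D := Z - Y with hD
  have hZ : Z = Y + D := by rw [hD]; abel
  set P := Dᵀ * D with hP
  set H := Yᵀ * D with hH
  have hHs : Hᵀ = H := by
    have h2 : H = Yᵀ * Z - Yᵀ * Y := by rw [hH, hD, Matrix.mul_sub]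
    rw [h2, Matrix.transpose_sub, hs.eq]
    simp [Matrix.transpose_mul]
  have hexp : Z * Zᵀ - Y * Yᵀ = Y * Dᵀ + D * Yᵀ + D * Dᵀ := by
    rw [hZ, Matrix.transpose_add, Matrix.add_mul, Matrix.mul_add, Matrix.mul_add]; abel
  have n1 : frob (D * Yᵀ) ^ 2 = frob (Y * Dᵀ) ^ 2 := by
    rw [← frob_transpose (Y * Dᵀ), Matrix.transpose_mul, Matrix.transpose_transpose]
  have n2 : frob (D * Dᵀ) ^ 2 = frob P ^ 2 := by
    rw [← mInner_self, ← mInner_self]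
    simp only [mInner, hP, Matrix.transpose_mul, Matrix.transpose_transpose]
    rw [Matrix.mul_assoc, Matrix.trace_mul_comm D, Matrix.mul_assoc, Matrix.mul_assoc,
      Matrix.mul_assoc]
  have c1 : mInner (Y * Dᵀ) (D * Yᵀ) = frob H ^ 2 := by
    rw [← mInner_self, mInner, mInner, hHs, hH, Matrix.transpose_mul, Matrix.transpose_transpose,
      Matrix.mul_assoc, Matrix.trace_mul_comm D]
    simp only [Matrix.mul_assoc]
  have c2 : mInner (Y * Dᵀ) (D * Dᵀ) = mInner H P := by
    rw [← hHs]
    simp only [mInner, hH, hP, Matrix.transpose_mul, Matrix.transpose_transpose]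
    rw [Matrix.mul_assoc, Matrix.trace_mul_comm D, Matrix.mul_assoc, Matrix.mul_assoc,
      Matrix.mul_assoc]
  have c3 : mInner (D * Yᵀ) (D * Dᵀ) = mInner H P := by
    rw [← mInner_transpose, Matrix.transpose_mul, Matrix.transpose_mul,
      Matrix.transpose_transpose, Matrix.transpose_transpose, c2]
  have tot : frob (Z * Zᵀ - Y * Yᵀ) ^ 2 =
      frob P ^ 2 + 2 * frob (Y * Dᵀ) ^ 2 + 2 * frob H ^ 2 + 4 * mInner H P := by
    rw [hexp, frob_add_sq, frob_add_sq, mInner_add_left, n1, n2, c1, c2, c3]; ring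
  -- Subtracting this square leaves 2‖YDᵀ‖² + (2/9)‖H‖² + (4/3)⟨H, P⟩ ≥ (2 − 4/3)‖YDᵀ‖², the
  -- constant 2/3 of the lemma.
  have hsq : frob (P + (4 / 3 : ℝ) • H) ^ 2 =
      frob P ^ 2 + 8 / 3 * mInner H P + 16 / 9 * frob H ^ 2 := by
    rw [frob_add_sq, frob_smul, mInner_smul_right, mInner_comm P H, mul_pow, sq_abs]; ring
  have hN : 0 ≤ mInner (Yᵀ * Z) P := by
    rw [hP, mInner_mul_right, Matrix.transpose_transpose, mInner_eq]
    refine Finset.sum_nonneg fun i _ => ?_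
    have h1 := hp (fun j => D i j)
    rw [← hs.eq, Matrix.mulVec_transpose, dotProduct_comm] at h1
    exact h1
  have hH2 : mInner H P = mInner (Yᵀ * Z) P - frob (Y * Dᵀ) ^ 2 := by
    have h2 : H = Yᵀ * Z - Yᵀ * Y := by rw [hH, hD, Matrix.mul_sub]
    rw [h2, mInner_sub_left]
    congr 1
    rw [← mInner_self, mInner_mul_right]
    simp only [mInner, Matrix.transpose_mul, Matrix.transpose_transpose, Matrix.mul_assoc]
    rw [Matrix.trace_mul_comm D]
    simp only [Matrix.mul_assoc]
  nlinarith [sq_nonneg (frob (P + (4 / 3 : ℝ) • H)), sq_nonneg (frob H)]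

end Procrustes

/-! ### Sigmoid and softplus -/

section Sigmoid

lemma sigmoid_le_exp (x : ℝ) : Real.sigmoid x ≤ Real.exp x := by
  have h := Real.sigmoid_mul_rexp_neg x
  have h2 : Real.sigmoid x = Real.sigmoid (-x) * Real.exp x := by
    rw [← h, mul_assoc, ← Real.exp_add]; simp
  rw [h2]
  exact mul_le_of_le_one_left (Real.exp_pos x).le (Real.sigmoid_le_one _)

lemma sigmoid_deriv_le (x : ℝ) : Real.sigmoid x * (1 - Real.sigmoid x) ≤ 1 / 4 := by
  nlinarith [sq_nonneg (Real.sigmoid x - 1 / 2)]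

lemma sigmoid_deriv_ge {M x : ℝ} (hx : |x| ≤ M) :
    Real.exp (-M) / 4 ≤ Real.sigmoid x * (1 - Real.sigmoid x) := by
  obtain ⟨h1, h2⟩ := abs_le.1 hx
  have hM : 0 ≤ M := (abs_nonneg x).trans hx
  have e1 : Real.exp (-x) ≤ Real.exp M := Real.exp_le_exp.2 (by linarith)
  have e2 : Real.exp x ≤ Real.exp M := Real.exp_le_exp.2 h2
  have e3 : 1 ≤ Real.exp M := Real.one_le_exp hM
  have e4 : Real.exp x * Real.exp (-x) = 1 := by rw [← Real.exp_add]; simp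
  have e5 := Real.exp_pos x
  have e6 := Real.exp_pos (-x)
  rw [← Real.sigmoid_neg, Real.sigmoid_def, Real.sigmoid_def, neg_neg, ← mul_inv, Real.exp_neg,
    ← one_div, ← one_div, div_div]
  apply one_div_le_one_div_of_le (by positivity)
  nlinarith

lemma sigmoid_sub_mul_ge {M a b : ℝ} (ha : |a| ≤ M) (hb : |b| ≤ M) :
    Real.exp (-M) / 4 * (a - b) ^ 2 ≤ (Real.sigmoid a - Real.sigmoid b) * (a - b) := by
  wlog hab : b ≤ a generalizing a b
  · have := this hb ha (le_of_not_ge hab)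
    nlinarith
  have h := (convex_Icc (-M) M).mul_sub_le_image_sub_of_le_deriv
    continuous_sigmoid.continuousOn differentiable_sigmoid.differentiableOn
    (C := Real.exp (-M) / 4) (fun x hx => by
      rw [interior_Icc] at hx
      rw [Real.deriv_sigmoid]
      exact sigmoid_deriv_ge (abs_le.2 ⟨hx.1.le, hx.2.le⟩)) b (abs_le.1 hb) a (abs_le.1 ha) hab
  nlinarith

lemma sigmoid_sub_le {a b : ℝ} (hab : b ≤ a) :
    Real.sigmoid a - Real.sigmoid b ≤ 1 / 4 * (a - b) :=
  image_sub_le_mul_sub_of_deriv_le differentiable_sigmoid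
    (fun x => by rw [Real.deriv_sigmoid]; exact sigmoid_deriv_le x) hab

/-- Cocoercivity, from monotonicity and the Lipschitz constant 1/4. It needs no bound on the
arguments, so it is available at an infeasible starting point. -/
lemma sigmoid_sub_mul_ge_sq (a b : ℝ) :
    4 * (Real.sigmoid a - Real.sigmoid b) ^ 2 ≤ (Real.sigmoid a - Real.sigmoid b) * (a - b) := by
  wlog hab : b ≤ a generalizing a b
  · have := this b a (le_of_not_ge hab)
    nlinarith
  have h1 := sigmoid_sub_le hab
  have h2 := Real.sigmoid_le hab
  nlinarith

lemma sigmoid_sub_sq_le (a b : ℝ) :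
    (Real.sigmoid a - Real.sigmoid b) ^ 2 ≤ 1 / 16 * (a - b) ^ 2 := by
  wlog hab : b ≤ a generalizing a b
  · have := this b a (le_of_not_ge hab)
    nlinarith
  have h1 := sigmoid_sub_le hab
  have h2 := Real.sigmoid_le hab
  nlinarith

/-- Softplus function, an antiderivative of the sigmoid. -/
def softplus (x : ℝ) : ℝ := Real.log (1 + Real.exp x)

lemma hasDerivAt_softplus (x : ℝ) : HasDerivAt softplus (Real.sigmoid x) x := by
  have h : HasDerivAt (fun x => 1 + Real.exp x) (Real.exp x) x :=
    (Real.hasDerivAt_exp x).const_add 1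
  have h2 := h.log (by positivity)
  have h3 : Real.exp x / (1 + Real.exp x) = Real.sigmoid x := by
    rw [Real.sigmoid_def, Real.exp_neg]
    have := Real.exp_pos x
    field_simp
    ring
  rwa [h3] at h2

/-- Second-order Taylor bound with the curvature e^{−M}/4 of `sigmoid_deriv_ge`: softplus minus its
quadratic minorant is monotone along the segment from a to b, which stays in [−M, M]. -/
lemma softplus_sub_ge {M a b : ℝ} (ha : |a| ≤ M) (hb : |b| ≤ M) :
    Real.sigmoid a * (b - a) + Real.exp (-M) / 8 * (b - a) ^ 2 ≤ softplus b - softplus a := by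
  set c := Real.exp (-M) / 4
  have hd : ∀ t : ℝ, HasDerivAt (fun t => softplus (a + t * (b - a)) - t * (Real.sigmoid a * (b - a))
      - t ^ 2 * (c / 2 * (b - a) ^ 2))
      (Real.sigmoid (a + t * (b - a)) * (b - a) - Real.sigmoid a * (b - a)
        - 2 * t * (c / 2 * (b - a) ^ 2)) t := by
    intro t
    have h1 : HasDerivAt (fun t => a + t * (b - a)) (b - a) t := by
      simpa using ((hasDerivAt_id t).mul_const (b - a)).const_add a
    have h2 := (hasDerivAt_softplus (a + t * (b - a))).comp t h1
    have h3 := (hasDerivAt_id t).mul_const (Real.sigmoid a * (b - a))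
    have h4 := (hasDerivAt_pow 2 t).mul_const (c / 2 * (b - a) ^ 2)
    refine ((h2.sub h3).sub h4).congr_deriv ?_
    norm_num
  have hmono := monotoneOn_of_deriv_nonneg (convex_Icc (0 : ℝ) 1)
    (fun t _ => (hd t).continuousAt.continuousWithinAt)
    (fun t _ => (hd t).differentiableAt.differentiableWithinAt) (fun t ht => by
      rw [interior_Icc] at ht
      rw [(hd t).deriv]
      have hat : |a + t * (b - a)| ≤ M := by
        rw [abs_le] at *
        constructor <;> nlinarith [ht.1, ht.2]
      have h1 := sigmoid_sub_mul_ge hat ha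
      have h2 : t * (Real.exp (-M) / 4 * (b - a) ^ 2 * t) ≤
          t * ((Real.sigmoid (a + t * (b - a)) - Real.sigmoid a) * (b - a)) := by
        calc _ = Real.exp (-M) / 4 * (a + t * (b - a) - a) ^ 2 := by ring
          _ ≤ _ := h1
          _ = _ := by ring
      have h3 := le_of_mul_le_mul_left h2 ht.1
      have h4 : 2 * t * (c / 2 * (b - a) ^ 2) = Real.exp (-M) / 4 * (b - a) ^ 2 * t := by
        simp only [c]; ring
      rw [h4]
      linarith)
  have h := hmono (Set.left_mem_Icc.2 zero_le_one) (Set.right_mem_Icc.2 zero_le_one) zero_le_one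
  simp only [zero_mul, add_zero, one_mul, add_sub_cancel, c] at h
  norm_num at h
  linarith

lemma softplus_sub_le (a b : ℝ) :
    softplus b - softplus a ≤ Real.sigmoid a * (b - a) + 1 / 8 * (b - a) ^ 2 := by
  have hd : ∀ t : ℝ, HasDerivAt (fun t => t * (Real.sigmoid a * (b - a))
      + t ^ 2 * (1 / 8 * (b - a) ^ 2) - softplus (a + t * (b - a)))
      (Real.sigmoid a * (b - a) + 2 * t * (1 / 8 * (b - a) ^ 2)
        - Real.sigmoid (a + t * (b - a)) * (b - a)) t := by
    intro t
    have h1 : HasDerivAt (fun t => a + t * (b - a)) (b - a) t := by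
      simpa using ((hasDerivAt_id t).mul_const (b - a)).const_add a
    have h2 := (hasDerivAt_softplus (a + t * (b - a))).comp t h1
    have h3 := (hasDerivAt_id t).mul_const (Real.sigmoid a * (b - a))
    have h4 := (hasDerivAt_pow 2 t).mul_const (1 / 8 * (b - a) ^ 2)
    refine ((h3.add h4).sub h2).congr_deriv ?_
    norm_num
  have hmono := monotoneOn_of_deriv_nonneg (convex_Icc (0 : ℝ) 1)
    (fun t _ => (hd t).continuousAt.continuousWithinAt)
    (fun t _ => (hd t).differentiableAt.differentiableWithinAt) (fun t ht => by
      rw [interior_Icc] at ht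
      rw [(hd t).deriv]
      rcases le_total a b with hab | hab
      · have h1 := sigmoid_sub_le (a := a + t * (b - a)) (b := a) (by nlinarith [ht.1])
        nlinarith
      · have h1 := sigmoid_sub_le (b := a + t * (b - a)) (a := a) (by nlinarith [ht.1])
        nlinarith)
  have h := hmono (Set.left_mem_Icc.2 zero_le_one) (Set.right_mem_Icc.2 zero_le_one) zero_le_one
  simp only [zero_mul, add_zero, one_mul, add_sub_cancel] at h
  norm_num at h
  linarith

end Sigmoid

/-! ### Projections -/

section Projection

variable {m n : ℕ}

/-- First-order optimality at s = 0 without derivatives. Applied to a segment from the projection to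
another point of a convex set, it gives the obtuse angle property `mInner_proj_le`. -/
lemma nonpos_of_forall_mul_le_sq_mul {a b : ℝ}
    (h : ∀ s : ℝ, 0 < s → s ≤ 1 → 2 * s * a ≤ s ^ 2 * b) : a ≤ 0 := by
  by_contra ha
  push Not at ha
  have h1 := h 1 one_pos le_rfl
  have hb : 0 < b := by linarith
  have h2 := h (min 1 (a / b)) (lt_min one_pos (by positivity)) (min_le_left _ _)
  set s := min 1 (a / b)
  have hs : 0 < s := lt_min one_pos (by positivity)
  have hsb : s * b ≤ a := by
    have : s ≤ a / b := min_le_right _ _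
    rwa [le_div_iff₀ hb] at this
  nlinarith

lemma mInner_proj_le {C : Set (Matrix (Fin m) (Fin n) ℝ)} {y x : Matrix (Fin m) (Fin n) ℝ}
    (hx : IsProj (fun V W => frob (V - W)) C y x) (hC : Convex ℝ C)
    {w : Matrix (Fin m) (Fin n) ℝ} (hw : w ∈ C) : mInner (y - x) (w - x) ≤ 0 := by
  refine nonpos_of_forall_mul_le_sq_mul (b := frob (w - x) ^ 2) fun s h0 h1 => ?_
  have hmem : x + s • (w - x) ∈ C := hC.add_smul_sub_mem hx.1 hw ⟨h0.le, h1⟩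
  have h := pow_le_pow_left₀ (frob_nonneg _) (hx.2 _ hmem) 2
  have e : y - (x + s • (w - x)) = (y - x) - s • (w - x) := by abel
  simp only [e] at h
  rw [frob_sub_sq (y - x), frob_smul, mInner_smul_right, mul_pow, sq_abs] at h
  linarith

/-- Projecting onto a convex set does not increase the distance to its points. -/
lemma frob_proj_sub_le {C : Set (Matrix (Fin m) (Fin n) ℝ)} {y x : Matrix (Fin m) (Fin n) ℝ}
    (hx : IsProj (fun V W => frob (V - W)) C y x) (hC : Convex ℝ C)
    {w : Matrix (Fin m) (Fin n) ℝ} (hw : w ∈ C) : frob (x - w) ^ 2 ≤ frob (y - w) ^ 2 := by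
  have h := mInner_proj_le hx hC hw
  have e : y - w = (y - x) - (w - x) := by abel
  rw [e, frob_sub_sq (y - x), frob_sub_comm x w]
  nlinarith [sq_nonneg (frob (y - x))]

/-- A projected step from a point of the convex set `C` is well aligned with the step. -/
lemma frob_proj_step_sq_le {C : Set (Matrix (Fin m) (Fin n) ℝ)} {z g x : Matrix (Fin m) (Fin n) ℝ}
    (hx : IsProj (fun V W => frob (V - W)) C (z + g) x) (hC : Convex ℝ C) (hz : z ∈ C) :
    frob (x - z) ^ 2 ≤ mInner g (x - z) := by
  have h := mInner_proj_le hx hC hz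
  have e1 : z + g - x = g - (x - z) := by abel
  have e2 : z - x = -(x - z) := by abel
  rw [e1, e2, mInner_neg_right, mInner_sub_left, mInner_self] at h
  linarith

/-- A vector as a one-column matrix. -/
def colM (a : Fin n → ℝ) : Matrix (Fin n) (Fin 1) ℝ := Matrix.of fun i _ => a i

lemma frob_colM_sq (a : Fin n → ℝ) : frob (colM a) ^ 2 = ∑ i, a i ^ 2 := by
  simp [frob_sq, colM]

lemma mInner_colM (a b : Fin n → ℝ) : mInner (colM a) (colM b) = ∑ i, a i * b i := by
  simp [mInner_eq, colM]

lemma colM_sub (a b : Fin n → ℝ) : colM (a - b) = colM a - colM b := rfl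

lemma colM_add (a b : Fin n → ℝ) : colM (a + b) = colM a + colM b := rfl

lemma IsProj.colM {C : Set (Fin n → ℝ)} {y x : Fin n → ℝ} (hx : IsProj vecDist C y x) :
    IsProj (fun V W => frob (V - W)) (colM '' C) (colM y) (colM x) := by
  have hd : ∀ a b : Fin n → ℝ, vecDist a b = frob (LatentSpace.colM a - LatentSpace.colM b) := by
    intro a b
    rw [vecDist, frob]
    simp [LatentSpace.colM]
  refine ⟨Set.mem_image_of_mem _ hx.1, ?_⟩
  rintro _ ⟨w, hw, rfl⟩
  simpa only [hd] using hx.2 w hw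

lemma convex_image_colM {C : Set (Fin n → ℝ)} (hC : Convex ℝ C) : Convex ℝ (colM '' C) :=
  hC.is_linear_image (f := (colM : (Fin n → ℝ) → Matrix (Fin n) (Fin 1) ℝ))
    ⟨fun _ _ => rfl, fun _ _ => rfl⟩

lemma sum_proj_sub_le {C : Set (Fin n → ℝ)} {y x : Fin n → ℝ} (hx : IsProj vecDist C y x)
    (hC : Convex ℝ C) {w : Fin n → ℝ} (hw : w ∈ C) :
    ∑ i, (x i - w i) ^ 2 ≤ ∑ i, (y i - w i) ^ 2 := by
  have := frob_proj_sub_le hx.colM (convex_image_colM hC) (Set.mem_image_of_mem _ hw)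
  rw [← colM_sub, ← colM_sub, frob_colM_sq, frob_colM_sq] at this
  exact this

lemma sum_proj_step_sq_le {C : Set (Fin n → ℝ)} {z g x : Fin n → ℝ}
    (hx : IsProj vecDist C (z + g) x) (hC : Convex ℝ C) (hz : z ∈ C) :
    ∑ i, (x i - z i) ^ 2 ≤ ∑ i, g i * (x i - z i) := by
  have := hx.colM
  rw [colM_add] at this
  have := frob_proj_step_sq_le this (convex_image_colM hC) (Set.mem_image_of_mem _ hz)
  rw [← colM_sub, frob_colM_sq, mInner_colM] at this
  exact this

lemma IsProj.colM_single {C : Set ℝ} {y x : ℝ} (hx : IsProj (fun a b => |a - b|) C y x) :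
    IsProj vecDist ((fun b (_ : Fin 1) => b) '' C) (fun _ => y) (fun _ => x) := by
  have hd : ∀ a b : ℝ, vecDist (fun _ : Fin 1 => a) (fun _ => b) = |a - b| := fun a b => by
    simp [vecDist, Real.sqrt_sq_eq_abs]
  refine ⟨Set.mem_image_of_mem _ hx.1, ?_⟩
  rintro _ ⟨w, hw, rfl⟩
  simpa only [hd] using hx.2 w hw

lemma convex_image_single {C : Set ℝ} (hC : Convex ℝ C) :
    Convex ℝ ((fun b (_ : Fin 1) => b) '' C) :=
  hC.is_linear_image (f := fun b (_ : Fin 1) => b) ⟨fun _ _ => rfl, fun _ _ => rfl⟩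

lemma sq_proj_sub_le {C : Set ℝ} {y x w : ℝ} (hx : IsProj (fun a b => |a - b|) C y x)
    (hC : Convex ℝ C) (hw : w ∈ C) : (x - w) ^ 2 ≤ (y - w) ^ 2 := by
  have := sum_proj_sub_le hx.colM_single (convex_image_single hC) (Set.mem_image_of_mem _ hw)
  simpa using this

lemma sq_proj_step_le {C : Set ℝ} {z g x : ℝ} (hx : IsProj (fun a b => |a - b|) C (z + g) x)
    (hC : Convex ℝ C) (hz : z ∈ C) : (x - z) ^ 2 ≤ g * (x - z) := by
  have := sum_proj_step_sq_le (z := fun _ : Fin 1 => z) (g := fun _ => g) hx.colM_single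
    (convex_image_single hC) (Set.mem_image_of_mem _ hz)
  simpa using this

end Projection

/-! ### Geometry of the parameter space -/

section Model

variable {n k : ℕ}

lemma frob_colOnes_sq (a : Fin n → ℝ) : frob (colOnes a) ^ 2 = n * ∑ i, a i ^ 2 := by
  simp [frob_sq, colOnes, Matrix.vecMulVec_apply, Finset.mul_sum]

lemma mInner_colOnes (G : Matrix (Fin n) (Fin n) ℝ) (a : Fin n → ℝ) :
    mInner G (colOnes a) = ∑ i, (G *ᵥ fun _ => (1 : ℝ)) i * a i := by
  simp [mInner_eq, colOnes, Matrix.vecMulVec_apply, Matrix.mulVec, dotProduct, Finset.sum_mul]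

lemma mInner_colOnes_transpose {G : Matrix (Fin n) (Fin n) ℝ} (hG : G.IsSymm) (a : Fin n → ℝ) :
    mInner G (colOnes a)ᵀ = mInner G (colOnes a) := by
  conv_lhs => rw [← hG.eq]
  exact mInner_transpose _ _

lemma colOnes_sub (a b : Fin n → ℝ) : colOnes (a - b) = colOnes a - colOnes b := by
  ext i j; simp [colOnes, Matrix.vecMulVec_apply]

lemma theta_sub (X : Matrix (Fin n) (Fin n) ℝ) (p q : Params n k) :
    p.theta X - q.theta X = (p.Z * p.Zᵀ - q.Z * q.Zᵀ) +
      (colOnes (p.α - q.α) + (colOnes (p.α - q.α))ᵀ) + (p.β - q.β) • X := by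
  rw [Params.theta, Params.theta, colOnes_sub, Matrix.transpose_sub, sub_smul]
  abel

lemma theta_isSymm {X : Matrix (Fin n) (Fin n) ℝ} (hX : X.IsSymm) (p : Params n k) :
    (p.theta X).IsSymm := by
  rw [Matrix.IsSymm, Params.theta]
  simp only [Matrix.transpose_add, Matrix.transpose_transpose, Matrix.transpose_smul,
    Matrix.transpose_mul, hX.eq]
  abel

lemma sigmoidM_isSymm {T : Matrix (Fin n) (Fin n) ℝ} (hT : T.IsSymm) : (sigmoidM T).IsSymm :=
  hT.map _

lemma colSum_eq_zero {Z : Matrix (Fin n) (Fin k) ℝ} (hZ : Centered Z) (j : Fin k) :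
    ∑ i, Z i j = 0 := by
  have h := hZ
  rw [Centered, Matrix.sub_mul, Matrix.one_mul, sub_eq_self] at h
  rcases Nat.eq_zero_or_pos n with rfl | hn
  · simp
  have h2 := congrFun (congrFun h ⟨0, hn⟩) j
  simp only [Matrix.smul_apply, Matrix.mul_apply, Matrix.of_apply, mul_one,
    smul_eq_mul, Matrix.zero_apply, ← Finset.mul_sum] at h2
  have hn' : (n : ℝ)⁻¹ ≠ 0 := by positivity
  exact (mul_eq_zero.1 h2).resolve_left hn'

lemma radius_nonneg {M₁ : ℝ} (hM : 0 ≤ M₁) (X : Matrix (Fin n) (Fin n) ℝ) : 0 ≤ radius M₁ X := by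
  unfold radius; split_ifs <;> linarith

lemma convex_CZ (M₁ : ℝ) (X : Matrix (Fin n) (Fin n) ℝ) : Convex ℝ (CZ k M₁ X) := by
  intro Z hZ V hV a b ha hb hab
  refine ⟨?_, fun i => ?_⟩
  · have h1 := hZ.1
    have h2 := hV.1
    unfold Centered at *
    rw [Matrix.mul_add, Matrix.mul_smul, Matrix.mul_smul, h1, h2]
  · have h1 := hZ.2 i
    have h2 := hV.2 i
    have h3 : ∀ j, (a • Z + b • V) i j ^ 2 ≤ a * Z i j ^ 2 + b * V i j ^ 2 := fun j => by
      simp only [Matrix.add_apply, Matrix.smul_apply, smul_eq_mul]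
      have hb' : b = 1 - a := by linarith
      subst hb'
      nlinarith [mul_nonneg (mul_nonneg ha hb) (sq_nonneg (Z i j - V i j))]
    calc _ ≤ ∑ j, (a * Z i j ^ 2 + b * V i j ^ 2) := Finset.sum_le_sum fun j _ => h3 j
      _ = a * ∑ j, Z i j ^ 2 + b * ∑ j, V i j ^ 2 := by
        rw [Finset.sum_add_distrib, Finset.mul_sum, Finset.mul_sum]
      _ ≤ a * radius M₁ X + b * radius M₁ X := by gcongr
      _ = radius M₁ X := by rw [← add_mul, hab, one_mul]

lemma convex_Cα (M₁ : ℝ) (X : Matrix (Fin n) (Fin n) ℝ) : Convex ℝ (Cα M₁ X) := by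
  intro x hx y hy a b ha hb hab i
  calc |(a • x + b • y) i| ≤ |a * x i| + |b * y i| := abs_add_le _ _
    _ = a * |x i| + b * |y i| := by rw [abs_mul, abs_mul, abs_of_nonneg ha, abs_of_nonneg hb]
    _ ≤ a * radius M₁ X + b * radius M₁ X := by gcongr; exacts [hx i, hy i]
    _ = radius M₁ X := by rw [← add_mul, hab, one_mul]

lemma convex_Cβ (M₁ : ℝ) (X : Matrix (Fin n) (Fin n) ℝ) : Convex ℝ (Cβ M₁ X) := by
  intro x hx y hy a b ha hb hab i j
  calc |a • x + b • y| * |X i j| ≤ (|a * x| + |b * y|) * |X i j| := by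
        gcongr; exact abs_add_le _ _
    _ = a * (|x| * |X i j|) + b * (|y| * |X i j|) := by
        rw [abs_mul, abs_mul, abs_of_nonneg ha, abs_of_nonneg hb]; ring
    _ ≤ a * radius M₁ X + b * radius M₁ X := by gcongr; exacts [hx i j, hy i j]
    _ = radius M₁ X := by rw [← add_mul, hab, one_mul]

lemma gram_apply_le {Z : Matrix (Fin n) (Fin k) ℝ} {r : ℝ} (hZ : ∀ i, ∑ j, Z i j ^ 2 ≤ r)
    (i j : Fin n) : |(Z * Zᵀ) i j| ≤ r := by
  have hr : 0 ≤ r := (Finset.sum_nonneg fun _ _ => sq_nonneg _).trans (hZ i)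
  refine abs_le_of_sq_le_sq ?_ hr
  rw [Matrix.mul_apply]
  refine (Finset.sum_mul_sq_le_sq_mul_sq Finset.univ (fun l => Z i l) (fun l => Zᵀ l j)).trans ?_
  rw [sq r]
  exact mul_le_mul (hZ i) (hZ j) (Finset.sum_nonneg fun _ _ => sq_nonneg _) hr

/-- The constraint sets force `|Θ i j| ≤ M₁`. -/
lemma abs_theta_le {M₁ : ℝ} {X : Matrix (Fin n) (Fin n) ℝ} {p : Params n k}
    (hZ : p.Z ∈ CZ k M₁ X) (hα : p.α ∈ Cα M₁ X) (hβ : X ≠ 0 → p.β ∈ Cβ M₁ X) (i j : Fin n) :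
    |p.theta X i j| ≤ M₁ := by
  have h1 := hα i
  have h2 := hα j
  have h3 := gram_apply_le hZ.2 i j
  have h4 : p.theta X i j = p.α i + p.α j + p.β * X i j + (p.Z * p.Zᵀ) i j := by
    simp [Params.theta, colOnes, Matrix.vecMulVec_apply]
  rw [h4]
  rw [abs_le] at *
  by_cases hX : X = 0
  · rw [radius, if_pos hX] at *
    rw [hX, Matrix.zero_apply, mul_zero]
    constructor <;> linarith
  · have h5 := hβ hX i j
    rw [← abs_mul, abs_le] at h5
    rw [radius, if_neg hX] at *
    constructor <;> linarith

/-- Squared error of the three components of `Θ`. -/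
def compErr (X : Matrix (Fin n) (Fin n) ℝ) (q p : Params n k) : ℝ :=
  errG q p + 2 * (n * ∑ i, (p.α i - q.α i) ^ 2) + (p.β - q.β) ^ 2 * frob X ^ 2

/-- Lyapunov function of projected gradient descent. -/
def lyap (X : Matrix (Fin n) (Fin n) ℝ) (q p : Params n k) : ℝ :=
  opNorm q.Z ^ 2 * procrustes p.Z q.Z ^ 2 + 2 * (n * ∑ i, (p.α i - q.α i) ^ 2)
    + 2 * ((p.β - q.β) ^ 2 * frob X ^ 2)

lemma errMetric_eq (X : Matrix (Fin n) (Fin n) ℝ) (q p : Params n k) :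
    errMetric X q p = opNorm q.Z ^ 2 * procrustes p.Z q.Z ^ 2
      + 2 * (n * ∑ i, (p.α i - q.α i) ^ 2) + (p.β - q.β) ^ 2 * frob X ^ 2 := by
  rw [errMetric, frob_colOnes_sq, frob_smul, mul_pow, sq_abs]; rfl

lemma sum_sub_sq_nonneg (p q : Params n k) : 0 ≤ n * ∑ i, (p.α i - q.α i) ^ 2 :=
  mul_nonneg (Nat.cast_nonneg n) (Finset.sum_nonneg fun _ _ => sq_nonneg _)

lemma errG_nonneg (p q : Params n k) : 0 ≤ errG q p := sq_nonneg _

lemma compErr_nonneg (X : Matrix (Fin n) (Fin n) ℝ) (q p : Params n k) : 0 ≤ compErr X q p := by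
  have := sum_sub_sq_nonneg p q
  have := errG_nonneg p q
  unfold compErr; positivity

lemma errMetric_nonneg (X : Matrix (Fin n) (Fin n) ℝ) (q p : Params n k) :
    0 ≤ errMetric X q p := by
  rw [errMetric_eq]
  have := sum_sub_sq_nonneg p q
  positivity

lemma errMetric_le_lyap (X : Matrix (Fin n) (Fin n) ℝ) (q p : Params n k) :
    errMetric X q p ≤ lyap X q p := by
  rw [errMetric_eq, lyap]
  have : 0 ≤ (p.β - q.β) ^ 2 * frob X ^ 2 := by positivity
  linarith

lemma lyap_nonneg (X : Matrix (Fin n) (Fin n) ℝ) (q p : Params n k) : 0 ≤ lyap X q p :=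
  (errMetric_nonneg X q p).trans (errMetric_le_lyap X q p)

/-- The two quantities differ only by the weight 2 on the covariate part. This conversion is the
origin of the factor 2 in front of the geometric term of the theorem. -/
lemma lyap_le_two_mul_errMetric (X : Matrix (Fin n) (Fin n) ℝ) (q p : Params n k) :
    lyap X q p ≤ 2 * errMetric X q p := by
  rw [errMetric_eq, lyap]
  have := sum_sub_sq_nonneg p q
  have : 0 ≤ opNorm q.Z ^ 2 * procrustes p.Z q.Z ^ 2 := by positivity
  linarith

lemma frob_alpha_sq_le (a : Fin n → ℝ) :
    frob (colOnes a + (colOnes a)ᵀ) ≤ 2 * Real.sqrt (n * ∑ i, a i ^ 2) := by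
  refine (frob_add_le _ _).trans ?_
  rw [frob_transpose, ← frob_colOnes_sq, Real.sqrt_sq (frob_nonneg _)]
  linarith

lemma errTheta_le (X : Matrix (Fin n) (Fin n) ℝ) (q p : Params n k) :
    errTheta X q p ≤ 4 * compErr X q p := by
  have h : frob (p.theta X - q.theta X) ≤ frob (p.Z * p.Zᵀ - q.Z * q.Zᵀ) +
      2 * Real.sqrt (n * ∑ i, (p.α i - q.α i) ^ 2) + |p.β - q.β| * frob X := by
    rw [theta_sub]
    refine (frob_add_le _ _).trans ?_
    rw [frob_smul]
    gcongr
    refine (frob_add_le _ _).trans ?_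
    gcongr
    exact frob_alpha_sq_le _
  have h2 := pow_le_pow_left₀ (frob_nonneg _) h 2
  rw [errTheta, compErr, errG, ← sq_abs (p.β - q.β)]
  refine h2.trans ?_
  have h3 := Real.sq_sqrt (sum_sub_sq_nonneg p q)
  set x := frob (p.Z * p.Zᵀ - q.Z * q.Zᵀ)
  set y := Real.sqrt (n * ∑ i, (p.α i - q.α i) ^ 2)
  set z := |p.β - q.β| * frob X with hz
  rw [← h3, ← mul_pow, ← hz]
  nlinarith [sq_nonneg (x - y), sq_nonneg (x - z), sq_nonneg (y - z)]

/-- Centering means Zᵀ1 = 0, so the Gram part of Θ is exactly orthogonal to the degree part. -/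
lemma mInner_gram_alpha {Z : Matrix (Fin n) (Fin k) ℝ} (hZ : Centered Z) (a : Fin n → ℝ) :
    mInner (Z * Zᵀ) (colOnes a) = 0 := by
  rw [mInner_colOnes]
  refine Finset.sum_eq_zero fun i _ => ?_
  have : (Zᵀ *ᵥ fun _ => (1 : ℝ)) = 0 := by
    ext j
    simp [Matrix.mulVec, dotProduct, colSum_eq_zero hZ j]
  rw [← Matrix.mulVec_mulVec, this, Matrix.mulVec_zero]
  simp

lemma gram_isSymm (Z : Matrix (Fin n) (Fin k) ℝ) : (Z * Zᵀ).IsSymm := by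
  rw [Matrix.IsSymm, Matrix.transpose_mul, Matrix.transpose_transpose]

lemma abs_mInner_colOnes_le (W : Matrix (Fin n) (Fin n) ℝ) (a : Fin n → ℝ) :
    |mInner W (colOnes a)| ≤ opNorm W * Real.sqrt (n * ∑ i, a i ^ 2) := by
  have h := abs_quadForm_le W a (fun _ => 1)
  rw [mInner_colOnes]
  have e : ∑ i, (W *ᵥ fun _ => (1 : ℝ)) i * a i = a ⬝ᵥ (W *ᵥ fun _ => (1 : ℝ)) :=
    Finset.sum_congr rfl fun i _ => mul_comm _ _
  rw [e]
  refine h.trans (le_of_eq ?_)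
  rw [mul_comm (n : ℝ), Real.sqrt_mul (Finset.sum_nonneg fun _ _ => sq_nonneg _)]
  simp

/-- The components of `Θ - Θ⋆` are nearly orthogonal when `X` has a large stable rank. -/
lemma compErr_le_errTheta {X : Matrix (Fin n) (Fin n) ℝ} (hX : X.IsSymm) (hk : 1 ≤ k)
    {q p : Params n k} (hst : 8 * Real.sqrt k * opNorm X ≤ frob X)
    (hp : Centered p.Z) (hq : Centered q.Z) :
    compErr X q p ≤ 2 * errTheta X q p := by
  set a := p.α - q.α with ha
  set b := p.β - q.β with hb
  set G := p.Z * p.Zᵀ - q.Z * q.Zᵀ with hG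
  have hGs : G.IsSymm := (gram_isSymm _).sub (gram_isSymm _)
  have e1 : mInner G (colOnes a + (colOnes a)ᵀ) = 0 := by
    rw [mInner_add_right, mInner_colOnes_transpose hGs, hG, mInner_sub_left,
      mInner_gram_alpha hp, mInner_gram_alpha hq]; simp
  have e2 : 2 * (n * ∑ i, a i ^ 2) ≤ frob (colOnes a + (colOnes a)ᵀ) ^ 2 := by
    rw [frob_add_sq, frob_transpose, frob_colOnes_sq]
    have : mInner (colOnes a) (colOnes a)ᵀ = (∑ i, a i) ^ 2 := by
      rw [mInner_eq, sq, Finset.sum_mul_sum]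
      simp [colOnes, Matrix.vecMulVec_apply]
    rw [this]
    nlinarith [sq_nonneg (∑ i, a i)]
  -- Both the Gram part and the degree part have low rank, so their inner products with X involve
  -- √k‖X‖_op, a small fraction of ‖X‖_F by the stable rank assumption.
  have e3 : |mInner G X| ≤ frob X / 8 * Real.sqrt 2 * frob G := by
    rw [mInner_comm]
    refine (abs_mInner_gram_sub_le X _ _).trans ?_
    rw [Real.sqrt_mul zero_le_two]
    refine mul_le_mul_of_nonneg_right ?_ (frob_nonneg _)
    nlinarith [Real.sqrt_nonneg 2, Real.sqrt_nonneg k]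
  have e4 : |mInner (colOnes a + (colOnes a)ᵀ) X| ≤
      frob X / 4 * Real.sqrt (n * ∑ i, a i ^ 2) := by
    rw [mInner_comm, mInner_add_right, mInner_colOnes_transpose hX, ← two_mul, abs_mul, abs_two]
    have h1 := abs_mInner_colOnes_le X a
    have h2 : 1 ≤ Real.sqrt k := by
      rw [Real.one_le_sqrt]; exact_mod_cast hk
    have h3 : opNorm X ≤ frob X / 8 := by nlinarith [opNorm_nonneg X]
    have h4 := mul_le_mul_of_nonneg_right h3 (Real.sqrt_nonneg (n * ∑ i, a i ^ 2))
    linarith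
  have tot : errTheta X q p = frob G ^ 2 + frob (colOnes a + (colOnes a)ᵀ) ^ 2 +
      b ^ 2 * frob X ^ 2 + 2 * b * mInner G X
      + 2 * b * mInner (colOnes a + (colOnes a)ᵀ) X := by
    rw [errTheta, theta_sub, frob_add_sq, frob_add_sq, e1, frob_smul, mul_pow, sq_abs,
      mInner_smul_right, mInner_add_left]
    ring
  have hab : ∀ c d : ℝ, -(|c| * |d|) ≤ c * d := fun c d => by
    rw [← abs_mul]; exact neg_abs_le _
  have c1 := hab b (mInner G X)
  have c2 := hab b (mInner (colOnes a + (colOnes a)ᵀ) X)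
  have c3 := mul_le_mul_of_nonneg_left e3 (abs_nonneg b)
  have c4 := mul_le_mul_of_nonneg_left e4 (abs_nonneg b)
  have hs2 : Real.sqrt 2 ≤ 3 / 2 := by
    rw [Real.sqrt_le_left (by norm_num)]; norm_num
  have hna : 0 ≤ n * ∑ i, a i ^ 2 := sum_sub_sq_nonneg p q
  have hsq := Real.sq_sqrt hna
  set y := Real.sqrt (n * ∑ i, a i ^ 2)
  set z := |b| * frob X with hz
  have hz2 : b ^ 2 * frob X ^ 2 = z ^ 2 := by rw [hz, mul_pow, sq_abs]
  have hz0 : 0 ≤ z := mul_nonneg (abs_nonneg _) (frob_nonneg _)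
  have hcomp : compErr X q p = frob G ^ 2 + 2 * (n * ∑ i, a i ^ 2) + b ^ 2 * frob X ^ 2 := rfl
  have c5 : |b| * (frob X / 8 * Real.sqrt 2 * frob G) ≤ 3 / 16 * (z * frob G) := by
    have : |b| * (frob X / 8 * Real.sqrt 2 * frob G) = Real.sqrt 2 / 8 * (z * frob G) := by
      rw [hz]; ring
    rw [this]
    have h0 : 0 ≤ z * frob G := mul_nonneg hz0 (frob_nonneg _)
    nlinarith
  have c6 : |b| * (frob X / 4 * y) = 1 / 4 * (z * y) := by rw [hz]; ring
  rw [hcomp, tot, hz2]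
  rw [← hsq] at e2 ⊢
  nlinarith [sq_nonneg (z - frob G), sq_nonneg (z - y), sq_nonneg z, sq_nonneg y,
    sq_nonneg (frob G)]

/-- The noise level `ζ` controls the noise matrix `W` against differences of parameters. -/
structure NoiseLevel (k : ℕ) (W X : Matrix (Fin n) (Fin n) ℝ) (ζ : ℝ) : Prop where
  op : 2 * opNorm W ≤ ζ
  cov : |mInner W X| ≤ Real.sqrt k * ζ * frob X

lemma NoiseLevel.nonneg {W X : Matrix (Fin n) (Fin n) ℝ} {ζ : ℝ} (h : NoiseLevel k W X ζ) :
    0 ≤ ζ := by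
  have := h.op
  have := opNorm_nonneg W
  linarith

lemma NoiseLevel.abs_gram_le {W X : Matrix (Fin n) (Fin n) ℝ} {ζ : ℝ} (h : NoiseLevel k W X ζ)
    (q p : Params n k) :
    |mInner W (p.Z * p.Zᵀ - q.Z * q.Zᵀ)| ≤ Real.sqrt k * ζ * Real.sqrt (compErr X q p) := by
  refine (abs_mInner_gram_sub_le W _ _).trans ?_
  have h1 : frob (p.Z * p.Zᵀ - q.Z * q.Zᵀ) ≤ Real.sqrt (compErr X q p) := by
    apply Real.le_sqrt_of_sq_le
    have := sum_sub_sq_nonneg p q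
    have : 0 ≤ (p.β - q.β) ^ 2 * frob X ^ 2 := by positivity
    rw [compErr, errG]; linarith
  have hs2 : Real.sqrt 2 ≤ 2 := by
    rw [Real.sqrt_le_left (by norm_num)]; norm_num
  have h2 : opNorm W * Real.sqrt (2 * k) ≤ Real.sqrt k * ζ := by
    rw [Real.sqrt_mul zero_le_two]
    have h3 := h.op
    have h4 := opNorm_nonneg W
    have h5 := Real.sqrt_nonneg k
    calc opNorm W * (Real.sqrt 2 * Real.sqrt k) = Real.sqrt 2 * opNorm W * Real.sqrt k := by ring
      _ ≤ ζ * Real.sqrt k := by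
        refine mul_le_mul_of_nonneg_right ?_ h5
        nlinarith
      _ = _ := mul_comm _ _
  have := h.nonneg
  exact mul_le_mul h2 h1 (frob_nonneg _) (by positivity)

/-- Each of the three components costs √k ζ: the Gram part by its rank 2k, the degree part by the
operator norm alone, the covariate part by the clause `cov`. -/
lemma NoiseLevel.abs_theta_le {W X : Matrix (Fin n) (Fin n) ℝ} {ζ : ℝ} (h : NoiseLevel k W X ζ)
    (hW : W.IsSymm) (hk : 1 ≤ k) (q p : Params n k) :
    |mInner W (p.theta X - q.theta X)| ≤
      3 * (Real.sqrt k * ζ) * Real.sqrt (compErr X q p) := by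
  have h1 := h.abs_gram_le q p
  have hζ := h.nonneg
  have hk' : 1 ≤ Real.sqrt k := by rw [Real.one_le_sqrt]; exact_mod_cast hk
  have hna := sum_sub_sq_nonneg p q
  have hE := errG_nonneg p q
  have hb0 : 0 ≤ (p.β - q.β) ^ 2 * frob X ^ 2 := by positivity
  have h2 : |mInner W (colOnes (p.α - q.α) + (colOnes (p.α - q.α))ᵀ)| ≤
      Real.sqrt k * ζ * Real.sqrt (compErr X q p) := by
    rw [mInner_add_right, mInner_colOnes_transpose hW, ← two_mul, abs_mul, abs_two]
    have h3 := abs_mInner_colOnes_le W (p.α - q.α)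
    have h4 : Real.sqrt (n * ∑ i, (p.α - q.α) i ^ 2) ≤ Real.sqrt (compErr X q p) := by
      apply Real.sqrt_le_sqrt
      change n * ∑ i, (p.α i - q.α i) ^ 2 ≤ _
      rw [compErr]; linarith
    calc 2 * |mInner W (colOnes (p.α - q.α))| ≤
          2 * opNorm W * Real.sqrt (n * ∑ i, (p.α - q.α) i ^ 2) := by linarith
      _ ≤ (Real.sqrt k * ζ) * Real.sqrt (compErr X q p) := by
        refine mul_le_mul ?_ h4 (Real.sqrt_nonneg _) (by positivity)
        have := h.op
        nlinarith
  have h3 : |mInner W ((p.β - q.β) • X)| ≤ Real.sqrt k * ζ * Real.sqrt (compErr X q p) := by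
    rw [mInner_smul_right, abs_mul]
    have h4 : |p.β - q.β| * frob X ≤ Real.sqrt (compErr X q p) := by
      apply Real.le_sqrt_of_sq_le
      rw [mul_pow, sq_abs, compErr]; linarith
    have h5 := mul_le_mul_of_nonneg_left h.cov (abs_nonneg (p.β - q.β))
    have h6 := mul_le_mul_of_nonneg_left h4 (mul_nonneg (Real.sqrt_nonneg k) hζ)
    nlinarith
  rw [theta_sub, mInner_add_right, mInner_add_right]
  refine (abs_add_le _ _).trans ?_
  have := abs_add_le (mInner W (p.Z * p.Zᵀ - q.Z * q.Zᵀ))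
    (mInner W (colOnes (p.α - q.α) + (colOnes (p.α - q.α))ᵀ))
  linarith

lemma abs_mInner_gram_le (W : Matrix (Fin n) (Fin n) ℝ) (D : Matrix (Fin n) (Fin k) ℝ) :
    |mInner W (D * Dᵀ)| ≤ opNorm W * frob D ^ 2 := by
  rw [mInner_mul_right', Matrix.transpose_transpose]
  refine (abs_mInner_le _ _).trans ?_
  have := mul_le_mul_of_nonneg_right (frob_mul_le_left W D) (frob_nonneg D)
  linarith [this, sq (frob D)]

lemma mInner_symm_cross {G : Matrix (Fin n) (Fin n) ℝ} (hG : G.IsSymm)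
    (Z D : Matrix (Fin n) (Fin k) ℝ) :
    mInner G (Z * Dᵀ + D * Zᵀ) = 2 * mInner (G * Z) D := by
  have h1 : mInner G (Z * Dᵀ) = mInner (G * D) Z := by
    rw [mInner_mul_right', Matrix.transpose_transpose]
  have h2 : mInner G (D * Zᵀ) = mInner (G * Z) D := by
    rw [mInner_mul_right', Matrix.transpose_transpose]
  have h3 : mInner G (Z * Dᵀ) = mInner G (D * Zᵀ) := by
    rw [← mInner_transpose, hG.eq, Matrix.transpose_mul, Matrix.transpose_transpose]
  rw [mInner_add_right, h3, h2]; ring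

end Model

/-! ### One step of projected gradient descent -/

section Step

variable {n k : ℕ}

/-- One update of projected gradient descent, with `s₀` in the role of `‖Z⁰‖²`. -/
structure IsStep (A X : Matrix (Fin n) (Fin n) ℝ) (M₁ η s₀ : ℝ) (p p' : Params n k) : Prop where
  projZ : IsProj (fun V W => frob (V - W)) (CZ k M₁ X)
      (p.Z + (2 * (η / s₀)) • ((A - sigmoidM (p.theta X)) * p.Z)) p'.Z
  projα : IsProj vecDist (Cα M₁ X)
      (p.α + (2 * (η / (2 * n))) • ((A - sigmoidM (p.theta X)) *ᵥ (fun _ => (1 : ℝ)))) p'.α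
  projβ : X ≠ 0 → IsProj (fun a b => |a - b|) (Cβ M₁ X)
      (p.β + (η / (2 * frob X ^ 2)) * mInner (A - sigmoidM (p.theta X)) X) p'.β
  skipβ : X = 0 → p'.β = p.β

lemma IsPGD.isStep {A X : Matrix (Fin n) (Fin n) ℝ} {M₁ η : ℝ} {p : ℕ → Params n k}
    (h : IsPGD A X M₁ η p) (t : ℕ) :
    IsStep A X M₁ η (opNorm (p 0).Z ^ 2) (p t) (p (t + 1)) :=
  ⟨(h t).1, (h t).2.1, (h t).2.2.1, (h t).2.2.2⟩

variable {A X : Matrix (Fin n) (Fin n) ℝ} {M₁ η s₀ : ℝ} {p p' q : Params n k}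

/-- The constraint set is invariant under right multiplication by rotations, so the aligned truth
Z⋆R is feasible and projecting does not move the iterate away from it. -/
lemma IsStep.gram_bound (h : IsStep A X M₁ η s₀ p p') (hqZ : q.Z ∈ CZ k M₁ X)
    {R : Matrix (Fin k) (Fin k) ℝ} (hR : R ∈ Matrix.orthogonalGroup (Fin k) ℝ) :
    procrustes p'.Z q.Z ^ 2 ≤ frob (p.Z - q.Z * R) ^ 2
      + 4 * (η / s₀) * mInner ((A - sigmoidM (p.theta X)) * p.Z) (p.Z - q.Z * R)
      + 4 * (η / s₀) ^ 2 * frob ((A - sigmoidM (p.theta X)) * p.Z) ^ 2 := by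
  have hmem : q.Z * R ∈ CZ k M₁ X := by
    refine ⟨?_, fun i => ?_⟩
    · have := hqZ.1
      unfold Centered at *
      rw [← Matrix.mul_assoc, this]
    · have e : ∑ j, (q.Z * R) i j ^ 2 = ((q.Z * R) * (q.Z * R)ᵀ) i i := by
        rw [Matrix.mul_apply]; exact Finset.sum_congr rfl fun j _ => sq _
      have e2 : (q.Z * R) * (q.Z * R)ᵀ = q.Z * q.Zᵀ := by
        rw [Matrix.transpose_mul, Matrix.mul_assoc, ← Matrix.mul_assoc R,
          mul_transpose_of_mem hR, Matrix.one_mul]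
      rw [e, e2, Matrix.mul_apply]
      simpa [sq] using hqZ.2 i
  have h1 := pow_le_pow_left₀ (procrustes_nonneg _ _) (procrustes_le p'.Z q.Z hR) 2
  have h2 := frob_proj_sub_le h.projZ (convex_CZ M₁ X) hmem
  refine (h1.trans h2).trans (le_of_eq ?_)
  have e : p.Z + (2 * (η / s₀)) • ((A - sigmoidM (p.theta X)) * p.Z) - q.Z * R =
      (p.Z - q.Z * R) + (2 * (η / s₀)) • ((A - sigmoidM (p.theta X)) * p.Z) := by abel
  rw [e, frob_add_sq, frob_smul, mInner_smul_right, mul_pow, sq_abs,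
    mInner_comm (p.Z - q.Z * R)]
  ring

lemma IsStep.alpha_bound (h : IsStep A X M₁ η s₀ p p') (hn : 0 < n) (hq : q.α ∈ Cα M₁ X) :
    n * ∑ i, (p'.α i - q.α i) ^ 2 ≤ n * ∑ i, (p.α i - q.α i) ^ 2
      + 2 * η * mInner (A - sigmoidM (p.theta X)) (colOnes (p.α - q.α))
      + η ^ 2 / n * ∑ i, ((A - sigmoidM (p.theta X)) *ᵥ (fun _ => (1 : ℝ))) i ^ 2 := by
  have h1 := sum_proj_sub_le h.projα (convex_Cα M₁ X) hq
  set g := (A - sigmoidM (p.theta X)) *ᵥ (fun _ => (1 : ℝ)) with hg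
  have hn' : (0 : ℝ) < n := by exact_mod_cast hn
  have e : ∑ i, ((p.α + (2 * (η / (2 * n))) • g) i - q.α i) ^ 2 =
      ∑ i, (p.α i - q.α i) ^ 2 + 2 * (η / n) * ∑ i, g i * (p.α i - q.α i)
        + (η / n) ^ 2 * ∑ i, g i ^ 2 := by
    rw [Finset.mul_sum, Finset.mul_sum, ← Finset.sum_add_distrib, ← Finset.sum_add_distrib]
    refine Finset.sum_congr rfl fun i _ => ?_
    simp only [Pi.add_apply, Pi.smul_apply, smul_eq_mul]
    field_simp
    ring
  rw [e] at h1
  have h2 := mul_le_mul_of_nonneg_left h1 hn'.le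
  rw [mInner_colOnes, ← hg]
  refine h2.trans (le_of_eq ?_)
  simp only [Pi.sub_apply]
  field_simp

lemma IsStep.beta_bound (h : IsStep A X M₁ η s₀ p p') (hq : q.β ∈ Cβ M₁ X) :
    (p'.β - q.β) ^ 2 * frob X ^ 2 ≤ (p.β - q.β) ^ 2 * frob X ^ 2
      + η * mInner (A - sigmoidM (p.theta X)) ((p.β - q.β) • X)
      + η ^ 2 / 4 * (mInner (A - sigmoidM (p.theta X)) ((frob X)⁻¹ • X)) ^ 2 := by
  by_cases hX : X = 0
  · rw [h.skipβ hX]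
    simp [hX, mInner]
  · have h1 := sq_proj_sub_le (h.projβ hX) (convex_Cβ M₁ X) hq
    have hX' := frob_pos hX
    have h2 := mul_le_mul_of_nonneg_right h1 (sq_nonneg (frob X))
    refine h2.trans (le_of_eq ?_)
    rw [mInner_smul_right, mInner_smul_right]
    field_simp
    ring

/-- Apply `frob_gram_sub_ge` at the optimal alignment, with Y = Z⋆R; then ‖YDᵀ‖_F ≥ σ_min ‖RDᵀ‖_F =
σ_min d. -/
lemma sigmaMin_sq_mul_procrustes_sq_le (q p : Params n k) :
    2 / 3 * (sigmaMin q.Z ^ 2 * procrustes p.Z q.Z ^ 2) ≤ errG q p := by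
  obtain ⟨R, hR, hRd, hRs, hRp⟩ := exists_alignment p.Z q.Z
  set D := p.Z - q.Z * R with hD
  have hYY : (q.Z * R) * (q.Z * R)ᵀ = q.Z * q.Zᵀ := by
    rw [Matrix.transpose_mul, Matrix.mul_assoc, ← Matrix.mul_assoc R,
      mul_transpose_of_mem hR, Matrix.one_mul]
  have h4 := frob_gram_sub_ge hRs hRp
  rw [hYY] at h4
  refine le_trans ?_ h4
  have h5 := sigmaMin_mul_frob_le q.Z (R * Dᵀ)
  have h6 : frob (R * Dᵀ) = frob D := by
    rw [← frob_transpose D, ← Real.sqrt_sq (frob_nonneg (R * Dᵀ)),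
      ← Real.sqrt_sq (frob_nonneg Dᵀ), ← mInner_self, ← mInner_self, mInner_mul_right,
      ← Matrix.mul_assoc, mul_eq_one_comm.1 (mul_transpose_of_mem hR), Matrix.one_mul]
  rw [h6, ← Matrix.mul_assoc] at h5
  have h7 := pow_le_pow_left₀ (mul_nonneg (sigmaMin_nonneg _) (frob_nonneg _)) h5 2
  rw [mul_pow] at h7
  rw [hRd]
  linarith

/-- The change of the error in one step, in terms of the gradient. -/
lemma IsStep.lyap_le (h : IsStep A X M₁ η s₀ p p') (hA : A.IsSymm) (hX : X.IsSymm) (hn : 0 < n)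
    (hqZ : q.Z ∈ CZ k M₁ X) (hqα : q.α ∈ Cα M₁ X) (hqβ : q.β ∈ Cβ M₁ X) :
    ∃ D : Matrix (Fin n) (Fin k) ℝ, frob D = procrustes p.Z q.Z ∧
      lyap X q p' ≤ lyap X q p
        + 2 * η * mInner (A - sigmoidM (p.theta X)) ((p.theta X - q.theta X) + D * Dᵀ)
        + 2 * η * (opNorm q.Z ^ 2 / s₀ - 1) * mInner (A - sigmoidM (p.theta X))
            ((p.Z * p.Zᵀ - q.Z * q.Zᵀ) + D * Dᵀ)
        + η ^ 2 * (4 * (opNorm q.Z / s₀) ^ 2 * frob ((A - sigmoidM (p.theta X)) * p.Z) ^ 2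
          + 2 / n * ∑ i, ((A - sigmoidM (p.theta X)) *ᵥ (fun _ => (1 : ℝ))) i ^ 2
          + 1 / 2 * (mInner (A - sigmoidM (p.theta X)) ((frob X)⁻¹ • X)) ^ 2) ∧
      errMetric X q p' ≤ errMetric X q p
        + 2 * η * mInner (A - sigmoidM (p.theta X)) ((p.theta X - q.theta X) + D * Dᵀ)
        + 2 * η * (opNorm q.Z ^ 2 / s₀ - 1) * mInner (A - sigmoidM (p.theta X))
            ((p.Z * p.Zᵀ - q.Z * q.Zᵀ) + D * Dᵀ)
        + η ^ 2 * (4 * (opNorm q.Z / s₀) ^ 2 * frob ((A - sigmoidM (p.theta X)) * p.Z) ^ 2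
          + 2 / n * ∑ i, ((A - sigmoidM (p.theta X)) *ᵥ (fun _ => (1 : ℝ))) i ^ 2
          + 1 / 2 * (mInner (A - sigmoidM (p.theta X)) ((frob X)⁻¹ • X)) ^ 2)
        - η * mInner (A - sigmoidM (p.theta X)) ((p.β - q.β) • X) := by
  obtain ⟨R, hR, hRd, hRs, hRp⟩ := exists_alignment p.Z q.Z
  set D := p.Z - q.Z * R with hD
  have hYY : (q.Z * R) * (q.Z * R)ᵀ = q.Z * q.Zᵀ := by
    rw [Matrix.transpose_mul, Matrix.mul_assoc, ← Matrix.mul_assoc R,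
      mul_transpose_of_mem hR, Matrix.one_mul]
  have h1 := h.gram_bound hqZ hR
  have h2 := h.alpha_bound hn hqα
  have h3 := h.beta_bound hqβ
  set G := A - sigmoidM (p.theta X) with hG
  have hGs : G.IsSymm := hA.sub (sigmoidM_isSymm (theta_isSymm hX p))
  refine ⟨D, hRd.symm, ?_⟩
  -- Because Z⋆R = Z − D, the Gram error plus DDᵀ equals ZDᵀ + DZᵀ: the linear term of the Z-update
  -- is exact once the quadratic remainder DDᵀ is included.
  · have hcross : mInner G ((p.Z * p.Zᵀ - q.Z * q.Zᵀ) + D * Dᵀ) = 2 * mInner (G * p.Z) D := by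
      rw [← mInner_symm_cross hGs, ← hYY]
      congr 1
      have hZ : q.Z * R = p.Z - D := by rw [hD]; abel
      rw [hZ, Matrix.transpose_sub, Matrix.sub_mul, Matrix.mul_sub, Matrix.mul_sub]
      abel
    have htheta : mInner G ((p.theta X - q.theta X) + D * Dᵀ) = 2 * mInner (G * p.Z) D
        + 2 * mInner G (colOnes (p.α - q.α)) + mInner G ((p.β - q.β) • X) := by
      have e : (p.theta X - q.theta X) + D * Dᵀ = ((p.Z * p.Zᵀ - q.Z * q.Zᵀ) + D * Dᵀ) +
          (colOnes (p.α - q.α) + (colOnes (p.α - q.α))ᵀ) + (p.β - q.β) • X := by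
        rw [theta_sub]; abel
      rw [e, mInner_add_right, mInner_add_right, hcross, mInner_add_right,
        mInner_colOnes_transpose hGs]
      ring
    -- The weights of `lyap` match the three linear terms to 2η⟨G, ΔΘ + DDᵀ⟩; the step size uses s₀
    -- where a² would be exact, which leaves the term with a²/s₀ − 1. In `errMetric` the covariate
    -- has half that weight, whence the extra last term.
    rw [hcross, htheta, lyap, lyap, errMetric_eq, errMetric_eq, hRd]
    have h4 := mul_le_mul_of_nonneg_left h1 (sq_nonneg (opNorm q.Z))
    have e1 : opNorm q.Z ^ 2 * (frob D ^ 2 + 4 * (η / s₀) * mInner (G * p.Z) D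
        + 4 * (η / s₀) ^ 2 * frob (G * p.Z) ^ 2) = opNorm q.Z ^ 2 * frob D ^ 2
        + 4 * η * (opNorm q.Z ^ 2 / s₀) * mInner (G * p.Z) D
        + η ^ 2 * (4 * (opNorm q.Z / s₀) ^ 2 * frob (G * p.Z) ^ 2) := by ring
    rw [e1] at h4
    have e2 : η ^ 2 * (2 / n * ∑ i, (G *ᵥ (fun _ => (1 : ℝ))) i ^ 2)
        = 2 * (η ^ 2 / n * ∑ i, (G *ᵥ (fun _ => (1 : ℝ))) i ^ 2) := by ring
    have e3 : 0 ≤ η ^ 2 * (mInner G ((frob X)⁻¹ • X)) ^ 2 := by positivity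
    constructor <;> linarith

/-- Deviation of the fitted edge probabilities. -/
def probDev (X : Matrix (Fin n) (Fin n) ℝ) (q p : Params n k) : Matrix (Fin n) (Fin n) ℝ :=
  sigmoidM (p.theta X) - sigmoidM (q.theta X)

lemma frob_probDev_sq_le (X : Matrix (Fin n) (Fin n) ℝ) (q p : Params n k) :
    4 * frob (probDev X q p) ^ 2 ≤ mInner (probDev X q p) (p.theta X - q.theta X) := by
  rw [frob_sq, mInner_eq, Finset.mul_sum]
  refine Finset.sum_le_sum fun i _ => ?_
  rw [Finset.mul_sum]
  exact Finset.sum_le_sum fun j _ => sigmoid_sub_mul_ge_sq _ _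

lemma frob_probDev_sq_le_errTheta (X : Matrix (Fin n) (Fin n) ℝ) (q p : Params n k) :
    frob (probDev X q p) ^ 2 ≤ 1 / 16 * errTheta X q p := by
  rw [errTheta, frob_sq, frob_sq, Finset.mul_sum]
  refine Finset.sum_le_sum fun i _ => ?_
  rw [Finset.mul_sum]
  exact Finset.sum_le_sum fun j _ => sigmoid_sub_sq_le _ _

lemma mInner_probDev_ge {M : ℝ} (hp : ∀ i j, |p.theta X i j| ≤ M)
    (hq : ∀ i j, |q.theta X i j| ≤ M) :
    Real.exp (-M) / 4 * errTheta X q p ≤ mInner (probDev X q p) (p.theta X - q.theta X) := by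
  rw [errTheta, frob_sq, mInner_eq, Finset.mul_sum]
  refine Finset.sum_le_sum fun i _ => ?_
  rw [Finset.mul_sum]
  exact Finset.sum_le_sum fun j _ => sigmoid_sub_mul_ge (hp i j) (hq i j)

lemma grad_eq (A X : Matrix (Fin n) (Fin n) ℝ) (q p : Params n k) :
    A - sigmoidM (p.theta X) = (A - sigmoidM (q.theta X)) - probDev X q p := by
  rw [probDev]; abel

/-- Sizes of the gradients of the three blocks. -/
lemma frob_grad_mul_le {W : Matrix (Fin n) (Fin n) ℝ} {ζ : ℝ} (hW : NoiseLevel k W X ζ)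
    (V : Matrix (Fin n) (Fin n) ℝ) (Z : Matrix (Fin n) (Fin k) ℝ) :
    frob ((W - V) * Z) ≤ (frob V + Real.sqrt k * ζ / 2) * opNorm Z := by
  rw [Matrix.sub_mul]
  refine (frob_sub_le _ _).trans ?_
  have h1 := frob_mul_le_left W Z
  have h2 := frob_mul_le_right V Z
  have h3 := frob_le_sqrt_mul_opNorm Z
  have h4 : opNorm W * frob Z ≤ ζ / 2 * (Real.sqrt k * opNorm Z) := by
    refine mul_le_mul (by linarith [hW.op]) h3 (frob_nonneg _) (by linarith [hW.nonneg])
  linarith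

lemma opNorm_grad_le {W : Matrix (Fin n) (Fin n) ℝ} {ζ : ℝ} (hW : NoiseLevel k W X ζ)
    (V : Matrix (Fin n) (Fin n) ℝ) : opNorm (W - V) ≤ frob V + ζ / 2 := by
  refine (opNorm_sub_le _ _).trans ?_
  linarith [hW.op, opNorm_le_frob V]

lemma abs_mInner_grad_cov_le {W : Matrix (Fin n) (Fin n) ℝ} {ζ : ℝ} (hW : NoiseLevel k W X ζ)
    (V : Matrix (Fin n) (Fin n) ℝ) :
    |mInner (W - V) ((frob X)⁻¹ • X)| ≤ frob V + Real.sqrt k * ζ := by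
  by_cases hX : X = 0
  · have := hW.nonneg
    have := frob_nonneg V
    simp only [hX, smul_zero, mInner, Matrix.mul_zero, Matrix.trace_zero, abs_zero]
    positivity
  have hX' := frob_pos hX
  have h1 := hW.cov
  have h2 := abs_mInner_le V X
  rw [mInner_smul_right, mInner_sub_left, abs_mul, abs_inv, abs_of_pos hX']
  rw [inv_mul_le_iff₀ hX']
  refine (abs_sub _ _).trans ?_
  linarith

set_option maxHeartbeats 400000 in
/-- One step changes the Lyapunov function by a negative multiple of the curvature term, up to
noise and higher order terms. -/
lemma IsStep.lyap_le_of_noise (h : IsStep A X M₁ η s₀ p p') (hA : A.IsSymm) (hX : X.IsSymm)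
    (hn : 0 < n) (hk : 1 ≤ k)
    (hqZ : q.Z ∈ CZ k M₁ X) (hqα : q.α ∈ Cα M₁ X) (hqβ : q.β ∈ Cβ M₁ X) {ζ δ : ℝ}
    (hW : NoiseLevel k (A - sigmoidM (q.theta X)) X ζ)
    (hZ : opNorm p.Z ≤ 2 * opNorm q.Z) (hqpos : 0 < opNorm q.Z)
    (hs1 : opNorm q.Z ^ 2 ≤ 2 * s₀)
    (hδ : |opNorm q.Z ^ 2 / s₀ - 1| ≤ δ) (hδ1 : δ ≤ 1) (hη : 0 < η) (hη1 : η ≤ 1 / 140) :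
    lyap X q p' ≤ lyap X q p - η * mInner (probDev X q p) (p.theta X - q.theta X)
      + η * (8 * (Real.sqrt k * ζ) * Real.sqrt (compErr X q p) + 4 * procrustes p.Z q.Z ^ 4
        + 2 * ζ * procrustes p.Z q.Z ^ 2 + δ ^ 2 * compErr X q p + k * ζ ^ 2) ∧
    errMetric X q p' ≤ errMetric X q p
      + η * (8 * (Real.sqrt k * ζ) * Real.sqrt (compErr X q p) + 4 * procrustes p.Z q.Z ^ 4
        + 2 * ζ * procrustes p.Z q.Z ^ 2 + δ ^ 2 * compErr X q p + k * ζ ^ 2)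
      + η * (2 * compErr X q p + k * ζ ^ 2) := by
  obtain ⟨D, hD, hL, hE⟩ := h.lyap_le hA hX hn hqZ hqα hqβ
  set W := A - sigmoidM (q.theta X) with hWdef
  set V := probDev X q p with hV
  have hgrad : A - sigmoidM (p.theta X) = W - V := grad_eq A X q p
  rw [hgrad] at hL hE
  have hWs : W.IsSymm := hA.sub (sigmoidM_isSymm (theta_isSymm hX q))
  set S := frob V with hS
  set d := procrustes p.Z q.Z with hd
  set Γ := Real.sqrt (compErr X q p) with hΓ
  set a := opNorm q.Z with ha
  have hζ := hW.nonneg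
  have hS0 : 0 ≤ S := frob_nonneg _
  have hd0 : 0 ≤ d := procrustes_nonneg _ _
  have hΓ0 : 0 ≤ Γ := Real.sqrt_nonneg _
  have hΓsq : Γ ^ 2 = compErr X q p := Real.sq_sqrt (compErr_nonneg _ _ _)
  have hδ0 : 0 ≤ δ := (abs_nonneg _).trans hδ
  have hk1 : (1 : ℝ) ≤ k := by exact_mod_cast hk
  have hsk := Real.sq_sqrt (Nat.cast_nonneg k : (0 : ℝ) ≤ k)
  have hsk0 := Real.sqrt_nonneg (k : ℝ)
  set N := Real.sqrt k * ζ with hN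
  have hN0 : 0 ≤ N := mul_nonneg hsk0 hζ
  have hNsq : N ^ 2 = k * ζ ^ 2 := by rw [hN, mul_pow, hsk]
  have hn' : (0 : ℝ) < n := by exact_mod_cast hn
  have hs0 : 0 < s₀ := by
    have : 0 < a ^ 2 := by positivity
    linarith
  set I := mInner V (p.theta X - q.theta X) with hI
  have hIS : 4 * S ^ 2 ≤ I := frob_probDev_sq_le X q p
  have l1 := abs_le.1 (hW.abs_theta_le hWs hk q p)
  have l2 := abs_le.1 (hW.abs_gram_le q p)
  have l3 : |mInner W (D * Dᵀ)| ≤ ζ / 2 * d ^ 2 := by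
    refine (abs_mInner_gram_le W D).trans ?_
    rw [hD]
    exact mul_le_mul_of_nonneg_right (by linarith [hW.op]) (sq_nonneg _)
  have l4 : |mInner V (D * Dᵀ)| ≤ S * d ^ 2 := by
    refine (abs_mInner_gram_le V D).trans ?_
    rw [hD]
    exact mul_le_mul_of_nonneg_right (opNorm_le_frob V) (sq_nonneg _)
  have l5 : |mInner V (p.Z * p.Zᵀ - q.Z * q.Zᵀ)| ≤ S * Γ := by
    refine (abs_mInner_le _ _).trans (mul_le_mul_of_nonneg_left ?_ hS0)
    apply Real.le_sqrt_of_sq_le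
    have := sum_sub_sq_nonneg p q
    have : 0 ≤ (p.β - q.β) ^ 2 * frob X ^ 2 := by positivity
    rw [compErr, errG]; linarith
  have l3' := abs_le.1 l3
  have l4' := abs_le.1 l4
  have l5' := abs_le.1 l5
  have b1 : mInner (W - V) ((p.theta X - q.theta X) + D * Dᵀ) ≤
      -I + 3 * N * Γ + S * d ^ 2 + ζ / 2 * d ^ 2 := by
    rw [mInner_sub_left, mInner_add_right, mInner_add_right]
    linarith
  have b2 : |mInner (W - V) ((p.Z * p.Zᵀ - q.Z * q.Zᵀ) + D * Dᵀ)| ≤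
      N * Γ + S * Γ + S * d ^ 2 + ζ / 2 * d ^ 2 := by
    rw [mInner_sub_left, mInner_add_right, mInner_add_right, abs_le]
    constructor <;> linarith
  have b3 : (a ^ 2 / s₀ - 1) * mInner (W - V) ((p.Z * p.Zᵀ - q.Z * q.Zᵀ) + D * Dᵀ) ≤
      N * Γ + δ * (S * Γ) + S * d ^ 2 + ζ / 2 * d ^ 2 := by
    refine (le_abs_self _).trans ?_
    rw [abs_mul]
    refine (mul_le_mul hδ b2 (abs_nonneg _) hδ0).trans ?_
    have h1 : 0 ≤ N * Γ + S * d ^ 2 + ζ / 2 * d ^ 2 := by positivity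
    have h2 := mul_le_of_le_one_left h1 hδ1
    linarith
  have q1 : 4 * (a / s₀) ^ 2 * frob ((W - V) * p.Z) ^ 2 ≤ 128 * S ^ 2 + 32 * N ^ 2 := by
    have h1 := frob_grad_mul_le hW V p.Z
    have h2 : frob ((W - V) * p.Z) ≤ (S + N / 2) * (2 * a) :=
      h1.trans (mul_le_mul_of_nonneg_left hZ (by positivity))
    have h3 : a / s₀ * frob ((W - V) * p.Z) ≤ 4 * (S + N / 2) := by
      have h4 : a / s₀ * frob ((W - V) * p.Z) ≤ a / s₀ * ((S + N / 2) * (2 * a)) :=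
        mul_le_mul_of_nonneg_left h2 (by positivity)
      have h5 : a / s₀ * ((S + N / 2) * (2 * a)) = 2 * (S + N / 2) * (a ^ 2 / s₀) := by ring
      have h6 : a ^ 2 / s₀ ≤ 2 := by rw [div_le_iff₀ hs0]; exact hs1
      have h7 := mul_le_mul_of_nonneg_left h6 (by positivity : 0 ≤ 2 * (S + N / 2))
      rw [← h5] at h7
      exact h4.trans (h7.trans (le_of_eq (by ring)))
    have h4 := pow_le_pow_left₀ (by have := frob_nonneg ((W - V) * p.Z); positivity) h3 2
    rw [mul_pow] at h4
    have h5 := sq_nonneg (S - N / 2)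
    linarith
  have q2 : 2 / n * ∑ i, ((W - V) *ᵥ (fun _ => (1 : ℝ))) i ^ 2 ≤ 4 * S ^ 2 + N ^ 2 := by
    have h1 := sum_mulVec_sq_le (W - V) (fun _ => 1)
    simp only [one_pow, Finset.sum_const, Finset.card_univ, Fintype.card_fin, nsmul_eq_mul,
      mul_one] at h1
    have h2 := pow_le_pow_left₀ (opNorm_nonneg _) (opNorm_grad_le hW V) 2
    have h3 : 2 / n * ∑ i, ((W - V) *ᵥ (fun _ => (1 : ℝ))) i ^ 2 ≤ 2 * opNorm (W - V) ^ 2 := by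
      rw [div_mul_eq_mul_div, div_le_iff₀ hn']
      linarith
    have h4 : ζ ^ 2 ≤ N ^ 2 := hNsq ▸ le_mul_of_one_le_left (sq_nonneg ζ) hk1
    have h5 := sq_nonneg (S - ζ / 2)
    linarith
  have q3 : 1 / 2 * (mInner (W - V) ((frob X)⁻¹ • X)) ^ 2 ≤ S ^ 2 + N ^ 2 := by
    have h1 := sq_le_sq' (by
      have := abs_le.1 (abs_mInner_grad_cov_le hW V); linarith [this.1])
      (abs_le.1 (abs_mInner_grad_cov_le hW V)).2
    have h5 := sq_nonneg (S - N)
    linarith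
  -- The three blocks contribute at most 133 S² + 34 N², so η ≤ 1/140 makes the second-order term at
  -- most η(S² + N²).
  have hquad : η ^ 2 * (4 * (a / s₀) ^ 2 * frob ((W - V) * p.Z) ^ 2
      + 2 / n * ∑ i, ((W - V) *ᵥ (fun _ => (1 : ℝ))) i ^ 2
      + 1 / 2 * (mInner (W - V) ((frob X)⁻¹ • X)) ^ 2) ≤ η * (S ^ 2 + N ^ 2) := by
    calc _ ≤ η ^ 2 * (140 * (S ^ 2 + N ^ 2)) := by
          refine mul_le_mul_of_nonneg_left ?_ (sq_nonneg _)
          linarith [sq_nonneg S, sq_nonneg N]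
      _ = (140 * η) * (η * (S ^ 2 + N ^ 2)) := by ring
      _ ≤ 1 * (η * (S ^ 2 + N ^ 2)) :=
          mul_le_mul_of_nonneg_right (by linarith) (by positivity)
      _ = _ := one_mul _
  have e1 : S * d ^ 2 ≤ S ^ 2 / 4 + d ^ 4 := by have := sq_nonneg (S / 2 - d ^ 2); linarith
  have e2 : δ * (S * Γ) ≤ S ^ 2 / 2 + δ ^ 2 * Γ ^ 2 / 2 := by
    have := sq_nonneg (S - δ * Γ)
    linarith
  -- The linear terms give −2I. The second-order term, DDᵀ and the step size mismatch together
  -- produce 3S², which one copy of I ≥ 4S² absorbs; the other copy is kept for the contraction.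
  have hin : 2 * mInner (W - V) ((p.theta X - q.theta X) + D * Dᵀ)
      + 2 * ((a ^ 2 / s₀ - 1) * mInner (W - V) ((p.Z * p.Zᵀ - q.Z * q.Zᵀ) + D * Dᵀ))
      + (S ^ 2 + N ^ 2) ≤ -I + (8 * N * Γ + 4 * d ^ 4 + 2 * ζ * d ^ 2 + δ ^ 2 * Γ ^ 2 + N ^ 2) := by
    linarith [sq_nonneg S]
  have hfin := mul_le_mul_of_nonneg_left hin hη.le
  -- The extra covariate term of `errMetric` is not absorbed by curvature. A crude bound is enough,
  -- since it will be used for a single step only.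
  have hβ : -mInner (W - V) ((p.β - q.β) • X) ≤ 2 * Γ ^ 2 + N ^ 2 := by
    have h1 : |p.β - q.β| * frob X ≤ Γ := by
      apply Real.le_sqrt_of_sq_le
      have := sum_sub_sq_nonneg p q
      have := errG_nonneg p q
      rw [mul_pow, sq_abs, compErr]; linarith
    have h2 := hW.cov
    have h3 := abs_mInner_le V X
    have h4 : |mInner (W - V) X| ≤ (S + N) * frob X := by
      rw [mInner_sub_left]
      refine (abs_sub _ _).trans ?_
      linarith
    have h5 : S ^ 2 ≤ Γ ^ 2 := by
      have := frob_probDev_sq_le_errTheta X q p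
      have := errTheta_le X q p
      rw [hΓsq]
      linarith [compErr_nonneg X q p]
    have h6 : S ≤ Γ := (abs_le_of_sq_le_sq' h5 hΓ0).2
    refine (neg_le_abs _).trans ?_
    rw [mInner_smul_right, abs_mul]
    calc |p.β - q.β| * |mInner (W - V) X| ≤ |p.β - q.β| * ((S + N) * frob X) :=
          mul_le_mul_of_nonneg_left h4 (abs_nonneg _)
      _ = (|p.β - q.β| * frob X) * (S + N) := by ring
      _ ≤ Γ * (Γ + N) := mul_le_mul h1 (by linarith) (by positivity) hΓ0
      _ ≤ _ := by have := sq_nonneg (Γ - N); have := sq_nonneg N; linarith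
  have hβ' := mul_le_mul_of_nonneg_left hβ hη.le
  have hI0 : 0 ≤ η * I := mul_nonneg hη.le (by linarith [sq_nonneg S])
  rw [← hΓsq, ← hNsq]
  constructor <;> linarith

end Step

/-! ### Descent of the negative log-likelihood -/

section Descent

variable {n k : ℕ}

/-- Negative log-likelihood of the logit matrix `T`. -/
def loss (A T : Matrix (Fin n) (Fin n) ℝ) : ℝ := ∑ i, ∑ j, (softplus (T i j) - A i j * T i j)

lemma loss_sub_le (A T T' : Matrix (Fin n) (Fin n) ℝ) :
    loss A T' - loss A T ≤ -mInner (A - sigmoidM T) (T' - T) + 1 / 8 * frob (T' - T) ^ 2 := by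
  rw [loss, loss, mInner_eq, frob_sq, ← Finset.sum_sub_distrib, ← Finset.sum_neg_distrib,
    Finset.mul_sum, ← Finset.sum_add_distrib]
  refine Finset.sum_le_sum fun i _ => ?_
  rw [← Finset.sum_sub_distrib, ← Finset.sum_neg_distrib, Finset.mul_sum,
    ← Finset.sum_add_distrib]
  refine Finset.sum_le_sum fun j _ => ?_
  have := softplus_sub_le (T i j) (T' i j)
  simp only [Matrix.sub_apply, sigmoidM, Matrix.map_apply]
  linarith

lemma loss_sub_ge {M : ℝ} (A : Matrix (Fin n) (Fin n) ℝ) {T T' : Matrix (Fin n) (Fin n) ℝ}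
    (hT : ∀ i j, |T i j| ≤ M) (hT' : ∀ i j, |T' i j| ≤ M) :
    -mInner (A - sigmoidM T) (T' - T) + Real.exp (-M) / 8 * frob (T' - T) ^ 2 ≤
      loss A T' - loss A T := by
  rw [loss, loss, mInner_eq, frob_sq, ← Finset.sum_sub_distrib, ← Finset.sum_neg_distrib,
    Finset.mul_sum, ← Finset.sum_add_distrib]
  refine Finset.sum_le_sum fun i _ => ?_
  rw [← Finset.sum_sub_distrib, ← Finset.sum_neg_distrib, Finset.mul_sum,
    ← Finset.sum_add_distrib]
  refine Finset.sum_le_sum fun j _ => ?_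
  have := softplus_sub_ge (hT i j) (hT' i j)
  simp only [Matrix.sub_apply, sigmoidM, Matrix.map_apply]
  linarith

lemma frob_gram_sub_le (Z V : Matrix (Fin n) (Fin k) ℝ) :
    frob (Z * Zᵀ - V * Vᵀ) ≤ (opNorm Z + opNorm V) * frob (Z - V) := by
  have e : Z * Zᵀ - V * Vᵀ = Z * (Z - V)ᵀ + (Z - V) * Vᵀ := by
    rw [Matrix.transpose_sub, Matrix.mul_sub, Matrix.sub_mul]; abel
  rw [e]
  refine (frob_add_le _ _).trans ?_
  have h1 := frob_mul_le_left Z (Z - V)ᵀ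
  have h2 := frob_mul_le_right (Z - V) Vᵀ
  rw [frob_transpose] at h1
  rw [opNorm_transpose] at h2
  linarith

lemma opNorm_le_add_frob (Z V : Matrix (Fin n) (Fin k) ℝ) :
    opNorm Z ≤ opNorm V + frob (Z - V) := by
  have h := opNorm_add_le V (Z - V)
  rw [add_sub_cancel] at h
  linarith [opNorm_le_frob (Z - V)]

variable {A X : Matrix (Fin n) (Fin n) ℝ} {M₁ η s₀ : ℝ} {p p' q : Params n k}

/-- With a small step size, a step from a feasible point does not increase the loss. -/
lemma IsStep.loss_le (h : IsStep A X M₁ η s₀ p p') (hA : A.IsSymm) (hX : X.IsSymm)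
    (hn : 0 < n) (hpZ : p.Z ∈ CZ k M₁ X) (hpα : p.α ∈ Cα M₁ X) (hpβ : X ≠ 0 → p.β ∈ Cβ M₁ X)
    {B z : ℝ} (hη : 0 < η) (hη1 : η ≤ 2) (hs₀ : 0 < s₀)
    (hGZ : frob ((A - sigmoidM (p.theta X)) * p.Z) ≤ B * z) (hz : opNorm p.Z ≤ z) (hz0 : 0 ≤ z)
    (hB : 2 * η * B ≤ s₀)
    (hG : η * (opNorm (A - sigmoidM (p.theta X)) + 9 / 2 * z ^ 2) ≤ s₀) :
    loss A (p'.theta X) ≤ loss A (p.theta X) := by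
  set G := A - sigmoidM (p.theta X) with hGdef
  have hGs : G.IsSymm := hA.sub (sigmoidM_isSymm (theta_isSymm hX p))
  have hn' : (0 : ℝ) < n := by exact_mod_cast hn
  set D := p'.Z - p.Z with hD
  -- In every block the squared displacement is at most the gradient step paired with the
  -- displacement. This is the sufficient decrease that has to beat the second-order term of the
  -- loss.
  have hZ := frob_proj_step_sq_le h.projZ (convex_CZ M₁ X) hpZ
  rw [← hGdef, ← hD, mInner_smul_left] at hZ
  have hα := sum_proj_step_sq_le h.projα (convex_Cα M₁ X) hpα
  have hα2 : 2 * (n * ∑ i, (p'.α i - p.α i) ^ 2) ≤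
      η * (2 * mInner G (colOnes (p'.α - p.α))) := by
    rw [mInner_colOnes]
    have e : ∑ i, ((2 * (η / (2 * n))) • (G *ᵥ fun _ => (1 : ℝ))) i * (p'.α i - p.α i) =
        η / n * ∑ i, (G *ᵥ fun _ => (1 : ℝ)) i * (p'.α - p.α) i := by
      rw [Finset.mul_sum]
      refine Finset.sum_congr rfl fun i _ => ?_
      simp only [Pi.smul_apply, smul_eq_mul, Pi.sub_apply]
      field_simp
    rw [← hGdef, e] at hα
    have h2 := mul_le_mul_of_nonneg_left hα hn'.le
    have e2 : n * (η / n * ∑ i, (G *ᵥ fun _ => (1 : ℝ)) i * (p'.α - p.α) i) =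
        η * ∑ i, (G *ᵥ fun _ => (1 : ℝ)) i * (p'.α - p.α) i := by field_simp
    rw [e2] at h2
    linarith
  have hβ2 : 2 * ((p'.β - p.β) ^ 2 * frob X ^ 2) ≤ η * mInner G ((p'.β - p.β) • X) := by
    by_cases hX0 : X = 0
    · rw [h.skipβ hX0, sub_self, zero_smul]
      simp [mInner]
    · have h1 := sq_proj_step_le (h.projβ hX0) (convex_Cβ M₁ X) (hpβ hX0)
      have hX' := frob_pos hX0
      rw [← hGdef] at h1
      rw [mInner_smul_right]
      have h2 := mul_le_mul_of_nonneg_right h1 (by positivity : 0 ≤ 2 * frob X ^ 2)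
      have e : η / (2 * frob X ^ 2) * mInner G X * (p'.β - p.β) * (2 * frob X ^ 2) =
          η * ((p'.β - p.β) * mInner G X) := by field_simp
      rw [e] at h2
      linarith
  -- The hypothesis on B keeps the displacement of Z below z, so that the new point has operator
  -- norm at most 2z.
  have hDz : frob D ≤ z := by
    have h1 := (abs_le.1 (abs_mInner_le (G * p.Z) D)).2
    have h2 : frob D ^ 2 ≤ 2 * (η / s₀) * (B * z * frob D) := by
      refine hZ.trans (mul_le_mul_of_nonneg_left (h1.trans ?_) (by positivity))
      exact mul_le_mul_of_nonneg_right hGZ (frob_nonneg _)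
    have h3 : 2 * (η / s₀) * (B * z * frob D) ≤ z * frob D := by
      have e : 2 * (η / s₀) * (B * z * frob D) = (2 * η * B / s₀) * (z * frob D) := by ring
      rw [e]
      refine mul_le_of_le_one_left (mul_nonneg hz0 (frob_nonneg _)) ?_
      rwa [div_le_one hs₀]
    by_contra hlt
    push Not at hlt
    have h4 : 0 < frob D := hz0.trans_lt hlt
    nlinarith
  -- Here 9 = (2 + 1)². Multiplied by the 4 of `errTheta_le` and the smoothness constant 1/8, it
  -- gives the 9/2 in the hypothesis `hG`.
  have hgram : errG p p' ≤ 9 * z ^ 2 * frob D ^ 2 := by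
    have h1 := frob_gram_sub_le p'.Z p.Z
    have h2 := opNorm_le_add_frob p'.Z p.Z
    rw [← hD] at h1 h2
    have h3 : frob (p'.Z * p'.Zᵀ - p.Z * p.Zᵀ) ≤ 3 * z * frob D :=
      h1.trans (mul_le_mul_of_nonneg_right (by linarith) (frob_nonneg _))
    have h4 := pow_le_pow_left₀ (frob_nonneg _) h3 2
    rw [errG]
    refine h4.trans (le_of_eq (by ring))
  have hth := errTheta_le X p p'
  rw [compErr] at hth
  have hcross : mInner G (p'.theta X - p.theta X) = 2 * mInner (G * p.Z) D + mInner G (D * Dᵀ)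
      + 2 * mInner G (colOnes (p'.α - p.α)) + mInner G ((p'.β - p.β) • X) := by
    have e : p'.Z * p'.Zᵀ - p.Z * p.Zᵀ = p.Z * Dᵀ + D * p.Zᵀ + D * Dᵀ := by
      have : p'.Z = p.Z + D := by rw [hD]; abel
      rw [this, Matrix.transpose_add, Matrix.add_mul, Matrix.mul_add, Matrix.mul_add]; abel
    rw [theta_sub, e, mInner_add_right, mInner_add_right, mInner_add_right,
      mInner_symm_cross hGs, mInner_add_right, mInner_colOnes_transpose hGs]
    ring
  have hDD := (abs_le.1 (abs_mInner_gram_le G D)).1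
  have hl := loss_sub_le A (p.theta X) (p'.theta X)
  rw [← hGdef, hcross] at hl
  have hZ2 : s₀ * frob D ^ 2 ≤ η * (2 * mInner (G * p.Z) D) := by
    have h1 := mul_le_mul_of_nonneg_left hZ hs₀.le
    have e : s₀ * (2 * (η / s₀) * mInner (G * p.Z) D) = η * (2 * mInner (G * p.Z) D) := by
      field_simp
    rwa [e] at h1
  have hG2 := mul_le_mul_of_nonneg_right hG (sq_nonneg (frob D))
  have hna := sum_sub_sq_nonneg p' p
  set y := n * ∑ i, (p'.α i - p.α i) ^ 2
  have hb0 : 0 ≤ (p'.β - p.β) ^ 2 * frob X ^ 2 := by positivity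
  set b := (p'.β - p.β) ^ 2 * frob X ^ 2
  change _ ≤ -(2 * mInner (G * p.Z) D + mInner G (D * Dᵀ)
      + 2 * mInner G (colOnes (p'.α - p.α)) + mInner G ((p'.β - p.β) • X))
      + 1 / 8 * errTheta X p p' at hl
  have hl2 := mul_le_mul_of_nonneg_left hl hη.le
  have t1 : η * errTheta X p p' ≤ η * (4 * (9 * z ^ 2 * frob D ^ 2)) + 8 * (2 * y) + 8 * b := by
    have h1 := mul_le_mul_of_nonneg_left hth hη.le
    have h2 := mul_le_mul_of_nonneg_left hgram hη.le
    have h3 := mul_le_mul_of_nonneg_right hη1 hna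
    have h4 := mul_le_mul_of_nonneg_right hη1 hb0
    linarith
  have t2 := mul_le_mul_of_nonneg_left hDD hη.le
  have : η * (loss A (p'.theta X) - loss A (p.theta X)) ≤ 0 := by linarith
  by_contra hcon
  push Not at hcon
  have := mul_pos hη (sub_pos.2 hcon)
  linarith

end Descent

/-! ### Contraction of the Lyapunov function -/

section Contraction

variable {n k : ℕ}

lemma opNorm_mul_of_mem (V : Matrix (Fin n) (Fin k) ℝ) {R : Matrix (Fin k) (Fin k) ℝ}
    (hR : R ∈ Matrix.orthogonalGroup (Fin k) ℝ) : opNorm (V * R) = opNorm V := by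
  have h : opNorm (V * R) ^ 2 = opNorm V ^ 2 := by
    rw [← opNorm_mul_transpose_self, Matrix.transpose_mul, Matrix.mul_assoc, ← Matrix.mul_assoc R,
      mul_transpose_of_mem hR, Matrix.one_mul, opNorm_mul_transpose_self]
  exact (sq_eq_sq₀ (opNorm_nonneg _) (opNorm_nonneg _)).1 h

lemma abs_opNorm_sub_le_procrustes (Z V : Matrix (Fin n) (Fin k) ℝ) :
    |opNorm Z - opNorm V| ≤ procrustes Z V := by
  obtain ⟨R, hR, hd, -⟩ := exists_alignment Z V
  have h1 := opNorm_le_add_frob Z (V * R)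
  have h2 := opNorm_le_add_frob (V * R) Z
  rw [frob_sub_comm] at h2
  rw [opNorm_mul_of_mem V hR] at h1 h2
  rw [hd, abs_le]
  constructor <;> linarith

lemma errG_le_of_opNorm_le {p q : Params n k} (h : opNorm p.Z ≤ 2 * opNorm q.Z) :
    errG q p ≤ 9 * (opNorm q.Z ^ 2 * procrustes p.Z q.Z ^ 2) := by
  obtain ⟨R, hR, hd, -⟩ := exists_alignment p.Z q.Z
  have h1 := frob_gram_sub_le p.Z (q.Z * R)
  rw [Matrix.transpose_mul, Matrix.mul_assoc q.Z, ← Matrix.mul_assoc R, mul_transpose_of_mem hR,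
    Matrix.one_mul, opNorm_mul_of_mem _ hR, ← hd] at h1
  have h2 : frob (p.Z * p.Zᵀ - q.Z * q.Zᵀ) ≤ 3 * opNorm q.Z * procrustes p.Z q.Z :=
    h1.trans (mul_le_mul_of_nonneg_right (by linarith) (procrustes_nonneg _ _))
  have h3 := pow_le_pow_left₀ (frob_nonneg _) h2 2
  rw [errG]
  exact h3.trans (le_of_eq (by ring))

lemma compErr_le_of_opNorm_le {X : Matrix (Fin n) (Fin n) ℝ} {p q : Params n k}
    (h : opNorm p.Z ≤ 2 * opNorm q.Z) : compErr X q p ≤ 9 * lyap X q p := by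
  have h1 := errG_le_of_opNorm_le h
  have h2 := sum_sub_sq_nonneg p q
  have h3 : 0 ≤ (p.β - q.β) ^ 2 * frob X ^ 2 := by positivity
  rw [compErr, lyap]
  linarith

/-- The inverse condition number `γ = σ_min² / (e^{M₁} ‖Z⋆‖²)` of the problem. -/
def conditioning (M₁ : ℝ) (q : Params n k) : ℝ :=
  sigmaMin q.Z ^ 2 / (Real.exp M₁ * opNorm q.Z ^ 2)

/-- Facts on the problem used in the analysis of the iterates; `ζ` is the noise level. -/
structure WellPosed (A X : Matrix (Fin n) (Fin n) ℝ) (M₁ η ζ : ℝ) (q : Params n k) : Prop where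
  symmA : A.IsSymm
  symmX : X.IsSymm
  n_pos : 0 < n
  k_pos : 1 ≤ k
  M₁_nonneg : 0 ≤ M₁
  memZ : q.Z ∈ CZ k M₁ X
  memα : q.α ∈ Cα M₁ X
  memβ : q.β ∈ Cβ M₁ X
  rankX : 8 * Real.sqrt k * opNorm X ≤ frob X
  noise : NoiseLevel k (A - sigmoidM (q.theta X)) X ζ
  η_pos : 0 < η
  η_le : η ≤ 1 / 1000
  sigma_pos : 0 < sigmaMin q.Z
  gap : 10000 * (Real.exp M₁ * ζ) ≤ sigmaMin q.Z ^ 2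
  gap_step : 10000 ^ 2 * (Real.exp M₁ ^ 3 * (η * (k * ζ ^ 2))) ≤ sigmaMin q.Z ^ 4

/-- Membership in the constraint sets; without covariate there is no constraint on `β`. -/
structure Feasible (M₁ : ℝ) (X : Matrix (Fin n) (Fin n) ℝ) (p : Params n k) : Prop where
  memZ : p.Z ∈ CZ k M₁ X
  memα : p.α ∈ Cα M₁ X
  memβ : X ≠ 0 → p.β ∈ Cβ M₁ X

lemma IsStep.feasible {A X : Matrix (Fin n) (Fin n) ℝ} {M₁ η s₀ : ℝ} {p p' : Params n k}
    (h : IsStep A X M₁ η s₀ p p') : Feasible M₁ X p' :=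
  ⟨h.projZ.1, h.projα.1, fun hX => (h.projβ hX).1⟩

variable {A X : Matrix (Fin n) (Fin n) ℝ} {M₁ η ζ s₀ : ℝ} {q p p' : Params n k}

section WellPosed

variable (hq : WellPosed A X M₁ η ζ q)
include hq

lemma WellPosed.sigma_le : sigmaMin q.Z ≤ opNorm q.Z := sigmaMin_le_opNorm hq.k_pos _

lemma WellPosed.op_pos : 0 < opNorm q.Z := hq.sigma_pos.trans_le hq.sigma_le

lemma WellPosed.exp_ge : 1 ≤ Real.exp M₁ := Real.one_le_exp hq.M₁_nonneg

lemma WellPosed.cond_pos : 0 < conditioning M₁ q := by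
  have := hq.sigma_pos
  have := hq.op_pos
  unfold conditioning; positivity

lemma WellPosed.cond_mul : conditioning M₁ q * (Real.exp M₁ * opNorm q.Z ^ 2) =
    sigmaMin q.Z ^ 2 := by
  have := hq.op_pos
  unfold conditioning; field_simp

lemma WellPosed.cond_mul_exp_le : conditioning M₁ q * Real.exp M₁ ≤ 1 := by
  have h1 := hq.cond_mul
  have h2 := pow_le_pow_left₀ hq.sigma_pos.le hq.sigma_le 2
  have h3 : 0 < opNorm q.Z ^ 2 := pow_pos hq.op_pos 2
  by_contra hcon
  push Not at hcon
  have := mul_lt_mul_of_pos_right hcon h3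
  linarith

lemma WellPosed.cond_le_one : conditioning M₁ q ≤ 1 := by
  have h1 := hq.cond_mul_exp_le
  have h2 := mul_le_mul_of_nonneg_left hq.exp_ge hq.cond_pos.le
  linarith

lemma WellPosed.errTheta_ge (hp : Feasible M₁ X p) :
    compErr X q p ≤ 2 * errTheta X q p :=
  compErr_le_errTheta hq.symmX hq.k_pos hq.rankX hp.memZ.1 hq.memZ.1

/-- Since γ e^{M₁} = κ⁻², multiplying turns a²d² into σ_min²d², which the Gram error controls; the
other two parts only need κ ≥ 1. -/
lemma WellPosed.cond_mul_lyap_le :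
    conditioning M₁ q * Real.exp M₁ * lyap X q p ≤ 2 * compErr X q p := by
  have hγ := hq.cond_mul
  have h1 := sigmaMin_sq_mul_procrustes_sq_le q p
  have h2 := hq.cond_mul_exp_le
  have h4 : 0 ≤ 2 * (n * ∑ i, (p.α i - q.α i) ^ 2) + 2 * ((p.β - q.β) ^ 2 * frob X ^ 2) := by
    have := sum_sub_sq_nonneg p q
    positivity
  have h5 := mul_le_of_le_one_left h4 h2
  have h6 : conditioning M₁ q * Real.exp M₁ * (opNorm q.Z ^ 2 * procrustes p.Z q.Z ^ 2) =
      sigmaMin q.Z ^ 2 * procrustes p.Z q.Z ^ 2 := by rw [← hγ]; ring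
  have h7 := sum_sub_sq_nonneg p q
  have h8 := errG_nonneg p q
  rw [lyap, compErr]
  linarith

/-- Contraction at a feasible point in the basin of attraction. -/
lemma WellPosed.contraction (h : IsStep A X M₁ η s₀ p p') (hp : Feasible M₁ X p)
    (hs1 : opNorm q.Z ^ 2 ≤ 2 * s₀)
    (hδ : |opNorm q.Z ^ 2 / s₀ - 1| ≤ conditioning M₁ q / 140)
    (hd : 512 * Real.exp M₁ * procrustes p.Z q.Z ^ 2 ≤ sigmaMin q.Z ^ 2) :
    lyap X q p' ≤ (1 - η * conditioning M₁ q / 64) * lyap X q p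
      + 513 * η * (Real.exp M₁ * (k * ζ ^ 2)) := by
  have hγ1 := hq.cond_le_one
  have hγ0 := hq.cond_pos
  have hE := hq.exp_ge
  have hd0 := procrustes_nonneg p.Z q.Z
  have hζ := hq.noise.nonneg
  have hda : procrustes p.Z q.Z ≤ opNorm q.Z := by
    refine (abs_le_of_sq_le_sq' ?_ hq.op_pos.le).2
    have h1 := pow_le_pow_left₀ hq.sigma_pos.le hq.sigma_le 2
    have h2 : 1 * procrustes p.Z q.Z ^ 2 ≤ 512 * Real.exp M₁ * procrustes p.Z q.Z ^ 2 :=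
      mul_le_mul_of_nonneg_right (by linarith) (sq_nonneg _)
    linarith
  have hZ : opNorm p.Z ≤ 2 * opNorm q.Z := by
    have := (abs_le.1 (abs_opNorm_sub_le_procrustes p.Z q.Z)).2
    linarith
  have hmain := (h.lyap_le_of_noise hq.symmA hq.symmX hq.n_pos hq.k_pos hq.memZ hq.memα hq.memβ
    hq.noise hZ hq.op_pos hs1 hδ (by linarith) hq.η_pos (by linarith [hq.η_le])).1
  have hI := mInner_probDev_ge (X := X) (p := p) (q := q)
    (abs_theta_le hp.memZ hp.memα hp.memβ)
    (abs_theta_le hq.memZ hq.memα fun _ => hq.memβ)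
  have hθ := hq.errTheta_ge hp
  have hL := hq.cond_mul_lyap_le (p := p)
  have hsd : sigmaMin q.Z ^ 2 * procrustes p.Z q.Z ^ 2 ≤ 3 / 2 * compErr X q p := by
    have h1 := sigmaMin_sq_mul_procrustes_sq_le q p
    have h2 := sum_sub_sq_nonneg p q
    have h3 : 0 ≤ (p.β - q.β) ^ 2 * frob X ^ 2 := by positivity
    rw [compErr]; linarith
  have hgap := hq.gap
  have hΓ0 := compErr_nonneg X q p
  have hsq := Real.sq_sqrt hΓ0
  have hN2 : (Real.sqrt k * ζ) ^ 2 = k * ζ ^ 2 := by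
    rw [mul_pow, Real.sq_sqrt (Nat.cast_nonneg k)]
  set E := Real.exp M₁ with hEdef
  set γ := conditioning M₁ q
  set d := procrustes p.Z q.Z
  set s := sigmaMin q.Z
  set N := Real.sqrt k * ζ
  set Γ := Real.sqrt (compErr X q p)
  set I := mInner (probDev X q p) (p.theta X - q.theta X)
  set L := lyap X q p
  have hE0 : 0 < E := by linarith
  -- The scale u is that of the curvature: I ≥ u/8. The error terms `t1` to `t4` use less than u/16
  -- of it, and γL ≤ 2u converts u/32 of the rest into γL/64.
  obtain ⟨u, hu⟩ : ∃ u, u = compErr X q p / E := ⟨_, rfl⟩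
  have hEu : compErr X q p = E * u := by rw [hu]; field_simp
  have hu0 : 0 ≤ u := by rw [hu]; positivity
  rw [hEu] at hsq hθ hL hsd hmain
  have hIu : u / 8 ≤ I := by
    refine le_trans ?_ hI
    rw [Real.exp_neg, ← hEdef]
    have : u / 8 = E⁻¹ / 4 * (E * u / 2) := by field_simp; ring
    rw [this]
    exact mul_le_mul_of_nonneg_left (by linarith) (by positivity)
  have hγL : γ * L ≤ 2 * u := by
    have : E * (γ * L) ≤ E * (2 * u) := by linarith
    exact le_of_mul_le_mul_left this hE0
  have t1 : 8 * N * Γ ≤ u / 32 + 512 * (E * N ^ 2) := by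
    have h1 := sq_nonneg (Γ - 128 * E * N)
    have h2 : E * (8 * N * Γ) ≤ E * (u / 32 + 512 * (E * N ^ 2)) := by linarith
    exact le_of_mul_le_mul_left h2 hE0
  have t2 : 4 * d ^ 4 ≤ 6 / 512 * u := by
    have h1 := mul_le_mul_of_nonneg_right hd (sq_nonneg d)
    have h2 : E * (4 * d ^ 4) ≤ E * (6 / 512 * u) := by linarith
    exact le_of_mul_le_mul_left h2 hE0
  have t3 : 2 * ζ * d ^ 2 ≤ 3 / 10000 * u := by
    have h1 := mul_le_mul_of_nonneg_right hgap (sq_nonneg d)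
    have h2 : E * (2 * ζ * d ^ 2) ≤ E * (3 / 10000 * u) := by linarith
    exact le_of_mul_le_mul_left h2 hE0
  have t4 : (γ / 140) ^ 2 * (E * u) ≤ u / 19600 := by
    have h1 : γ * (γ * E) ≤ 1 * 1 :=
      mul_le_mul hγ1 hq.cond_mul_exp_le (by positivity) zero_le_one
    have h2 := mul_le_mul_of_nonneg_right h1 hu0
    linarith
  have t5 : N ^ 2 ≤ E * N ^ 2 := le_mul_of_one_le_left (sq_nonneg N) hE
  rw [← hN2] at hmain ⊢
  have t6 : -I + (8 * N * Γ + 4 * d ^ 4 + 2 * ζ * d ^ 2 + (γ / 140) ^ 2 * (E * u) + N ^ 2) ≤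
      -(γ * L / 64) + 513 * (E * N ^ 2) := by linarith
  have t7 := mul_le_mul_of_nonneg_left t6 hq.η_pos.le
  linarith

/-- The first step, from a possibly infeasible starting point. -/
lemma WellPosed.first_step (h : IsStep A X M₁ η (opNorm p.Z ^ 2) p p')
    (hinit : 100000 * (Real.exp M₁ ^ 2 * errMetric X q p) ≤ sigmaMin q.Z ^ 4) :
    (opNorm q.Z ^ 2 ≤ 2 * opNorm p.Z ^ 2 ∧ opNorm p.Z ≤ 2 * opNorm q.Z ∧
      |opNorm q.Z ^ 2 / opNorm p.Z ^ 2 - 1| ≤ conditioning M₁ q / 140) ∧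
    (∀ θ : ℝ, 0 < θ → θ ≤ 1 → lyap X q p' ≤
      (1 + η * (θ + conditioning M₁ q / 256)) * lyap X q p + η * (145 / θ * (k * ζ ^ 2))) ∧
    errMetric X q p' ≤ (1 + 50 * η) * errMetric X q p + 200 * η * (k * ζ ^ 2) := by
  have hγ1 := hq.cond_le_one
  have hγ0 := hq.cond_pos
  have hγm := hq.cond_mul
  have hE := hq.exp_ge
  have hd0 := procrustes_nonneg p.Z q.Z
  have hζ := hq.noise.nonneg
  have ha := hq.op_pos
  have hde : opNorm q.Z ^ 2 * procrustes p.Z q.Z ^ 2 ≤ errMetric X q p := by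
    rw [errMetric_eq]
    have := sum_sub_sq_nonneg p q
    have : 0 ≤ (p.β - q.β) ^ 2 * frob X ^ 2 := by positivity
    linarith
  have habs := abs_le.1 (abs_opNorm_sub_le_procrustes p.Z q.Z)
  have hLe := lyap_le_two_mul_errMetric X q p
  have heL := errMetric_le_lyap X q p
  have hgap := hq.gap
  have hN2 : (Real.sqrt k * ζ) ^ 2 = k * ζ ^ 2 := by
    rw [mul_pow, Real.sq_sqrt (Nat.cast_nonneg k)]
  have hstep := fun hZ hs1 hδ => h.lyap_le_of_noise (δ := conditioning M₁ q / 140)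
    hq.symmA hq.symmX hq.n_pos hq.k_pos hq.memZ hq.memα
    hq.memβ hq.noise hZ hq.op_pos hs1 hδ (by linarith) hq.η_pos (by linarith [hq.η_le])
  have hcomp := compErr_le_of_opNorm_le (X := X) (p := p) (q := q)
  have he0 := errMetric_nonneg X q p
  -- Only monotonicity of the sigmoid is used: the logits of the starting point may exceed M₁, so no
  -- positive curvature is available.
  have hI0 : 0 ≤ mInner (probDev X q p) (p.theta X - q.theta X) := by
    have := frob_probDev_sq_le X q p
    have := sq_nonneg (frob (probDev X q p))
    linarith
  have hη := hq.η_pos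
  set E := Real.exp M₁ with hEdef
  set γ := conditioning M₁ q
  set d := procrustes p.Z q.Z
  set s := sigmaMin q.Z
  set a := opNorm q.Z
  set z := opNorm p.Z
  set N := Real.sqrt k * ζ
  set L := lyap X q p
  set e := errMetric X q p
  have hE0 : 0 < E := by linarith
  have hs4 : s ^ 4 = γ ^ 2 * (E ^ 2 * a ^ 4) := by
    have : s ^ 4 = (s ^ 2) ^ 2 := by ring
    rw [this, ← hγm]; ring
  have he : 100000 * e ≤ γ ^ 2 * a ^ 4 := by
    have h1 : E ^ 2 * (100000 * e) ≤ E ^ 2 * (γ ^ 2 * a ^ 4) := by linarith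
    exact le_of_mul_le_mul_left h1 (by positivity)
  -- The basin of the initializer scales with γ², hence d ≤ γa/300. This puts ‖Z⁰‖² within relative
  -- error γ/140 of a², once and for all, since the step sizes never change.
  have hd2 : 100000 * d ^ 2 ≤ γ ^ 2 * a ^ 2 := by
    have h1 : a ^ 2 * (100000 * d ^ 2) ≤ a ^ 2 * (γ ^ 2 * a ^ 2) := by linarith
    exact le_of_mul_le_mul_left h1 (by positivity)
  have hd : d ≤ γ * a / 300 := by
    refine (abs_le_of_sq_le_sq' ?_ (by positivity)).2
    have : 0 ≤ γ ^ 2 * a ^ 2 := by positivity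
    have e1 : (γ * a / 300) ^ 2 = γ ^ 2 * a ^ 2 / 90000 := by ring
    rw [e1]; linarith
  have hda : d ≤ a / 300 := by
    have := mul_le_of_le_one_left ha.le hγ1
    linarith
  have hz1 : 299 / 300 * a ≤ z := by linarith
  have hz2 : z ≤ 301 / 300 * a := by linarith
  have hz0 : 0 < z := by linarith
  have hs1 : a ^ 2 ≤ 2 * z ^ 2 := by
    have h1 := pow_le_pow_left₀ (by positivity) hz1 2
    have : 0 ≤ a ^ 2 := sq_nonneg a
    linarith
  have hZ : z ≤ 2 * a := by linarith
  have hδ : |a ^ 2 / z ^ 2 - 1| ≤ γ / 140 := by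
    have e1 : a ^ 2 / z ^ 2 - 1 = (a - z) * ((a + z) / z ^ 2) := by field_simp; ring
    have h1 : |a - z| ≤ γ * a / 300 := by rw [abs_le]; constructor <;> linarith
    have h2 : 0 ≤ (a + z) / z ^ 2 := by positivity
    rw [e1, abs_mul, abs_of_nonneg h2]
    refine (mul_le_mul_of_nonneg_right h1 h2).trans ?_
    have h3 : a * (a + z) ≤ 300 / 140 * z ^ 2 := by
      have h5 : a ≤ 300 / 299 * z := by linarith
      have h6 : a * (a + z) ≤ (300 / 299 * z) * (300 / 299 * z + z) :=
        mul_le_mul h5 (by linarith) (by positivity) (by positivity)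
      have : 0 ≤ z ^ 2 := sq_nonneg z
      linarith
    have h4 : γ * a / 300 * ((a + z) / z ^ 2) = γ / 300 * (a * (a + z) / z ^ 2) := by ring
    rw [h4]
    have h5 : a * (a + z) / z ^ 2 ≤ 300 / 140 := by
      rw [div_le_iff₀ (by positivity)]; exact h3
    have := mul_le_mul_of_nonneg_left h5 (by positivity : 0 ≤ γ / 300)
    linarith
  refine ⟨⟨hs1, hZ, hδ⟩, ?_⟩
  obtain ⟨hm, hm'⟩ := hstep hZ hs1 hδ
  have hc := hcomp hZ
  have hL0 : 0 ≤ L := he0.trans heL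
  have hγsq : γ ^ 2 ≤ γ := by
    have := mul_le_of_le_one_left hγ0.le hγ1
    rw [sq]; exact this
  have haL : a ^ 2 * d ^ 2 ≤ L := hde.trans heL
  have t2 : 4 * d ^ 4 ≤ γ * L / 25000 := by
    have h1 := mul_le_mul_of_nonneg_right hd2 (sq_nonneg d)
    have h2 : γ ^ 2 * a ^ 2 * d ^ 2 ≤ γ * L := by
      rw [mul_assoc]
      exact mul_le_mul hγsq haL (by positivity) hγ0.le
    linarith
  have t3 : 2 * ζ * d ^ 2 ≤ γ * L / 5000 := by
    have h1 := mul_le_mul_of_nonneg_right hgap (sq_nonneg d)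
    rw [← hγm] at h1
    have h2 := mul_le_mul_of_nonneg_left haL (mul_nonneg hγ0.le hE0.le)
    have h3 : E * (2 * ζ * d ^ 2) ≤ E * (γ * L / 5000) := by linarith
    exact le_of_mul_le_mul_left h3 hE0
  have t4 : (γ / 140) ^ 2 * compErr X q p ≤ 9 / 19600 * (γ * L) := by
    have h1 := mul_le_mul_of_nonneg_left hc (by positivity : 0 ≤ (γ / 140) ^ 2)
    have h2 := mul_le_mul_of_nonneg_right hγsq hL0
    linarith
  have hΓ0 := compErr_nonneg X q p
  have hsqL : Real.sqrt (compErr X q p) ≤ 3 * Real.sqrt L := by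
    rw [Real.sqrt_le_left (by positivity), mul_pow, Real.sq_sqrt hL0]
    linarith
  have hLs := Real.sq_sqrt hL0
  have hN0 : 0 ≤ N := mul_nonneg (Real.sqrt_nonneg _) hζ
  -- Young's inequality with free θ: a θ of order γ when the inflation must be amortized by later
  -- contraction, θ = 1 when a bounded factor suffices.
  have t1 : ∀ θ : ℝ, 0 < θ → 8 * N * Real.sqrt (compErr X q p) ≤ θ * L + 144 / θ * N ^ 2 := by
    intro θ hθ
    have h1 := mul_le_mul_of_nonneg_left hsqL (by positivity : 0 ≤ 8 * N)
    have h2 := sq_nonneg (θ * Real.sqrt L - 12 * N)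
    have h3 : θ * (24 * N * Real.sqrt L) ≤ θ * (θ * L + 144 / θ * N ^ 2) := by
      have e1 : θ * (θ * L + 144 / θ * N ^ 2) = θ ^ 2 * L + 144 * N ^ 2 := by field_simp
      have e2 : θ ^ 2 * Real.sqrt L ^ 2 = θ ^ 2 * L := by rw [hLs]
      rw [e1]
      linarith
    have h4 := le_of_mul_le_mul_left h3 hθ
    linarith
  have hγL : 0 ≤ γ * L := by positivity
  rw [← hN2] at hm hm' ⊢
  constructor
  · intro θ hθ hθ1
    have h5 : N ^ 2 ≤ 1 / θ * N ^ 2 :=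
      le_mul_of_one_le_left (sq_nonneg N) (by rw [le_div_iff₀ hθ]; linarith)
    have h6 := t1 θ hθ
    have e1 : 145 / θ * N ^ 2 = 144 / θ * N ^ 2 + 1 / θ * N ^ 2 := by ring
    have h7 : -mInner (probDev X q p) (p.theta X - q.theta X) +
        (8 * N * Real.sqrt (compErr X q p) + 4 * d ^ 4 + 2 * ζ * d ^ 2
          + (γ / 140) ^ 2 * compErr X q p + N ^ 2) ≤
        (θ + γ / 256) * L + 145 / θ * N ^ 2 := by
      rw [e1]; linarith
    have h8 := mul_le_mul_of_nonneg_left h7 hη.le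
    linarith
  · have h6 := t1 1 one_pos
    have hγL1 : γ * L ≤ L := mul_le_of_le_one_left hL0 hγ1
    have h7 : (8 * N * Real.sqrt (compErr X q p) + 4 * d ^ 4 + 2 * ζ * d ^ 2
          + (γ / 140) ^ 2 * compErr X q p + N ^ 2) + (2 * compErr X q p + N ^ 2) ≤
        50 * e + 200 * N ^ 2 := by
      have := sq_nonneg N
      linarith
    have h8 := mul_le_mul_of_nonneg_left h7 hη.le
    linarith

end WellPosed

end Contraction

/-! ### Errors of the iterates -/

section Iterates

variable {n k : ℕ} {A X : Matrix (Fin n) (Fin n) ℝ} {M₁ η ζ s₀ : ℝ} {q p' : Params n k}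

section Likelihood

variable {p : Params n k} (hq : WellPosed A X M₁ η ζ q)
include hq

lemma WellPosed.symm_noise : (A - sigmoidM (q.theta X)).IsSymm :=
  hq.symmA.sub (sigmoidM_isSymm (theta_isSymm hq.symmX q))

/-- Strong convexity: a feasible point with a small loss is close to the truth. -/
lemma WellPosed.errTheta_le_of_loss (hp : Feasible M₁ X p) {F : ℝ}
    (hF : loss A (p.theta X) - loss A (q.theta X) ≤ F) :
    errTheta X q p ≤ 16 * Real.exp M₁ * F + 1152 * (Real.exp M₁ ^ 2 * (k * ζ ^ 2)) := by
  have h1 := loss_sub_ge A (abs_theta_le hq.memZ hq.memα fun _ => hq.memβ)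
    (abs_theta_le hp.memZ hp.memα hp.memβ)
  have h2 := (abs_le.1 (hq.noise.abs_theta_le hq.symm_noise hq.k_pos q p)).2
  have h3 := hq.errTheta_ge hp
  have hE := hq.exp_ge
  have hζ := hq.noise.nonneg
  have hN2 : (Real.sqrt k * ζ) ^ 2 = k * ζ ^ 2 := by
    rw [mul_pow, Real.sq_sqrt (Nat.cast_nonneg k)]
  have hsq := Real.sq_sqrt (compErr_nonneg X q p)
  have hN0 : 0 ≤ Real.sqrt k * ζ := mul_nonneg (Real.sqrt_nonneg _) hζ
  rw [Real.exp_neg] at h1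
  change _ + _ * errTheta X q p ≤ _ at h1
  rw [← hN2]
  set E := Real.exp M₁
  set N := Real.sqrt k * ζ
  set Γ := Real.sqrt (compErr X q p)
  have hE0 : 0 < E := by linarith
  have h4 := h1.trans hF
  have h5 := mul_le_mul_of_nonneg_left h4 (by positivity : 0 ≤ 16 * E)
  have e1 : 16 * E * (-mInner (A - sigmoidM (q.theta X)) (p.theta X - q.theta X)
      + E⁻¹ / 8 * errTheta X q p) =
      -(16 * E * mInner (A - sigmoidM (q.theta X)) (p.theta X - q.theta X))
      + 2 * errTheta X q p := by
    field_simp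
    ring
  rw [e1] at h5
  have h6 := mul_le_mul_of_nonneg_left h2 (by positivity : 0 ≤ 16 * E)
  -- This is 48ENΓ ≤ Γ²/2 + 1152E²N². By Γ² ≤ 2 `errTheta` the first term is absorbed into the left
  -- side.
  have h7 := sq_nonneg (Γ - 48 * E * N)
  linarith

/-- Upper bound on the excess loss. -/
lemma WellPosed.loss_sub_le (p : Params n k) :
    loss A (p.theta X) - loss A (q.theta X) ≤ compErr X q p + 9 / 2 * (k * ζ ^ 2) := by
  have h1 := LatentSpace.loss_sub_le A (q.theta X) (p.theta X)
  have h2 := (abs_le.1 (hq.noise.abs_theta_le hq.symm_noise hq.k_pos q p)).1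
  have h3 := errTheta_le X q p
  have hN2 : (Real.sqrt k * ζ) ^ 2 = k * ζ ^ 2 := by
    rw [mul_pow, Real.sq_sqrt (Nat.cast_nonneg k)]
  have hsq := Real.sq_sqrt (compErr_nonneg X q p)
  change _ ≤ _ + 1 / 8 * errTheta X q p at h1
  rw [← hN2]
  set N := Real.sqrt k * ζ
  set Γ := Real.sqrt (compErr X q p)
  have h7 := sq_nonneg (Γ - 3 * N)
  linarith

/-- The loss decreases at feasible points that are not too far from the truth. -/
lemma WellPosed.loss_le (h : IsStep A X M₁ η s₀ p p') (hp : Feasible M₁ X p)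
    (hs1 : opNorm q.Z ^ 2 ≤ 2 * s₀)
    (hB : 10000 * (η * errTheta X q p) ≤ opNorm q.Z ^ 4) :
    loss A (p'.theta X) ≤ loss A (p.theta X) := by
  have hE := hq.exp_ge
  have hζ := hq.noise.nonneg
  have ha := hq.op_pos
  have hsa := hq.sigma_le
  have hgap := hq.gap
  have hgap2 := hq.gap_step
  have hη := hq.η_pos
  have hη1 := hq.η_le
  have hV := frob_probDev_sq_le_errTheta X q p
  have hθ : 0 ≤ errTheta X q p := sq_nonneg _
  have hΓ := hq.errTheta_ge hp
  have hG : errG q p ≤ compErr X q p := by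
    have h2 := sum_sub_sq_nonneg p q
    have h3 : 0 ≤ (p.β - q.β) ^ 2 * frob X ^ 2 := by positivity
    rw [compErr]; linarith
  have hN2 : (Real.sqrt k * ζ) ^ 2 = k * ζ ^ 2 := by
    rw [mul_pow, Real.sq_sqrt (Nat.cast_nonneg k)]
  have hN0 : 0 ≤ Real.sqrt k * ζ := mul_nonneg (Real.sqrt_nonneg _) hζ
  have hgradZ := frob_grad_mul_le hq.noise (probDev X q p) p.Z
  have hgradOp := opNorm_grad_le hq.noise (probDev X q p)
  rw [← grad_eq] at hgradZ hgradOp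
  have hz : opNorm p.Z ^ 2 ≤ opNorm q.Z ^ 2 + frob (p.Z * p.Zᵀ - q.Z * q.Zᵀ) := by
    rw [← opNorm_mul_transpose_self, ← opNorm_mul_transpose_self]
    have h1 := opNorm_add_le (q.Z * q.Zᵀ) (p.Z * p.Zᵀ - q.Z * q.Zᵀ)
    rw [add_sub_cancel] at h1
    linarith [opNorm_le_frob (p.Z * p.Zᵀ - q.Z * q.Zᵀ)]
  set S := frob (probDev X q p)
  set N := Real.sqrt k * ζ
  set a := opNorm q.Z
  set E := Real.exp M₁
  have hS0 : 0 ≤ S := frob_nonneg _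
  have ha4 : 0 < a ^ 4 := by positivity
  -- The squares of the quantities to be bounded carry η², while the hypotheses carry η; the surplus
  -- factor is at most 1/1000.
  have ηη : ∀ x : ℝ, 0 ≤ x → η * (η * x) ≤ 1 / 1000 * (η * x) := fun x hx =>
    mul_le_mul_of_nonneg_right hη1 (by positivity)
  have hηS : η * S ≤ a ^ 2 / 2000 := by
    refine (abs_le_of_sq_le_sq' ?_ (by positivity)).2
    have h1 := ηη (S ^ 2) (sq_nonneg _)
    have h2 := mul_le_mul_of_nonneg_left hV hη.le
    have e1 : (η * S) ^ 2 = η * (η * S ^ 2) := by ring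
    have e2 : (a ^ 2 / 2000) ^ 2 = a ^ 4 / 4000000 := by ring
    rw [e1, e2]; linarith
  have hηG : η * frob (p.Z * p.Zᵀ - q.Z * q.Zᵀ) ≤ a ^ 2 / 2000 := by
    refine (abs_le_of_sq_le_sq' ?_ (by positivity)).2
    have h1 := ηη (errG q p) (errG_nonneg p q)
    have h2 := mul_le_mul_of_nonneg_left (hG.trans hΓ) hη.le
    have e1 : (η * frob (p.Z * p.Zᵀ - q.Z * q.Zᵀ)) ^ 2 = η * (η * errG q p) := by
      rw [errG]; ring
    have e2 : (a ^ 2 / 2000) ^ 2 = a ^ 4 / 4000000 := by ring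
    rw [e1, e2]; linarith
  have hs4 : sigmaMin q.Z ^ 4 ≤ a ^ 4 := pow_le_pow_left₀ hq.sigma_pos.le hsa 4
  have hs2 : sigmaMin q.Z ^ 2 ≤ a ^ 2 := pow_le_pow_left₀ hq.sigma_pos.le hsa 2
  have hηN : η * N ≤ a ^ 2 / 10000 := by
    refine (abs_le_of_sq_le_sq' ?_ (by positivity)).2
    have h1 := ηη (k * ζ ^ 2) (hN2 ▸ sq_nonneg _)
    have h0 : 0 ≤ η * (k * ζ ^ 2) := mul_nonneg hη.le (hN2 ▸ sq_nonneg _)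
    have h2 := le_mul_of_one_le_left h0 (one_le_pow₀ hE : 1 ≤ E ^ 3)
    have e1 : (η * N) ^ 2 = η * (η * (k * ζ ^ 2)) := by rw [← hN2]; ring
    have e2 : (a ^ 2 / 10000) ^ 2 = a ^ 4 / 100000000 := by ring
    rw [e1, e2]; linarith
  have hηζ : η * ζ ≤ a ^ 2 / 10000 := by
    have h1 := le_mul_of_one_le_left hζ hE
    have h2 := mul_le_mul_of_nonneg_right (hη1.trans (by norm_num : (1 : ℝ) / 1000 ≤ 1)) hζ
    linarith
  have ha2 : 0 < a ^ 2 := by positivity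
  have hs0 : 0 < s₀ := by linarith
  refine h.loss_le hq.symmA hq.symmX hq.n_pos hp.memZ hp.memα hp.memβ (B := S + N / 2)
    (z := opNorm p.Z) hη (by linarith) hs0 hgradZ le_rfl (opNorm_nonneg _) ?_ ?_
  · linarith
  · have h1 := mul_le_mul_of_nonneg_left hgradOp hη.le
    have h2 := mul_le_mul_of_nonneg_left hz hη.le
    have h3 := mul_le_mul_of_nonneg_right hη1 ha2.le
    linarith

end Likelihood

variable {p : ℕ → Params n k} (hq : WellPosed A X M₁ η ζ q)
include hq

/-- Convergence when the statistical error is well inside the basin of attraction. -/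
lemma WellPosed.iterates_of_small_noise (hp : IsPGD A X M₁ η p)
    (hinit : 100000 * (Real.exp M₁ ^ 2 * errMetric X q (p 0)) ≤ sigmaMin q.Z ^ 4) {ν : ℝ}
    (hν : conditioning M₁ q * ν = Real.exp M₁ * (k * ζ ^ 2))
    (hsmall : 40000000 * ν ≤ conditioning M₁ q * opNorm q.Z ^ 4) (t : ℕ) :
    lyap X q (p (t + 1)) ≤ (1 - η * conditioning M₁ q / 64) ^ t * lyap X q (p 1) + 32832 * ν ∧
    lyap X q (p 1) ≤ (1 + η * conditioning M₁ q / 128) * lyap X q (p 0) + 38 * ν ∧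
    opNorm (p (t + 1)).Z ≤ 2 * opNorm q.Z := by
  obtain ⟨⟨hs1, -, hδ⟩, hθ, -⟩ := hq.first_step (hp.isStep 0) hinit
  have hγ0 := hq.cond_pos
  have hγ1 := hq.cond_le_one
  have hγm := hq.cond_mul
  have hE := hq.exp_ge
  have hη := hq.η_pos
  have hη1 := hq.η_le
  have ha := hq.op_pos
  have hL0 := lyap_nonneg X q (p 0)
  have hL1 := lyap_nonneg X q (p 1)
  have hLe := lyap_le_two_mul_errMetric X q (p 0)
  have hcon := fun t h1 h2 => hq.contraction (hp.isStep (t + 1)) (hp.isStep t).feasible h1 h2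
  -- With θ = γ/256 the total inflation is ηγ/128, half of what one later step contracts, and the
  -- noise term stays of order ν because η ≤ 1/1000.
  have hsθ := hθ (conditioning M₁ q / 256) (by positivity) (by linarith)
  have hkζ : 0 ≤ k * ζ ^ 2 := by positivity
  set γ := conditioning M₁ q
  set E := Real.exp M₁
  set a := opNorm q.Z
  set s := sigmaMin q.Z
  have hE0 : 0 < E := by linarith
  have hν0 : 0 ≤ ν := by
    have : 0 ≤ γ * ν := hν ▸ by positivity
    exact nonneg_of_mul_nonneg_right this hγ0
  have hfirst : lyap X q (p 1) ≤ (1 + η * γ / 128) * lyap X q (p 0) + 38 * ν := by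
    have h1 : 145 / (γ / 256) * (k * ζ ^ 2) ≤ 37120 * ν := by
      have e1 : 145 / (γ / 256) * (k * ζ ^ 2) = 37120 * (k * ζ ^ 2) / γ := by field_simp; ring
      rw [e1, div_le_iff₀ hγ0]
      have := le_mul_of_one_le_left hkζ hE
      linarith
    have h2 := mul_le_mul_of_nonneg_left h1 hη.le
    have h3 := mul_le_mul_of_nonneg_right hη1 hν0
    linarith
  have hs4 : s ^ 4 = γ ^ 2 * (E ^ 2 * a ^ 4) := by
    have : s ^ 4 = (s ^ 2) ^ 2 := by ring
    rw [this, ← hγm]; ring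
  have he : 100000 * errMetric X q (p 0) ≤ γ * a ^ 4 := by
    have h1 : E ^ 2 * (100000 * errMetric X q (p 0)) ≤ E ^ 2 * (γ ^ 2 * a ^ 4) := by linarith
    have h2 := le_of_mul_le_mul_left h1 (by positivity)
    have h3 : γ ^ 2 ≤ γ := by rw [sq]; exact mul_le_of_le_one_left hγ0.le hγ1
    exact h2.trans (mul_le_mul_of_nonneg_right h3 (by positivity))
  have hr0 : 0 ≤ 1 - η * γ / 64 := by
    have := mul_le_mul hη1 hγ1 hγ0.le (by norm_num)
    linarith
  have hr1 : 1 - η * γ / 64 ≤ 1 := by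
    have := mul_pos hη hγ0
    linarith
  -- The smallness of ν and of the initial error ensures that the bound of the induction hypothesis
  -- lies inside the basin, so the contraction applies to the next step.
  have hbasin : ∀ t, lyap X q (p (t + 1)) ≤
      (1 - η * γ / 64) ^ t * lyap X q (p 1) + 32832 * ν →
      512 * E * procrustes (p (t + 1)).Z q.Z ^ 2 ≤ s ^ 2 := by
    intro t ht
    have h1 := mul_le_of_le_one_left hL1 (pow_le_one₀ (n := t) hr0 hr1)
    have h2 : a ^ 2 * procrustes (p (t + 1)).Z q.Z ^ 2 ≤ lyap X q (p (t + 1)) := by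
      have h4 : 0 ≤ 2 * (n * ∑ i, ((p (t + 1)).α i - q.α i) ^ 2)
          + 2 * (((p (t + 1)).β - q.β) ^ 2 * frob X ^ 2) := by
        have := sum_sub_sq_nonneg (p (t + 1)) q
        positivity
      rw [lyap]; linarith
    have h3 : (η * γ / 128) * lyap X q (p 0) ≤ 1 * lyap X q (p 0) := by
      refine mul_le_mul_of_nonneg_right ?_ hL0
      linarith
    have h4 : 512 * (a ^ 2 * procrustes (p (t + 1)).Z q.Z ^ 2) ≤ γ * a ^ 4 := by linarith
    have h5 := mul_le_mul_of_nonneg_left h4 hE0.le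
    have h6 : a ^ 2 * (512 * E * procrustes (p (t + 1)).Z q.Z ^ 2) ≤ a ^ 2 * s ^ 2 := by
      rw [← hγm]; linarith
    exact le_of_mul_le_mul_left h6 (by positivity)
  -- The constant 32832 = 64 · 513 is the fixed point of the recursion with factor 1 − ηγ/64 and
  -- noise 513 ηγν.
  have hall : ∀ t, lyap X q (p (t + 1)) ≤
      (1 - η * γ / 64) ^ t * lyap X q (p 1) + 32832 * ν := by
    intro t
    induction t with
    | zero => simp; linarith
    | succ t ih =>
      have h1 := hcon t hs1 hδ (hbasin t ih)
      have h2 := mul_le_mul_of_nonneg_left ih hr0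
      rw [← hν] at h1
      rw [pow_succ]
      linarith
  refine ⟨hall t, hfirst, ?_⟩
  have h1 := hbasin t (hall t)
  have h2 := (abs_le.1 (abs_opNorm_sub_le_procrustes (p (t + 1)).Z q.Z)).2
  have hd0 := procrustes_nonneg (p (t + 1)).Z q.Z
  have h3 : procrustes (p (t + 1)).Z q.Z ≤ a := by
    refine (abs_le_of_sq_le_sq' ?_ ha.le).2
    have h4 := pow_le_pow_left₀ hq.sigma_pos.le hq.sigma_le 2
    have h5 : 1 * procrustes (p (t + 1)).Z q.Z ^ 2 ≤ 512 * E * procrustes (p (t + 1)).Z q.Z ^ 2 :=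
      mul_le_mul_of_nonneg_right (by linarith) (sq_nonneg _)
    linarith
  linarith

/-- Descent of the loss keeps all iterates close to the truth. -/
lemma WellPosed.errTheta_iterates_le (hp : IsPGD A X M₁ η p)
    (hinit : 100000 * (Real.exp M₁ ^ 2 * errMetric X q (p 0)) ≤ sigmaMin q.Z ^ 4) (t : ℕ) :
    errTheta X q (p (t + 1)) ≤ 432 * (Real.exp M₁ * errMetric X q (p 0))
      + 1400 * (Real.exp M₁ ^ 2 * (k * ζ ^ 2)) := by
  obtain ⟨⟨hs1, -, hδ⟩, hθ, -⟩ := hq.first_step (hp.isStep 0) hinit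
  have hγ0 := hq.cond_pos
  have hγ1 := hq.cond_le_one
  have hγm := hq.cond_mul
  have hE := hq.exp_ge
  have hη := hq.η_pos
  have hη1 := hq.η_le
  have ha := hq.op_pos
  have hL0 := lyap_nonneg X q (p 0)
  have hL1 := lyap_nonneg X q (p 1)
  have hLe := lyap_le_two_mul_errMetric X q (p 0)
  -- With θ = 1 the noise term is η k ζ² without division by γ; the bounded inflation is harmless,
  -- as only the loss after the first step matters.
  have hsθ := hθ 1 one_pos le_rfl
  have hkζ : 0 ≤ k * ζ ^ 2 := by positivity
  have hgap2 := hq.gap_step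
  have he0 := errMetric_nonneg X q (p 0)
  have hs4 : sigmaMin q.Z ^ 4 ≤ opNorm q.Z ^ 4 :=
    pow_le_pow_left₀ hq.sigma_pos.le hq.sigma_le 4
  have hloss0 := hq.loss_sub_le (p 1)
  have hcomp := compErr_le_of_opNorm_le (X := X) (p := p 1) (q := q)
  have hstep := fun t h2 => hq.loss_le (hp.isStep (t + 1)) (hp.isStep t).feasible hs1 h2
  have herr := fun (t : ℕ) (F : ℝ) => hq.errTheta_le_of_loss (hp.isStep t).feasible (F := F)
  have hγ' := hq.cond_mul_exp_le
  have hop1 := (abs_le.1 (abs_opNorm_sub_le_procrustes (p 1).Z q.Z)).2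
  set γ := conditioning M₁ q
  set E := Real.exp M₁
  set a := opNorm q.Z
  set s := sigmaMin q.Z
  set e := errMetric X q (p 0)
  have hE0 : 0 < E := by linarith
  have hEe : e ≤ E * e := le_mul_of_one_le_left he0 hE
  have hEe2 : E * e ≤ E ^ 2 * e := by
    rw [sq, mul_assoc]; exact le_mul_of_one_le_left (by positivity) hE
  have hEζ : k * ζ ^ 2 ≤ E * (k * ζ ^ 2) := le_mul_of_one_le_left hkζ hE
  have hEζ2 : E * (k * ζ ^ 2) ≤ E ^ 2 * (k * ζ ^ 2) := by
    have e1 : E ^ 2 * (k * ζ ^ 2) = E * (E * (k * ζ ^ 2)) := by ring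
    rw [e1]; exact le_mul_of_one_le_left (by positivity) hE
  have hηζ3 : η * (E ^ 2 * (k * ζ ^ 2)) ≤ E ^ 3 * (η * (k * ζ ^ 2)) := by
    have e1 : E ^ 3 * (η * (k * ζ ^ 2)) = E * (η * (E ^ 2 * (k * ζ ^ 2))) := by ring
    rw [e1]
    exact le_mul_of_one_le_left (by positivity) hE
  have hηζ : η * (k * ζ ^ 2) ≤ η * (E ^ 2 * (k * ζ ^ 2)) :=
    mul_le_mul_of_nonneg_left (hEζ.trans hEζ2) hη.le
  have ha4 : 0 < a ^ 4 := by positivity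
  have hL1b : lyap X q (p 1) ≤ 3 * e + 145 * (η * (k * ζ ^ 2)) := by
    have h1 : η * (1 + γ / 256) * lyap X q (p 0) ≤ 1 / 4 * lyap X q (p 0) := by
      refine mul_le_mul_of_nonneg_right ?_ hL0
      have := mul_le_of_le_one_right hη.le hγ1
      linarith
    linarith
  have hZ1 : opNorm (p 1).Z ≤ 2 * a := by
    have h2 : a ^ 2 * procrustes (p 1).Z q.Z ^ 2 ≤ lyap X q (p 1) := by
      have h4 : 0 ≤ 2 * (n * ∑ i, ((p 1).α i - q.α i) ^ 2)
          + 2 * (((p 1).β - q.β) ^ 2 * frob X ^ 2) := by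
        have := sum_sub_sq_nonneg (p 1) q
        positivity
      rw [lyap]; linarith
    have h3 : procrustes (p 1).Z q.Z ≤ a := by
      refine (abs_le_of_sq_le_sq' ?_ ha.le).2
      have h5 : a ^ 2 * procrustes (p 1).Z q.Z ^ 2 ≤ a ^ 2 * a ^ 2 := by linarith
      exact le_of_mul_le_mul_left h5 (by positivity)
    linarith
  have hc := hcomp hZ1
  have hηk : η * (k * ζ ^ 2) ≤ 1 / 1000 * (k * ζ ^ 2) := mul_le_mul_of_nonneg_right hη1 hkζ
  have hF1 : loss A ((p 1).theta X) - loss A (q.theta X) ≤ 27 * e + 15 * (k * ζ ^ 2) := by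
    linarith
  have hbound : ∀ t, loss A ((p (t + 1)).theta X) ≤ loss A ((p 1).theta X) →
      errTheta X q (p (t + 1)) ≤ 432 * (E * e) + 1400 * (E ^ 2 * (k * ζ ^ 2)) := by
    intro t ht
    have h1 := herr t (27 * e + 15 * (k * ζ ^ 2)) (by linarith)
    linarith
  -- The loop closes: a loss below that of the first iterate gives closeness to the truth by strong
  -- convexity, and closeness is what makes the next step a descent step.
  have hall : ∀ t, loss A ((p (t + 1)).theta X) ≤ loss A ((p 1).theta X) := by
    intro t
    induction t with
    | zero => exact le_rfl
    | succ t ih =>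
      refine (hstep t ?_).trans ih
      have h1 := mul_le_mul_of_nonneg_left (hbound t ih) hη.le
      have h2 : η * (E * e) ≤ 1 / 1000 * (E * e) :=
        mul_le_mul_of_nonneg_right hη1 (by positivity)
      linarith
  exact hbound t (hall t)

/-- Errors of the iterates of projected gradient descent. -/
theorem WellPosed.iterates (hp : IsPGD A X M₁ η p)
    (hinit : 100000 * (Real.exp M₁ ^ 2 * errMetric X q (p 0)) ≤ sigmaMin q.Z ^ 4) {ν : ℝ}
    (hν : conditioning M₁ q * ν = Real.exp M₁ * (k * ζ ^ 2)) (t : ℕ) :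
    errMetric X q (p t) ≤
      2 * (1 - η * conditioning M₁ q / 256) ^ t * errMetric X q (p 0) + 1000000 * ν ∧
    compErr X q (p t) ≤ 20000000 *
      ((1 - η * conditioning M₁ q / 256) ^ t * errMetric X q (p 0) + ν) := by
  have hE := hq.exp_ge
  have hγ0 := hq.cond_pos
  have hγ1 := hq.cond_le_one
  have hγm := hq.cond_mul
  have hη := hq.η_pos
  have hη1 := hq.η_le
  have ha := hq.op_pos
  have he0 := errMetric_nonneg X q (p 0)
  have hkζ : 0 ≤ k * ζ ^ 2 := by positivity
  have hν0 : 0 ≤ ν := by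
    have : 0 ≤ conditioning M₁ q * ν := hν ▸ by positivity
    exact nonneg_of_mul_nonneg_right this hγ0
  have hkν : k * ζ ^ 2 ≤ ν := by
    have h1 := le_mul_of_one_le_left hkζ hE
    have h2 := mul_le_of_le_one_left hν0 hγ1
    linarith
  obtain ⟨⟨hs1, hZ0, hδ⟩, -, hfirst⟩ := hq.first_step (hp.isStep 0) hinit
  have hηγ : η * conditioning M₁ q ≤ 1 / 1000 := by
    have := mul_le_mul hη1 hγ1 hγ0.le (by norm_num)
    linarith
  have hηγ0 : 0 < η * conditioning M₁ q := mul_pos hη hγ0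
  set x := η * conditioning M₁ q / 256 with hx
  have hx0 : 0 < x := by positivity
  have hr0 : 0 ≤ 1 - x := by linarith
  have hpow0 : 0 ≤ (1 - x) ^ t := pow_nonneg hr0 t
  have hre0 : 0 ≤ (1 - x) ^ t * errMetric X q (p 0) := mul_nonneg hpow0 he0
  rcases t with _ | t
  · refine ⟨by rw [pow_zero]; linarith, ?_⟩
    have h1 := compErr_le_of_opNorm_le (X := X) hZ0
    have h2 := lyap_le_two_mul_errMetric X q (p 0)
    rw [pow_zero]
    linarith
  -- In the first regime the statistical error lies well inside the basin and contraction works; in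
  -- the second only descent of the loss is available.
  by_cases hsmall : 40000000 * ν ≤ conditioning M₁ q * opNorm q.Z ^ 4
  · obtain ⟨h1, h2, h3⟩ := hq.iterates_of_small_noise hp hinit hν hsmall t
    have e64 : η * conditioning M₁ q / 64 = 4 * x := by rw [hx]; ring
    have e128 : η * conditioning M₁ q / 128 = 2 * x := by rw [hx]; ring
    rw [e64] at h1
    rw [e128] at h2
    have hLe := lyap_le_two_mul_errMetric X q (p 0)
    have hr4 : 0 ≤ 1 - 4 * x := by linarith
    have hr4' : (1 - 4 * x) ^ t ≤ 1 := pow_le_one₀ hr4 (by linarith)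
    have h4 : (1 - 4 * x) ^ t * lyap X q (p 1) ≤
        (1 - 4 * x) ^ t * (1 + 2 * x) * (2 * errMetric X q (p 0)) + 38 * ν := by
      have h5 := mul_le_mul_of_nonneg_left h2 (pow_nonneg hr4 t)
      have h6 := mul_le_of_le_one_left hν0 hr4'
      have h7 := mul_le_mul_of_nonneg_left hLe
        (by positivity : 0 ≤ (1 - 4 * x) ^ t * (1 + 2 * x))
      linarith
    have hL : lyap X q (p (t + 1)) ≤
        (1 - 4 * x) ^ t * (1 + 2 * x) * (2 * errMetric X q (p 0)) + 33000 * ν := by linarith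
    have hc := compErr_le_of_opNorm_le (X := X) h3
    have heL := errMetric_le_lyap X q (p (t + 1))
    -- After a single step the bound through `lyap` would give 2(1 + 2x) times the initial error,
    -- more than the claimed 2(1 − x). The direct bound for `errMetric` in `first_step` has no such
    -- factor 2.
    rcases t with _ | t
    · constructor
      · have h5 : 50 * η * errMetric X q (p 0) ≤ 1 / 20 * errMetric X q (p 0) :=
          mul_le_mul_of_nonneg_right (by linarith) he0
        have h6 : x * errMetric X q (p 0) ≤ 1 / 1000 * errMetric X q (p 0) :=
          mul_le_mul_of_nonneg_right (by linarith) he0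
        have h7 : η * (k * ζ ^ 2) ≤ 1 * (k * ζ ^ 2) :=
          mul_le_mul_of_nonneg_right (by linarith) hkζ
        rw [zero_add, pow_one]
        rw [zero_add] at hfirst
        linarith
      · have h6 : x * errMetric X q (p 0) ≤ 1 / 1000 * errMetric X q (p 0) :=
          mul_le_mul_of_nonneg_right (by linarith) he0
        rw [pow_zero] at hL
        rw [zero_add, pow_one]
        rw [zero_add] at hL hc
        linarith
    -- One contraction by 1 − 4x repays the inflation 1 + 2x and still leaves two factors 1 − x;
    -- this fixes the rate at 1/256.
    · have h5 : (1 - 4 * x) ^ (t + 1) * (1 + 2 * x) ≤ (1 - x) ^ (t + 1 + 1) := by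
        have h6 : (1 - 4 * x) ^ t ≤ (1 - x) ^ t := pow_le_pow_left₀ hr4 (by linarith) t
        have h7 : (1 - 4 * x) * (1 + 2 * x) ≤ (1 - x) ^ 2 := by
          have := sq_nonneg x
          linarith
        calc _ = (1 - 4 * x) ^ t * ((1 - 4 * x) * (1 + 2 * x)) := by ring
          _ ≤ (1 - x) ^ t * (1 - x) ^ 2 := mul_le_mul h6 h7 (by positivity) (by positivity)
          _ = _ := by ring
      have h6 := mul_le_mul_of_nonneg_right h5 (by positivity : 0 ≤ 2 * errMetric X q (p 0))
      constructor <;> linarith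
  -- Now γa⁴ is below a multiple of ν, so the initial condition gives an initial error of at most
  -- 400γν. The descent bound is then of order γe^{M₁}ν, and dividing by γe^{M₁} to pass to `lyap`
  -- still leaves order ν.
  · push Not at hsmall
    have h1 := hq.errTheta_iterates_le hp hinit t
    have h2 := hq.errTheta_ge (hp.isStep t).feasible
    have h3 := hq.cond_mul_lyap_le (p := p (t + 1))
    have h4 := hq.cond_mul_exp_le
    have heL := errMetric_le_lyap X q (p (t + 1))
    set γ := conditioning M₁ q
    set E := Real.exp M₁
    set a := opNorm q.Z
    set s := sigmaMin q.Z
    have hE0 : 0 < E := by linarith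
    have hs4 : s ^ 4 = γ ^ 2 * (E ^ 2 * a ^ 4) := by
      have : s ^ 4 = (s ^ 2) ^ 2 := by ring
      rw [this, ← hγm]; ring
    have he : 100000 * errMetric X q (p 0) ≤ γ * (γ * a ^ 4) := by
      have h5 : E ^ 2 * (100000 * errMetric X q (p 0)) ≤ E ^ 2 * (γ * (γ * a ^ 4)) := by linarith
      exact le_of_mul_le_mul_left h5 (by positivity)
    have he2 : errMetric X q (p 0) ≤ γ * (400 * ν) := by
      have := mul_le_mul_of_nonneg_left hsmall.le hγ0.le
      linarith
    have hθ : errTheta X q (p (t + 1)) ≤ (γ * E) * (174200 * ν) := by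
      have h5 := mul_le_mul_of_nonneg_left he2 hE0.le
      have h6 : E ^ 2 * (k * ζ ^ 2) = γ * E * ν := by
        have : E ^ 2 * (k * ζ ^ 2) = E * (E * (k * ζ ^ 2)) := by ring
        rw [this, ← hν]; ring
      rw [h6] at h1
      linarith
    have hL : lyap X q (p (t + 1)) ≤ 4 * (174200 * ν) := by
      have h5 : (γ * E) * lyap X q (p (t + 1)) ≤ (γ * E) * (4 * (174200 * ν)) := by linarith
      exact le_of_mul_le_mul_left h5 (by positivity)
    have hθ2 : errTheta X q (p (t + 1)) ≤ 174200 * ν :=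
      hθ.trans (mul_le_of_le_one_left (by positivity) h4)
    constructor <;> linarith

end Iterates

/-! ### The noise level of the theorem -/

section Reduction

variable {n k : ℕ}

lemma eight_mul_opNorm_le_frob {X : Matrix (Fin n) (Fin n) ℝ}
    (h : X ≠ 0 → 64 * (k : ℝ) ≤ frob X ^ 2 / opNorm X ^ 2) :
    8 * Real.sqrt k * opNorm X ≤ frob X := by
  have hf : 0 ≤ frob X := Real.sqrt_nonneg _
  by_cases hX : X = 0
  · have : opNorm X ≤ 0 := by
      refine (opNorm_le_frob X).trans ?_
      rw [hX]; simp [frob]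
    have := mul_nonpos_of_nonneg_of_nonpos (by positivity : 0 ≤ 8 * Real.sqrt k) this
    linarith
  · rcases (opNorm_nonneg X).eq_or_lt with h0 | h0
    · rw [← h0, mul_zero]; exact hf
    · have h1 := h hX
      rw [le_div_iff₀ (by positivity)] at h1
      refine le_of_sq_le_sq ?_ hf
      have : (8 * Real.sqrt k * opNorm X) ^ 2 = 64 * Real.sqrt k ^ 2 * opNorm X ^ 2 := by ring
      rw [this, Real.sq_sqrt (Nat.cast_nonneg k)]
      exact h1

lemma noiseLevel_zeta (hk : 1 ≤ k) (A P X : Matrix (Fin n) (Fin n) ℝ) :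
    NoiseLevel k (A - P) X (zeta k A P X) := by
  refine ⟨(le_max_left _ _).trans (le_max_left _ _), ?_⟩
  have hk0 : 0 < Real.sqrt k := Real.sqrt_pos.2 (by exact_mod_cast hk)
  have h : |mInner (A - P) ((frob X)⁻¹ • X)| / Real.sqrt k ≤ zeta k A P X :=
    (le_max_right _ _).trans (le_max_left _ _)
  have hs : mInner (A - P) ((frob X)⁻¹ • X) = (frob X)⁻¹ * mInner (A - P) X := by
    simp [mInner, Matrix.trace_smul]
  rcases (Real.sqrt_nonneg (∑ i, ∑ j, X i j ^ 2)).eq_or_lt with h0 | h0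
  · have hX : X = 0 := frob_eq_zero.1 h0.symm
    rw [hX]; simp [mInner, frob]
  · change 0 < frob X at h0
    rw [hs, abs_mul, abs_of_pos (inv_pos.2 h0), div_le_iff₀ hk0,
      inv_mul_le_iff₀ h0] at h
    linarith

lemma Setting.n_pos {M₀ cη M₁ M₂ η : ℝ} {X : Matrix (Fin n) (Fin n) ℝ} {q : Params n k}
    (h : Setting M₀ cη n k M₁ M₂ η X q) : 0 < n := by
  rcases Nat.eq_zero_or_pos n with rfl | hn
  · have h1 := h.fullRank.trans_le (sigmaMin_le_opNorm h.k_pos q.Z)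
    have h2 := opNorm_le_frob q.Z
    have h3 : frob q.Z = 0 := by simp [frob]
    linarith
  · exact hn

lemma kappa_sq_mul {q : Params n k} (h : 0 < sigmaMin q.Z) (x : ℝ) :
    kappa q.Z ^ 2 * x ≤ opNorm q.Z ^ 2 → 0 < opNorm q.Z → x ≤ sigmaMin q.Z ^ 2 := by
  intro h1 ha
  have e : kappa q.Z ^ 2 * x = opNorm q.Z ^ 2 * (x / sigmaMin q.Z ^ 2) := by
    rw [kappa]; field_simp
  rw [e] at h1
  have h2 : x / sigmaMin q.Z ^ 2 ≤ 1 :=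
    le_of_mul_le_mul_left (by linarith) (by positivity : 0 < opNorm q.Z ^ 2)
  rwa [div_le_one (by positivity)] at h2

/-- The maximum in the signal condition splits into two requirements on σ_min². The entry 1 gives
`gap`; the square root, after squaring, gives `gap_step`, which serves only the descent of the loss.
-/
lemma Setting.wellPosed {M₁ M₂ η ζ : ℝ} {A X : Matrix (Fin n) (Fin n) ℝ} {q : Params n k}
    (h : Setting 64 (1 / 1000) n k M₁ M₂ η X q) (hA : A.IsSymm)
    (hζ : NoiseLevel k (A - sigmoidM (q.theta X)) X ζ)
    (hgap : 10000 * kappa q.Z ^ 2 * Real.exp M₁ * ζ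
      * max (Real.sqrt (η * k * Real.exp M₁)) 1 ≤ opNorm q.Z ^ 2) :
    WellPosed A X M₁ η ζ q := by
  have ha : 0 < opNorm q.Z := h.fullRank.trans_le (sigmaMin_le_opNorm h.k_pos q.Z)
  have hζ0 := hζ.nonneg
  have hη := h.η_pos
  have hs : 10000 * (Real.exp M₁ * ζ) * max (Real.sqrt (η * k * Real.exp M₁)) 1
      ≤ sigmaMin q.Z ^ 2 := kappa_sq_mul h.fullRank _ (by linarith) ha
  have hc : 0 ≤ 10000 * (Real.exp M₁ * ζ) := by positivity
  refine ⟨hA, h.cov.1, h.n_pos, h.k_pos, h.M₂_nonneg.trans h.M₂_le, h.truth.1, h.truth.2.1,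
    h.truth.2.2.1, eight_mul_opNorm_le_frob h.stableRank, hζ, h.η_pos, h.η_le, h.fullRank,
    ?_, ?_⟩
  · exact (le_mul_of_one_le_right hc (le_max_right _ _)).trans hs
  · have h1 := (mul_le_mul_of_nonneg_left (le_max_left _ 1) hc).trans hs
    have h2 := pow_le_pow_left₀ (by positivity) h1 2
    have e : (10000 * (Real.exp M₁ * ζ) * Real.sqrt (η * k * Real.exp M₁)) ^ 2 =
        10000 ^ 2 * (Real.exp M₁ * ζ) ^ 2 * Real.sqrt (η * k * Real.exp M₁) ^ 2 := by ring
    rw [e, Real.sq_sqrt (by positivity)] at h2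
    linarith

lemma rate_eq {M₁ η : ℝ} {q : Params n k} (ha : 0 < opNorm q.Z) :
    rate M₁ (kappa q.Z) η (1 / 256) = 1 - η * conditioning M₁ q / 256 := by
  rw [rate, kappa, conditioning]
  field_simp

lemma GoodInit.bound {M₁ : ℝ} {X : Matrix (Fin n) (Fin n) ℝ} {q p₀ : Params n k}
    (h : GoodInit (1 / 100000) M₁ X q p₀) (hs : 0 < sigmaMin q.Z) (ha : 0 < opNorm q.Z) :
    100000 * (Real.exp M₁ ^ 2 * errMetric X q p₀) ≤ sigmaMin q.Z ^ 4 := by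
  rw [GoodInit] at h
  have e : 1 / 100000 * Real.exp (-2 * M₁) * opNorm q.Z ^ 4 / kappa q.Z ^ 4 =
      sigmaMin q.Z ^ 4 / (100000 * Real.exp M₁ ^ 2) := by
    have : Real.exp (-2 * M₁) = (Real.exp M₁ ^ 2)⁻¹ := by
      rw [← Real.exp_nat_mul, ← Real.exp_neg]; congr 1; push_cast; ring
    rw [kappa, this]
    field_simp
  rw [e, le_div_iff₀ (by positivity)] at h
  linarith

/-- The convergence guarantee, for an arbitrary bound `ζ` on the noise. -/
theorem Setting.iterates {M₁ M₂ η ζ : ℝ} {A X : Matrix (Fin n) (Fin n) ℝ} {q : Params n k}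
    (h : Setting 64 (1 / 1000) n k M₁ M₂ η X q) (hA : A.IsSymm)
    (hζ : NoiseLevel k (A - sigmoidM (q.theta X)) X ζ)
    (hgap : 10000 * kappa q.Z ^ 2 * Real.exp M₁ * ζ
      * max (Real.sqrt (η * k * Real.exp M₁)) 1 ≤ opNorm q.Z ^ 2)
    {p : ℕ → Params n k} (hp : IsPGD A X M₁ η p) (hinit : GoodInit (1 / 100000) M₁ X q (p 0))
    (t : ℕ) :
    errMetric X q (p t) ≤ 2 * rate M₁ (kappa q.Z) η (1 / 256) ^ t * errMetric X q (p 0)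
      + 1000000 * (kappa q.Z ^ 2 * Real.exp (2 * M₁) * ζ ^ 2 * k) ∧
    compErr X q (p t) ≤ 20000000 * (rate M₁ (kappa q.Z) η (1 / 256) ^ t * errMetric X q (p 0)
      + kappa q.Z ^ 2 * Real.exp (2 * M₁) * ζ ^ 2 * k) := by
  have ha : 0 < opNorm q.Z := h.fullRank.trans_le (sigmaMin_le_opNorm h.k_pos q.Z)
  have hs := h.fullRank
  rw [rate_eq ha]
  refine (h.wellPosed hA hζ hgap).iterates hp (hinit.bound hs ha) ?_ t
  have : Real.exp (2 * M₁) = Real.exp M₁ ^ 2 := by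
    rw [← Real.exp_nat_mul]; norm_num
  rw [this, kappa, conditioning]
  field_simp

end Reduction

/-! ### Closed walks and traces of powers -/

section Walks

/-- Induction on the length, peeling off the first vertex. The endpoints are imposed by an
indicator, so that all sums run over plain functions and can be regrouped by kernel. -/
lemma pow_apply_eq_sum_walk {V : Type*} [Fintype V] [DecidableEq V] (M : Matrix V V ℝ) (L : ℕ)
    (i j : V) : (M ^ L) i j = ∑ u : Fin (L + 1) → V,
      if u 0 = i ∧ u (Fin.last L) = j then ∏ t : Fin L, M (u t.castSucc) (u t.succ) else 0 := by
  induction L generalizing i with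
  | zero =>
    rw [← (Equiv.funUnique (Fin 1) V).symm.sum_comp]
    have : ∀ x, (if (Equiv.funUnique (Fin 1) V).symm x 0 = i ∧
        (Equiv.funUnique (Fin 1) V).symm x (Fin.last 0) = j then
        ∏ t : Fin 0, M ((Equiv.funUnique (Fin 1) V).symm x t.castSucc)
          ((Equiv.funUnique (Fin 1) V).symm x t.succ) else 0) =
        if x = i then (if i = j then (1 : ℝ) else 0) else 0 := by
      intro x
      by_cases hx : x = i <;> simp [hx]
    rw [Finset.sum_congr rfl fun x _ => this x, Finset.sum_ite_eq', pow_zero, Matrix.one_apply]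
    simp
  | succ L ih =>
    rw [pow_succ', Matrix.mul_apply]
    simp_rw [ih]
    rw [← (Fin.consEquiv (fun _ : Fin (L + 2) => V)).sum_comp, Fintype.sum_prod_type]
    have h1 : ∀ (x : V) (u : Fin (L + 1) → V),
        (if (Fin.consEquiv (fun _ : Fin (L + 2) => V)) (x, u) 0 = i ∧
          (Fin.consEquiv (fun _ : Fin (L + 2) => V)) (x, u) (Fin.last (L + 1)) = j then
          ∏ t : Fin (L + 1), M ((Fin.consEquiv (fun _ : Fin (L + 2) => V)) (x, u) t.castSucc)
            ((Fin.consEquiv (fun _ : Fin (L + 2) => V)) (x, u) t.succ) else 0) =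
        if x = i then (if u (Fin.last L) = j then
          M i (u 0) * ∏ t : Fin L, M (u t.castSucc) (u t.succ) else 0) else 0 := by
      intro x u
      rw [Fin.prod_univ_succ]
      simp only [Fin.consEquiv_apply, Fin.cons_zero, ← Fin.succ_last, Fin.cons_succ,
        Fin.castSucc_zero, ← Fin.succ_castSucc]
      by_cases hx : x = i
      · subst hx; simp
      · simp [hx]
    simp_rw [h1]
    rw [Finset.sum_comm]
    simp_rw [Finset.sum_ite_eq', Finset.mul_sum]
    rw [Finset.sum_comm]
    refine Finset.sum_congr rfl fun u _ => ?_
    rw [Finset.sum_eq_single (u 0)]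
    · by_cases h : u (Fin.last L) = j <;> simp [h]
    · intro b _ hb
      simp [Ne.symm hb]
    · simp

lemma trace_pow_eq_sum_walk {V : Type*} [Fintype V] [DecidableEq V] (M : Matrix V V ℝ) (L : ℕ) :
    Matrix.trace (M ^ L) = ∑ u : Fin (L + 1) → V,
      if u 0 = u (Fin.last L) then ∏ t : Fin L, M (u t.castSucc) (u t.succ) else 0 := by
  simp_rw [Matrix.trace, Matrix.diag, pow_apply_eq_sum_walk]
  rw [Finset.sum_comm]
  refine Finset.sum_congr rfl fun u _ => ?_
  rw [Finset.sum_eq_single (u 0)]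
  · by_cases h : u 0 = u (Fin.last L)
    · simp [h]
    · simp [h, Ne.symm h]
  · intro b _ hb
    simp [Ne.symm hb]
  · simp

variable {N L : ℕ}

/-- Unordered pairs of distinct elements, listed as increasing pairs. -/
abbrev Edge (N : ℕ) : Type := {e : Fin N × Fin N // e.1 < e.2}

/-- The edge between two distinct vertices. -/
def Edge.of {a b : Fin N} (h : a ≠ b) : Edge N := ⟨(min a b, max a b), min_lt_max.2 h⟩

lemma Edge.of_eq_of_iff {a b c d : Fin N} (h : a ≠ b) (h' : c ≠ d) :
    Edge.of h = Edge.of h' ↔ (a = c ∧ b = d) ∨ (a = d ∧ b = c) := by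
  simp only [Edge.of, Subtype.mk.injEq, Prod.mk.injEq]
  rcases le_total a b with h1 | h1 <;> rcases le_total c d with h2 | h2 <;>
    simp only [h1, h2, min_eq_left, min_eq_right, max_eq_left, max_eq_right] <;>
    simp only [Fin.ext_iff, Fin.le_def, ne_eq] at * <;> omega

/-- The symmetric matrix with zero diagonal and given entries above the diagonal. -/
def symMatrix (x : Edge N → ℝ) : Matrix (Fin N) (Fin N) ℝ :=
  Matrix.of fun i j => if h : i ≠ j then x (Edge.of h) else 0

lemma symMatrix_of_ne (x : Edge N → ℝ) {i j : Fin N} (h : i ≠ j) :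
    symMatrix x i j = x (Edge.of h) := by simp [symMatrix, h]

lemma symMatrix_self (x : Edge N → ℝ) (i : Fin N) : symMatrix x i i = 0 := by simp [symMatrix]

lemma symMatrix_isSymm (x : Edge N → ℝ) : (symMatrix x).IsSymm := by
  ext i j
  rw [Matrix.transpose_apply]
  by_cases h : i = j
  · rw [h]
  · rw [symMatrix_of_ne x h, symMatrix_of_ne x (Ne.symm h)]
    congr 1
    rw [Edge.of_eq_of_iff]
    simp

lemma symMatrix_of_lt (x : Edge N → ℝ) (e : Edge N) : symMatrix x e.1.1 e.1.2 = x e := by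
  rw [symMatrix_of_ne x e.2.ne]
  congr 1
  simp [Edge.of, e.2.le]

lemma eq_symMatrix {M : Matrix (Fin N) (Fin N) ℝ} (hM : M.IsSymm) (h0 : ∀ i, M i i = 0) :
    M = symMatrix fun e => M e.1.1 e.1.2 := by
  ext i j
  by_cases h : i = j
  · rw [h, h0, symMatrix_self]
  · rw [symMatrix_of_ne _ h]
    rcases lt_or_gt_of_ne h with h' | h'
    · simp [Edge.of, h'.le]
    · simp [Edge.of, h'.le, hM.apply i j]

/-- No step of the walk stays in place. -/
def Loopless (u : Fin (L + 1) → Fin N) : Prop := ∀ t : Fin L, u t.castSucc ≠ u t.succ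

/-- The edges of a walk. -/
def Loopless.edge {u : Fin (L + 1) → Fin N} (h : Loopless u) (t : Fin L) : Edge N := Edge.of (h t)

/-- How often a walk uses an edge. -/
def Loopless.count {u : Fin (L + 1) → Fin N} (h : Loopless u) (e : Edge N) : ℕ :=
  (Finset.univ.filter fun t => h.edge t = e).card

lemma Loopless.prod_eq {u : Fin (L + 1) → Fin N} (h : Loopless u) (x : Edge N → ℝ) :
    ∏ t : Fin L, symMatrix x (u t.castSucc) (u t.succ) = ∏ e, x e ^ h.count e := by
  have h1 : ∀ t : Fin L, symMatrix x (u t.castSucc) (u t.succ) = x (h.edge t) :=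
    fun t => symMatrix_of_ne x (h t)
  rw [Finset.prod_congr rfl fun t _ => h1 t, ← Finset.prod_fiberwise' Finset.univ h.edge]
  refine Finset.prod_congr rfl fun e _ => ?_
  rw [Finset.prod_const]; rfl

lemma prod_eq_zero_of_not_loopless {u : Fin (L + 1) → Fin N} (h : ¬ Loopless u)
    (x : Edge N → ℝ) : ∏ t : Fin L, symMatrix x (u t.castSucc) (u t.succ) = 0 := by
  rw [Loopless] at h
  push Not at h
  obtain ⟨t, ht⟩ := h
  refine Finset.prod_eq_zero (Finset.mem_univ t) ?_
  rw [ht, symMatrix_self]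

/-- The pattern of coincidences of a closed walk in which every edge is used at least twice. -/
def GoodShape (s : Setoid (Fin (L + 1))) : Prop :=
  (∀ t : Fin L, ¬ s t.castSucc t.succ) ∧ s 0 (Fin.last L) ∧
    ∀ t : Fin L, ∃ t', t' ≠ t ∧ ((s t'.castSucc t.castSucc ∧ s t'.succ t.succ) ∨
      (s t'.castSucc t.succ ∧ s t'.succ t.castSucc))

lemma GoodShape.loopless {u : Fin (L + 1) → Fin N} (h : GoodShape (Setoid.ker u)) : Loopless u :=
  fun t => h.1 t

lemma GoodShape.two_le_count {u : Fin (L + 1) → Fin N} (h : GoodShape (Setoid.ker u))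
    (t : Fin L) : 2 ≤ h.loopless.count (h.loopless.edge t) := by
  obtain ⟨t', hne, ht'⟩ := h.2.2 t
  have he : h.loopless.edge t' = h.loopless.edge t :=
    (Edge.of_eq_of_iff _ _).2 ht'
  rw [Loopless.count, ← Finset.card_pair hne]
  refine Finset.card_le_card ?_
  intro x hx
  rw [Finset.mem_insert, Finset.mem_singleton] at hx
  rcases hx with rfl | rfl <;> simp [he]

/-- An edge used exactly once contributes its mean, zero, as an independent factor; so closed walks
of bad shape have expectation zero. -/
lemma Loopless.exists_count_eq_one {u : Fin (L + 1) → Fin N} (h : Loopless u)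
    (hc : u 0 = u (Fin.last L)) (hn : ¬ GoodShape (Setoid.ker u)) : ∃ e, h.count e = 1 := by
  have : ¬ ∀ t : Fin L, ∃ t', t' ≠ t ∧
      ((Setoid.ker u t'.castSucc t.castSucc ∧ Setoid.ker u t'.succ t.succ) ∨
      (Setoid.ker u t'.castSucc t.succ ∧ Setoid.ker u t'.succ t.castSucc)) :=
    fun h' => hn ⟨h, hc, h'⟩
  push Not at this
  obtain ⟨t, ht⟩ := this
  refine ⟨h.edge t, ?_⟩
  rw [Loopless.count, Finset.card_eq_one]
  refine ⟨t, ?_⟩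
  ext t'
  simp only [Finset.mem_filter, Finset.mem_univ, true_and, Finset.mem_singleton]
  constructor
  · intro he
    by_contra hne
    have h1 := ht t' hne
    rcases (Edge.of_eq_of_iff _ _).1 he with ⟨ha, hb⟩ | ⟨ha, hb⟩
    · exact h1.1 ha hb
    · exact h1.2 ha hb
  · rintro rfl; rfl

/-- The edges used by a walk. -/
def Loopless.edges {u : Fin (L + 1) → Fin N} (h : Loopless u) : Finset (Edge N) :=
  Finset.univ.image h.edge

lemma Loopless.count_eq_zero_iff {u : Fin (L + 1) → Fin N} (h : Loopless u) (e : Edge N) :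
    h.count e = 0 ↔ e ∉ h.edges := by
  simp [Loopless.count, Loopless.edges, Finset.filter_eq_empty_iff]

lemma GoodShape.two_mul_card_edges_le {u : Fin (L + 1) → Fin N} (h : GoodShape (Setoid.ker u)) :
    2 * h.loopless.edges.card ≤ L := by
  have h1 : ∑ e ∈ h.loopless.edges, h.loopless.count e = L := by
    have := Finset.card_eq_sum_card_image h.loopless.edge Finset.univ
    rw [Finset.card_univ, Fintype.card_fin] at this
    exact this.symm
  refine le_of_le_of_eq ?_ h1
  rw [mul_comm, ← smul_eq_mul]
  refine Finset.card_nsmul_le_sum _ _ _ fun e he => ?_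
  obtain ⟨t, -, rfl⟩ := Finset.mem_image.1 he
  exact h.two_le_count t

/-- A connected graph has at most one more vertex than edges. -/
lemma Loopless.card_image_le {u : Fin (L + 1) → Fin N} (h : Loopless u) :
    (Finset.univ.image u).card ≤ h.edges.card + 1 := by
  -- Induction along the walk: the vertices seen up to time j against the edges crossed before time
  -- j.
  have key : ∀ j : ℕ, j ≤ L → ((Finset.univ.filter fun a : Fin (L + 1) => a.1 ≤ j).image u).card ≤
      ((Finset.univ.filter fun t : Fin L => t.1 < j).image h.edge).card + 1 := by
    intro j
    induction j with
    | zero =>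
      intro _
      have : (Finset.univ.filter fun a : Fin (L + 1) => a.1 ≤ 0) = {0} := by
        ext a
        rw [Finset.mem_filter, Finset.mem_singleton, Fin.ext_iff]
        simp
      rw [this]; simp
    | succ j ih =>
      intro hj
      have ih := ih (by omega)
      set t : Fin L := ⟨j, hj⟩
      have e1 : (Finset.univ.filter fun a : Fin (L + 1) => a.1 ≤ j + 1) =
          insert t.succ (Finset.univ.filter fun a : Fin (L + 1) => a.1 ≤ j) := by
        ext a
        simp only [Finset.mem_filter, Finset.mem_univ, true_and, Finset.mem_insert, Fin.ext_iff,
          Fin.val_succ, t]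
        omega
      have e2 : (Finset.univ.filter fun a : Fin L => a.1 < j + 1) =
          insert t (Finset.univ.filter fun a : Fin L => a.1 < j) := by
        ext a
        simp only [Finset.mem_filter, Finset.mem_univ, true_and, Finset.mem_insert, Fin.ext_iff, t]
        omega
      rw [e1, e2, Finset.image_insert, Finset.image_insert]
      by_cases hm : u t.succ ∈ (Finset.univ.filter fun a : Fin (L + 1) => a.1 ≤ j).image u
      · rw [Finset.insert_eq_of_mem hm]
        refine ih.trans ?_
        have := Finset.card_le_card (Finset.subset_insert (h.edge t)
          ((Finset.univ.filter fun a : Fin L => a.1 < j).image h.edge))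
        omega
      -- A vertex not seen before lies on no earlier edge, so the edge just crossed is new as well.
      · have hm2 : h.edge t ∉ (Finset.univ.filter fun a : Fin L => a.1 < j).image h.edge := by
          intro hc
          obtain ⟨t', ht', he⟩ := Finset.mem_image.1 hc
          rw [Finset.mem_filter] at ht'
          apply hm
          rcases (Edge.of_eq_of_iff _ _).1 he with ⟨-, hb⟩ | ⟨ha, -⟩
          · refine Finset.mem_image.2 ⟨t'.succ, ?_, hb⟩
            simp only [Finset.mem_filter, Finset.mem_univ, true_and, Fin.val_succ]
            omega
          · refine Finset.mem_image.2 ⟨t'.castSucc, ?_, ha⟩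
            simp only [Finset.mem_filter, Finset.mem_univ, true_and, Fin.val_castSucc]
            omega
        rw [Finset.card_insert_of_notMem hm, Finset.card_insert_of_notMem hm2]
        omega
  have h1 := key L le_rfl
  have e1 : (Finset.univ.filter fun a : Fin (L + 1) => a.1 ≤ L) = Finset.univ := by
    ext a; simp; omega
  have e2 : (Finset.univ.filter fun a : Fin L => a.1 < L) = Finset.univ := by
    ext a; simp
  rwa [e1, e2] at h1

lemma card_quotient_ker (u : Fin (L + 1) → Fin N) :
    Nat.card (Quotient (Setoid.ker u)) = (Finset.univ.image u).card := by
  rw [Nat.card_congr (Setoid.quotientKerEquivRange u), Nat.card_coe_set_eq, ← Set.ncard_coe_finset]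
  congr 1
  simp

/-- The maps with a given kernel are the embeddings of the quotient. -/
lemma card_ker_eq (s : Setoid (Fin (L + 1))) :
    Nat.card {u : Fin (L + 1) → Fin N // Setoid.ker u = s} =
      N.descFactorial (Nat.card (Quotient s)) := by
  classical
  have : Fintype (Quotient s) := Fintype.ofFinite _
  have e : (Quotient s ↪ Fin N) ≃ {u : Fin (L + 1) → Fin N // Setoid.ker u = s} := by
    refine Equiv.ofBijective (fun f => ⟨fun a => f (Quotient.mk s a), ?_⟩) ⟨?_, ?_⟩
    · ext a b
      rw [Setoid.ker_def, f.injective.eq_iff, Quotient.eq]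
    · intro f g hfg
      ext x
      obtain ⟨a, rfl⟩ := Quotient.exists_rep x
      have := congrFun (congrArg Subtype.val hfg) a
      exact congrArg Fin.val this
    · rintro ⟨u, rfl⟩
      refine ⟨⟨Setoid.kerLift u, Setoid.kerLift_injective u⟩, ?_⟩
      ext a; rfl
  rw [← Nat.card_congr e, Nat.card_eq_fintype_card, Fintype.card_embedding_eq, Fintype.card_fin,
    Nat.card_eq_fintype_card]

end Walks

/-! ### Comparison of moments -/

section Moments

variable {N L : ℕ}

/-- Every shape is the shape of some walk. -/
lemma exists_ker_eq (s : Setoid (Fin (L + 1))) :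
    ∃ u : Fin (L + 1) → Fin (Nat.card (Quotient s)), Setoid.ker u = s := by
  have h : Nat.card {u : Fin (L + 1) → Fin (Nat.card (Quotient s)) // Setoid.ker u = s} ≠ 0 := by
    rw [card_ker_eq, Nat.descFactorial_self]
    exact Nat.factorial_ne_zero _
  obtain ⟨⟨u, hu⟩⟩ := (Nat.card_ne_zero.1 h).1
  exact ⟨u, hu⟩

/-- Realize the shape by a walk: it has at most one more vertex than edges, and each edge is used at
least twice among L steps. -/
lemma GoodShape.two_mul_card_quotient_le {s : Setoid (Fin (L + 1))} (h : GoodShape s) :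
    2 * Nat.card (Quotient s) ≤ L + 2 := by
  obtain ⟨u, hu⟩ := exists_ker_eq s
  have h' : GoodShape (Setoid.ker u) := by rwa [hu]
  have h1 := h'.loopless.card_image_le
  have h2 := h'.two_mul_card_edges_le
  rw [← card_quotient_ker, hu] at h1
  omega

open Classical in
-- The set of shapes is chosen before N, so sums over walks on vertex sets of different sizes can be
-- compared shape by shape.
lemma sum_ker_eq (f : Setoid (Fin (L + 1)) → ℝ) :
    ∃ S : Finset (Setoid (Fin (L + 1))), (∀ s ∈ S, GoodShape s) ∧ (∀ s, GoodShape s → s ∈ S) ∧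
      ∀ N : ℕ, ∑ u : Fin (L + 1) → Fin N with GoodShape (Setoid.ker u), f (Setoid.ker u) =
        ∑ s ∈ S, (N.descFactorial (Nat.card (Quotient s)) : ℝ) * f s := by
  have hfin : Finite (Setoid (Fin (L + 1))) :=
    Finite.of_injective (fun s : Setoid (Fin (L + 1)) => (s.r : Fin (L + 1) → Fin (L + 1) → Prop))
      fun s t h => by ext a b; exact iff_of_eq (congrFun (congrFun h a) b)
  have : Fintype (Setoid (Fin (L + 1))) := Fintype.ofFinite _
  refine ⟨Finset.univ.filter GoodShape, by simp, by simp, fun N => ?_⟩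
  rw [← Finset.sum_fiberwise_of_maps_to
    (s := Finset.univ.filter fun u : Fin (L + 1) → Fin N => GoodShape (Setoid.ker u))
    (t := Finset.univ.filter GoodShape)
    (g := fun u : Fin (L + 1) → Fin N => Setoid.ker u) (by simp)]
  refine Finset.sum_congr rfl fun s hs => ?_
  rw [Finset.mem_filter] at hs
  rw [Finset.sum_congr rfl (g := fun _ => f s)
    (fun u hu => by rw [(Finset.mem_filter.1 hu).2]), Finset.sum_const, nsmul_eq_mul]
  congr 1
  rw [← card_ker_eq, Nat.card_eq_fintype_card, Fintype.card_subtype]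
  congr 2
  ext u
  simp only [Finset.mem_filter, Finset.mem_univ, true_and, and_iff_right_iff_imp]
  rintro rfl
  exact hs.2

open Classical in
/-- Weighted walks on `n` vertices against walks on `2 m` vertices. -/
lemma sum_goodShape_le {n m : ℕ} (hm : 0 < m) {p : ℝ} (hp : 0 ≤ p) (hnp : n * p ≤ m) :
    m * ∑ u : Fin (2 * m + 1) → Fin n with GoodShape (Setoid.ker u),
        p ^ ((Finset.univ.image u).card - 1) ≤
      n * ∑ u : Fin (2 * m + 1) → Fin (2 * m) with GoodShape (Setoid.ker u), (1 : ℝ) := by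
  have e1 : ∀ u : Fin (2 * m + 1) → Fin n, p ^ ((Finset.univ.image u).card - 1) =
      p ^ (Nat.card (Quotient (Setoid.ker u)) - 1) := fun u => by rw [card_quotient_ker]
  simp_rw [e1]
  obtain ⟨S, hS, hS', hf⟩ := sum_ker_eq (L := 2 * m) fun s => p ^ (Nat.card (Quotient s) - 1)
  obtain ⟨S', hS1, hS1', hf'⟩ := sum_ker_eq (L := 2 * m) fun _ => 1
  have hSS : S' = S := Finset.ext fun s => ⟨fun h => hS' s (hS1 s h), fun h => hS1' s (hS s h)⟩
  rw [hf n, hf' (2 * m), hSS, Finset.mul_sum, Finset.mul_sum]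
  refine Finset.sum_le_sum fun s hs => ?_
  have hv := (hS s hs).two_mul_card_quotient_le
  have hv1 : 0 < Nat.card (Quotient s) := Nat.card_pos_iff.2 ⟨⟨Quotient.mk s 0⟩, inferInstance⟩
  obtain ⟨v, hv'⟩ : ∃ v, Nat.card (Quotient s) = v + 1 := ⟨_, (Nat.succ_pred_eq_of_pos hv1).symm⟩
  rw [hv'] at hv ⊢
  rw [Nat.add_sub_cancel, mul_one]
  have h1 : ((n.descFactorial (v + 1) : ℕ) : ℝ) ≤ (n : ℝ) ^ (v + 1) := by
    exact_mod_cast Nat.descFactorial_le_pow n (v + 1)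
  -- A good shape of length 2m has v + 1 ≤ m + 1 vertices, so every factor of the descending
  -- factorial of 2m is at least m: this is why 2m vertices are taken.
  have h2 : (m : ℝ) ^ (v + 1) ≤ (((2 * m).descFactorial (v + 1) : ℕ) : ℝ) := by
    have := Nat.pow_sub_le_descFactorial (2 * m) (v + 1)
    have h3 : m ^ (v + 1) ≤ (2 * m + 1 - (v + 1)) ^ (v + 1) := Nat.pow_le_pow_left (by omega) _
    exact_mod_cast h3.trans this
  have h3 : (n * p) ^ v ≤ (m : ℝ) ^ v := pow_le_pow_left₀ (by positivity) hnp v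
  calc (m : ℝ) * ((n.descFactorial (v + 1) : ℕ) * p ^ v) ≤ m * ((n : ℝ) ^ (v + 1) * p ^ v) := by
        gcongr
    _ = m * n * (n * p) ^ v := by rw [mul_pow]; ring
    _ ≤ m * n * (m : ℝ) ^ v := by gcongr
    _ = n * (m : ℝ) ^ (v + 1) := by ring
    _ ≤ _ := by gcongr

variable {Ω : Type*} [MeasurableSpace Ω] {μ : Measure Ω} [IsProbabilityMeasure μ]
  {w : Edge N → Ω → ℝ}

/-- Independent bounded centered entries above the diagonal. -/
structure CenteredEntries (μ : Measure Ω) (w : Edge N → Ω → ℝ) : Prop where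
  indep : iIndepFun w μ
  meas : ∀ e, Measurable (w e)
  bdd : ∃ B, ∀ e ω, |w e ω| ≤ B
  mean : ∀ e, ∫ ω, w e ω ∂μ = 0

lemma CenteredEntries.integrable_prod (h : CenteredEntries μ w) (c : Edge N → ℕ) :
    Integrable (fun ω => ∏ e, w e ω ^ c e) μ := by
  obtain ⟨B, hB⟩ := h.bdd
  refine Integrable.of_bound (C := ∏ e, |B| ^ c e)
    (Finset.measurable_prod _ fun e _ => (h.meas e).pow_const _).aestronglyMeasurable
    (ae_of_all _ fun ω => ?_)
  rw [Real.norm_eq_abs, Finset.abs_prod]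
  refine Finset.prod_le_prod (fun e _ => abs_nonneg _) fun e _ => ?_
  rw [abs_pow]
  exact pow_le_pow_left₀ (abs_nonneg _) ((hB e ω).trans (le_abs_self B)) _

omit [IsProbabilityMeasure μ] in
lemma CenteredEntries.integral_prod (h : CenteredEntries μ w) (c : Edge N → ℕ) :
    ∫ ω, ∏ e, w e ω ^ c e ∂μ = ∏ e, ∫ ω, w e ω ^ c e ∂μ := by
  have h1 : iIndepFun (fun e ω => w e ω ^ c e) μ :=
    h.indep.comp (fun e x => x ^ c e) fun e => measurable_id.pow_const _
  exact h1.integral_fun_prod_eq_prod_integral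
    fun e => ((h.meas e).pow_const _).aestronglyMeasurable

lemma CenteredEntries.integrable_walk (h : CenteredEntries μ w) (u : Fin (L + 1) → Fin N) :
    Integrable (fun ω => ∏ t : Fin L, symMatrix (fun e => w e ω) (u t.castSucc) (u t.succ)) μ := by
  by_cases hu : Loopless u
  · simp_rw [hu.prod_eq]
    exact h.integrable_prod _
  · simp_rw [prod_eq_zero_of_not_loopless hu]
    exact integrable_zero _ _ _

omit [IsProbabilityMeasure μ] in
lemma CenteredEntries.integral_walk_of_not_good (h : CenteredEntries μ w)
    {u : Fin (L + 1) → Fin N} (hc : u 0 = u (Fin.last L)) (hn : ¬ GoodShape (Setoid.ker u)) :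
    ∫ ω, ∏ t : Fin L, symMatrix (fun e => w e ω) (u t.castSucc) (u t.succ) ∂μ = 0 := by
  by_cases hu : Loopless u
  · obtain ⟨e, he⟩ := hu.exists_count_eq_one hc hn
    simp_rw [hu.prod_eq]
    rw [h.integral_prod]
    refine Finset.prod_eq_zero (Finset.mem_univ e) ?_
    simp_rw [he, pow_one]
    exact h.mean e
  · simp_rw [prod_eq_zero_of_not_loopless hu]
    exact integral_zero _ _

lemma CenteredEntries.integrable_trace (h : CenteredEntries μ w) (L : ℕ) :
    Integrable (fun ω => Matrix.trace (symMatrix (fun e => w e ω) ^ L)) μ := by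
  simp_rw [trace_pow_eq_sum_walk]
  refine integrable_finsetSum _ fun u _ => ?_
  split_ifs
  · exact h.integrable_walk u
  · exact integrable_zero _ _ _

open Classical in
lemma CenteredEntries.integral_trace (h : CenteredEntries μ w) (L : ℕ) :
    ∫ ω, Matrix.trace (symMatrix (fun e => w e ω) ^ L) ∂μ =
      ∑ u : Fin (L + 1) → Fin N with GoodShape (Setoid.ker u),
        ∫ ω, ∏ t : Fin L, symMatrix (fun e => w e ω) (u t.castSucc) (u t.succ) ∂μ := by
  simp_rw [trace_pow_eq_sum_walk]
  rw [integral_finsetSum _ fun u _ => by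
    split_ifs
    · exact h.integrable_walk u
    · exact integrable_zero _ _ _, Finset.sum_filter]
  refine Finset.sum_congr rfl fun u _ => ?_
  by_cases hc : u 0 = u (Fin.last L)
  · simp only [hc, if_true]
    split_ifs with hg
    · rfl
    · exact h.integral_walk_of_not_good hc hg
  · have : ¬ GoodShape (Setoid.ker u) := fun hg => hc hg.2.1
    simp [hc, this]

open Classical in
-- Each distinct edge of a good walk contributes a factor at most p, and there are at least as many
-- edges as vertices minus one; p ≤ 1 allows dropping the rest.
lemma CenteredEntries.integral_trace_le (h : CenteredEntries μ w) {p : ℝ} (hp : 0 ≤ p)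
    (hp1 : p ≤ 1) (hw : ∀ e, ∀ s, 2 ≤ s → |∫ ω, w e ω ^ s ∂μ| ≤ p) (L : ℕ) :
    ∫ ω, Matrix.trace (symMatrix (fun e => w e ω) ^ L) ∂μ ≤
      ∑ u : Fin (L + 1) → Fin N with GoodShape (Setoid.ker u),
        p ^ ((Finset.univ.image u).card - 1) := by
  rw [h.integral_trace]
  refine Finset.sum_le_sum fun u hu => ?_
  have hg : GoodShape (Setoid.ker u) := (Finset.mem_filter.1 hu).2
  simp_rw [hg.loopless.prod_eq]
  rw [h.integral_prod]
  refine (le_abs_self _).trans ?_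
  rw [Finset.abs_prod]
  have h1 : ∏ e, |∫ ω, w e ω ^ hg.loopless.count e ∂μ| ≤
      ∏ e, if e ∈ hg.loopless.edges then p else 1 := by
    refine Finset.prod_le_prod (fun e _ => abs_nonneg _) fun e _ => ?_
    split_ifs with he
    · obtain ⟨t, -, rfl⟩ := Finset.mem_image.1 he
      exact hw _ _ (hg.two_le_count t)
    · rw [(hg.loopless.count_eq_zero_iff e).2 he]
      simp
  refine h1.trans ?_
  rw [Finset.prod_ite_mem, Finset.univ_inter, Finset.prod_const]
  exact pow_le_pow_of_le_one hp hp1 (by have := hg.loopless.card_image_le; omega)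

open Classical in
-- The reverse direction: if all moments of order at least two are at least 1, every good walk
-- contributes at least 1.
lemma CenteredEntries.le_integral_trace (h : CenteredEntries μ w)
    (hw : ∀ e, ∀ s, 2 ≤ s → 1 ≤ ∫ ω, w e ω ^ s ∂μ) (L : ℕ) :
    ∑ u : Fin (L + 1) → Fin N with GoodShape (Setoid.ker u), (1 : ℝ) ≤
      ∫ ω, Matrix.trace (symMatrix (fun e => w e ω) ^ L) ∂μ := by
  rw [h.integral_trace]
  refine Finset.sum_le_sum fun u hu => ?_
  have hg : GoodShape (Setoid.ker u) := (Finset.mem_filter.1 hu).2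
  simp_rw [hg.loopless.prod_eq]
  rw [h.integral_prod]
  rw [← Finset.prod_const_one (ι := Edge N) (s := Finset.univ)]
  refine Finset.prod_le_prod (fun _ _ => zero_le_one) fun e _ => ?_
  by_cases he : e ∈ hg.loopless.edges
  · obtain ⟨t, -, rfl⟩ := Finset.mem_image.1 he
    exact hw _ _ (hg.two_le_count t)
  · rw [(hg.loopless.count_eq_zero_iff e).2 he]
    simp

/-- Comparison of the moments of a sparse random matrix with those of a smaller dense one. -/
lemma integral_trace_pow_le_comparator {n m : ℕ} (hm : 0 < m) {p : ℝ} (hp : 0 ≤ p) (hp1 : p ≤ 1)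
    (hnp : n * p ≤ m) {w : Edge n → Ω → ℝ} (h : CenteredEntries μ w)
    (hw : ∀ e, ∀ s, 2 ≤ s → |∫ ω, w e ω ^ s ∂μ| ≤ p)
    {Ω' : Type*} [MeasurableSpace Ω'] {μ' : Measure Ω'} [IsProbabilityMeasure μ']
    {w' : Edge (2 * m) → Ω' → ℝ} (h' : CenteredEntries μ' w')
    (hw' : ∀ e, ∀ s, 2 ≤ s → 1 ≤ ∫ ω, w' e ω ^ s ∂μ') :
    m * ∫ ω, Matrix.trace (symMatrix (fun e => w e ω) ^ (2 * m)) ∂μ ≤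
      n * ∫ ω, Matrix.trace (symMatrix (fun e => w' e ω) ^ (2 * m)) ∂μ' := by
  classical
  calc _ ≤ _ := mul_le_mul_of_nonneg_left (h.integral_trace_le hp hp1 hw (2 * m))
        (Nat.cast_nonneg m)
    _ ≤ _ := sum_goodShape_le hm hp hnp
    _ ≤ _ := mul_le_mul_of_nonneg_left (h'.le_integral_trace hw' (2 * m)) (Nat.cast_nonneg n)

end Moments

/-! ### Norms of dense random matrices -/

section Nets

variable {r : ℕ}

/-- A 1/2-separated subset of the unit ball of largest cardinality. Scaled by 2 it is 1-separated in
the ball of radius 2, where the volume bound 5^r applies. -/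
lemma exists_net (r : ℕ) : ∃ S : Finset (EuclideanSpace ℝ (Fin r)), S.card ≤ 5 ^ r ∧
    (∀ c ∈ S, ‖c‖ ≤ 1) ∧ ∀ x : EuclideanSpace ℝ (Fin r), ‖x‖ ≤ 1 → ∃ c ∈ S, ‖x - c‖ ≤ 1 / 2 := by
  classical
  let Q : Finset (EuclideanSpace ℝ (Fin r)) → Prop := fun S => (∀ c ∈ S, ‖c‖ ≤ 1) ∧
    ∀ c ∈ S, ∀ d ∈ S, c ≠ d → 1 / 2 ≤ ‖c - d‖
  have hcard : ∀ S, Q S → S.card ≤ 5 ^ r := by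
    intro S hS
    have h := Besicovitch.card_le_of_separated (S.image fun x => (2 : ℝ) • x) ?_ ?_
    · rwa [Finset.card_image_of_injective _ (smul_right_injective _ two_ne_zero),
        finrank_euclideanSpace_fin] at h
    · intro c hc
      obtain ⟨x, hx, rfl⟩ := Finset.mem_image.1 hc
      rw [norm_smul, Real.norm_two]
      linarith [hS.1 x hx]
    · intro c hc d hd hcd
      obtain ⟨x, hx, rfl⟩ := Finset.mem_image.1 hc
      obtain ⟨y, hy, rfl⟩ := Finset.mem_image.1 hd
      rw [← smul_sub, norm_smul, Real.norm_two]
      linarith [hS.2 x hx y hy fun h => hcd (by rw [h])]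
  have hne : ∃ k S, Q S ∧ S.card = k := ⟨0, ∅, ⟨by simp, by simp⟩, rfl⟩
  obtain ⟨S, hS, hmax⟩ : ∃ S, Q S ∧ ∀ S', Q S' → S'.card ≤ S.card := by
    obtain ⟨S, hS, hc⟩ := Nat.findGreatest_spec (P := fun k => ∃ S, Q S ∧ S.card = k)
      (Nat.zero_le (5 ^ r)) ⟨∅, ⟨by simp, by simp⟩, rfl⟩
    refine ⟨S, hS, fun S' hS' => ?_⟩
    rw [hc]
    exact Nat.le_findGreatest (hcard S' hS') ⟨S', hS', rfl⟩
  refine ⟨S, hcard S hS, hS.1, fun x hx => ?_⟩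
  by_contra! hcon
  have hxS : x ∉ S := by
    intro h
    have := hcon x h
    rw [sub_self, norm_zero] at this
    linarith
  have h1 := hmax (insert x S) ⟨?_, ?_⟩
  · rw [Finset.card_insert_of_notMem hxS] at h1
    omega
  · intro c hc
    rcases Finset.mem_insert.1 hc with rfl | hc
    · exact hx
    · exact hS.1 c hc
  · intro c hc d hd hcd
    rcases Finset.mem_insert.1 hc with h1 | h1 <;> rcases Finset.mem_insert.1 hd with h2 | h2
    · exact absurd (h1.trans h2.symm) hcd
    · rw [h1]; exact (hcon d h2).le
    · rw [h2, norm_sub_rev]; exact (hcon c h1).le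
    · exact hS.2 c h1 d h2 hcd

/-- A matrix norm is controlled by the bilinear form on a net. -/
lemma opNorm_pow_le_sum_net {S : Finset (EuclideanSpace ℝ (Fin r))}
    (hS : ∀ x : EuclideanSpace ℝ (Fin r), ‖x‖ ≤ 1 → ∃ c ∈ S, ‖x - c‖ ≤ 1 / 2)
    (M : Matrix (Fin r) (Fin r) ℝ) (L : ℕ) :
    opNorm M ^ L ≤ 4 ^ L * ∑ c ∈ S, ∑ d ∈ S, |d.ofLp ⬝ᵥ (M *ᵥ c.ofLp)| ^ L := by
  set T := LinearMap.toContinuousLinearMap (Matrix.toEuclideanLin M) with hT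
  have hTd : ∀ c d : EuclideanSpace ℝ (Fin r), d.ofLp ⬝ᵥ (M *ᵥ c.ofLp) = inner ℝ d (T c) := by
    intro c d
    rw [EuclideanSpace.inner_eq_star_dotProduct, hT]
    simp [Matrix.toLpLin_apply, dotProduct_comm]
  obtain ⟨c0, hc0, -⟩ := hS 0 (by simp)
  obtain ⟨⟨c, d⟩, hcd, hmax⟩ := Finset.exists_max_image (S ×ˢ S)
    (fun x => |x.2.ofLp ⬝ᵥ (M *ᵥ x.1.ofLp)|) ⟨(c0, c0), by simp [hc0]⟩
  rw [Finset.mem_product] at hcd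
  set K := |d.ofLp ⬝ᵥ (M *ᵥ c.ofLp)| with hK
  have hK0 : 0 ≤ K := abs_nonneg _
  -- Approximating each of the two unit vectors by the net at distance 1/2 costs a factor 2, hence
  -- the 4 in the statement.
  have h1 : ∀ c ∈ S, ‖T c‖ ≤ 2 * K := by
    intro c hc
    rcases eq_or_ne (T c) 0 with h0 | h0
    · rw [h0, norm_zero]; positivity
    · have hpos : 0 < ‖T c‖ := norm_pos_iff.2 h0
      obtain ⟨d, hd, hxd⟩ := hS (‖T c‖⁻¹ • T c) (by
        rw [norm_smul, norm_inv, norm_norm, inv_mul_cancel₀ hpos.ne'])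
      have h2 : inner ℝ (‖T c‖⁻¹ • T c) (T c) = ‖T c‖ := by
        rw [real_inner_smul_left, real_inner_self_eq_norm_sq]
        field_simp
      have h3 : inner ℝ (‖T c‖⁻¹ • T c - d) (T c) ≤ 1 / 2 * ‖T c‖ :=
        (real_inner_le_norm _ _).trans (mul_le_mul_of_nonneg_right hxd hpos.le)
      rw [inner_sub_left, h2, ← hTd] at h3
      have h4 := hmax (c, d) (Finset.mem_product.2 ⟨hc, hd⟩)
      have h5 := le_abs_self (d.ofLp ⬝ᵥ (M *ᵥ c.ofLp))
      simp only at h4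
      linarith
  have hop : opNorm M = ‖T‖ := rfl
  have h2 : ‖T‖ ≤ 2 * K + 1 / 2 * ‖T‖ := by
    refine ContinuousLinearMap.opNorm_le_of_unit_norm (𝕜 := ℝ) (by positivity) fun x hx => ?_
    obtain ⟨c, hc, hxc⟩ := hS x hx.le
    have h3 : T x = T c + T (x - c) := by rw [map_sub]; abel
    have h4 := T.le_opNorm (x - c)
    have h5 := mul_le_mul_of_nonneg_left hxc (norm_nonneg T)
    have h6 := norm_add_le (T c) (T (x - c))
    rw [← h3] at h6
    linarith [h1 c hc]
  have h3 : opNorm M ≤ 4 * K := by rw [hop]; linarith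
  refine (pow_le_pow_left₀ (opNorm_nonneg M) h3 L).trans ?_
  rw [mul_pow]
  refine mul_le_mul_of_nonneg_left ?_ (by positivity)
  rw [← Finset.sum_product']
  exact Finset.single_le_sum (f := fun x : EuclideanSpace ℝ (Fin r) × EuclideanSpace ℝ (Fin r) =>
    |x.2.ofLp ⬝ᵥ (M *ᵥ x.1.ofLp)| ^ L) (fun _ _ => by positivity) (Finset.mem_product.2 hcd)

lemma sum_edge_eq {N : ℕ} (F : Fin N → Fin N → ℝ) :
    ∑ e : Edge N, (F e.1.1 e.1.2 + F e.1.2 e.1.1) =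
      ∑ i, ∑ j, if i = j then 0 else F i j := by
  have h1 : ∑ e : Edge N, F e.1.1 e.1.2 =
      ∑ x : Fin N × Fin N, if x.1 < x.2 then F x.1 x.2 else 0 := by
    rw [← Finset.sum_filter]
    exact (Finset.sum_subtype _ (by simp) fun x : Fin N × Fin N => F x.1 x.2).symm
  have h2 : ∑ e : Edge N, F e.1.2 e.1.1 =
      ∑ x : Fin N × Fin N, if x.2 < x.1 then F x.1 x.2 else 0 := by
    rw [← (Equiv.prodComm (Fin N) (Fin N)).sum_comp]
    rw [← Finset.sum_filter]
    exact (Finset.sum_subtype _ (fun x => by rw [Finset.mem_filter]; exact and_iff_right (Finset.mem_univ x))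
      fun x : Fin N × Fin N => F x.2 x.1).symm
  rw [Finset.sum_add_distrib, h1, h2, ← Finset.sum_add_distrib, Fintype.sum_prod_type]
  refine Finset.sum_congr rfl fun i _ => Finset.sum_congr rfl fun j _ => ?_
  rcases lt_trichotomy i j with h | h | h
  · simp [h, h.ne, h.not_gt]
  · simp [h]
  · simp [h, h.ne', h.not_gt]

lemma dotProduct_symMatrix (x : Edge r → ℝ) (c d : Fin r → ℝ) :
    d ⬝ᵥ (symMatrix x *ᵥ c) = ∑ e : Edge r, (d e.1.1 * c e.1.2 + d e.1.2 * c e.1.1) * x e := by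
  have h := sum_edge_eq fun i j => d i * (symMatrix x i j * c j)
  have h1 : ∀ e : Edge r, d e.1.1 * (symMatrix x e.1.1 e.1.2 * c e.1.2) +
      d e.1.2 * (symMatrix x e.1.2 e.1.1 * c e.1.1) =
      (d e.1.1 * c e.1.2 + d e.1.2 * c e.1.1) * x e := by
    intro e
    rw [(symMatrix_isSymm x).apply e.1.1 e.1.2, symMatrix_of_lt]
    ring
  rw [← Finset.sum_congr rfl fun e _ => h1 e, h]
  simp only [dotProduct, Matrix.mulVec, Finset.mul_sum]
  refine Finset.sum_congr rfl fun i _ => Finset.sum_congr rfl fun j _ => ?_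
  split_ifs with hij
  · rw [hij, symMatrix_self]; ring
  · rfl

lemma sum_edge_coeff_sq_le (c d : EuclideanSpace ℝ (Fin r)) (hc : ‖c‖ ≤ 1) (hd : ‖d‖ ≤ 1) :
    ∑ e : Edge r, (d e.1.1 * c e.1.2 + d e.1.2 * c e.1.1) ^ 2 ≤ 2 := by
  have h1 : ∑ e : Edge r, (d e.1.1 * c e.1.2 + d e.1.2 * c e.1.1) ^ 2 ≤
      2 * ∑ e : Edge r, ((d e.1.1 * c e.1.2) ^ 2 + (d e.1.2 * c e.1.1) ^ 2) := by
    rw [Finset.mul_sum]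
    refine Finset.sum_le_sum fun e _ => ?_
    have := sq_nonneg (d e.1.1 * c e.1.2 - d e.1.2 * c e.1.1)
    linarith
  rw [sum_edge_eq fun i j => (d i * c j) ^ 2] at h1
  have h2 : ∑ i, ∑ j, (if i = j then 0 else (d i * c j) ^ 2) ≤ ‖d‖ ^ 2 * ‖c‖ ^ 2 := by
    rw [EuclideanSpace.real_norm_sq_eq, EuclideanSpace.real_norm_sq_eq, Finset.sum_mul_sum]
    refine Finset.sum_le_sum fun i _ => Finset.sum_le_sum fun j _ => ?_
    split_ifs
    · positivity
    · rw [mul_pow]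
  have h3 : ‖d‖ ^ 2 * ‖c‖ ^ 2 ≤ 1 :=
    mul_le_one₀ (pow_le_one₀ (norm_nonneg d) hd) (sq_nonneg _) (pow_le_one₀ (norm_nonneg c) hc)
  linarith

/-- From x^L ≤ L! e^x at x = √L |z| and L! ≤ L^L. The scale √L is the one at which a subgaussian
exponential moment yields an L-th moment of order (C√L)^L. -/
lemma pow_le_sqrt_pow_mul_exp (z : ℝ) {L : ℕ} (hL : 0 < L) :
    |z| ^ L ≤ Real.sqrt L ^ L * (Real.exp (Real.sqrt L * z) + Real.exp (-Real.sqrt L * z)) := by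
  have hs : 0 < Real.sqrt L := Real.sqrt_pos.2 (by exact_mod_cast hL)
  have h1 := Real.pow_div_factorial_le_exp (x := Real.sqrt L * |z|) (by positivity) L
  rw [div_le_iff₀ (by positivity), mul_pow] at h1
  have h2 : (L.factorial : ℝ) ≤ Real.sqrt L ^ L * Real.sqrt L ^ L := by
    rw [← mul_pow, Real.mul_self_sqrt (Nat.cast_nonneg L)]
    exact_mod_cast Nat.factorial_le_pow L
  have h3 : Real.exp (Real.sqrt L * |z|) ≤
      Real.exp (Real.sqrt L * z) + Real.exp (-Real.sqrt L * z) := by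
    rcases abs_cases z with ⟨h, -⟩ | ⟨h, -⟩
    · rw [h]; linarith [Real.exp_pos (-Real.sqrt L * z)]
    · rw [h, mul_neg, ← neg_mul]; linarith [Real.exp_pos (Real.sqrt L * z)]
  have h4 : Real.sqrt L ^ L * |z| ^ L ≤ Real.sqrt L ^ L * (Real.sqrt L ^ L *
      Real.exp (Real.sqrt L * |z|)) := by
    refine h1.trans ?_
    have := mul_le_mul_of_nonneg_left h2 (Real.exp_nonneg (Real.sqrt L * |z|))
    linarith
  refine (le_of_mul_le_mul_left h4 (by positivity)).trans ?_
  exact mul_le_mul_of_nonneg_left h3 (by positivity)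

end Nets

/-! ### Subgaussian moments and the dense two-point comparison matrix -/

section Comparator

variable {r L : ℕ} {Ω : Type*} [MeasurableSpace Ω] {μ : Measure Ω} [IsProbabilityMeasure μ]

/-- Hoeffding's lemma: an interval of length 3 gives variance proxy 9/4 per entry, and the squared
coefficients sum to at most 2. -/
lemma CenteredEntries.subgaussian {w : Edge r → Ω → ℝ} (h : CenteredEntries μ w)
    (hw : ∀ e ω, w e ω ∈ Set.Icc (-1 : ℝ) 2) {a : Edge r → ℝ} (ha : ∑ e, a e ^ 2 ≤ 2) (t : ℝ) :
    Integrable (fun ω => Real.exp (t * ∑ e, a e * w e ω)) μ ∧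
      ∫ ω, Real.exp (t * ∑ e, a e * w e ω) ∂μ ≤ Real.exp (9 / 4 * t ^ 2) := by
  have h1 : ∀ e, HasSubgaussianMGF (fun ω => a e * w e ω)
      (‖a e‖₊ ^ 2 * (‖(2 : ℝ) - -1‖₊ / 2) ^ 2) μ := fun e => by
    have h0 := (hasSubgaussianMGF_of_mem_Icc_of_integral_eq_zero (h.meas e).aemeasurable
      (ae_of_all _ (hw e)) (h.mean e)).const_mul (a e)
    have e1 : ‖a e‖₊ ^ 2 = ⟨a e ^ 2, sq_nonneg (a e)⟩ := NNReal.coe_injective (sq_abs (a e))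
    rwa [e1]
  have h2 : iIndepFun (fun e ω => a e * w e ω) μ :=
    h.indep.comp (fun e x => a e * x) fun e => measurable_const_mul (a e)
  have h3 := HasSubgaussianMGF.sum_of_iIndepFun h2 (s := Finset.univ) fun e _ => h1 e
  refine ⟨h3.integrable_exp_mul t, (h3.mgf_le t).trans (Real.exp_le_exp.2 ?_)⟩
  have h4 : ((∑ e : Edge r, (‖a e‖₊ ^ 2 * (‖(2 : ℝ) - -1‖₊ / 2) ^ 2) : NNReal) : ℝ) = (∑ e, a e ^ 2) * (9 / 4) := by
    rw [NNReal.coe_sum, Finset.sum_mul]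
    refine Finset.sum_congr rfl fun e _ => ?_
    push_cast
    rw [Real.norm_eq_abs, Real.norm_eq_abs, sq_abs, abs_of_nonneg (by norm_num)]
    norm_num
  rw [h4]
  have := mul_le_mul_of_nonneg_right ha (sq_nonneg t)
  linarith

lemma exp_nine_fourths_pow_le (L : ℕ) : Real.exp (9 / 4 * L) ≤ 21 ^ L := by
  have h1 : Real.exp (9 / 4) ≤ 21 := by
    have h2 : Real.exp (9 / 4) ≤ Real.exp 1 ^ 3 := by
      rw [← Real.exp_nat_mul]; exact Real.exp_le_exp.2 (by norm_num)
    have h3 := pow_le_pow_left₀ (Real.exp_pos 1).le Real.exp_one_lt_d9.le 3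
    refine h2.trans (h3.trans ?_)
    norm_num
  rw [mul_comm, Real.exp_nat_mul]
  exact pow_le_pow_left₀ (Real.exp_pos _).le h1 L

lemma CenteredEntries.integral_abs_form_pow_le {w : Edge r → Ω → ℝ} (h : CenteredEntries μ w)
    (hw : ∀ e ω, w e ω ∈ Set.Icc (-1 : ℝ) 2) {a : Edge r → ℝ} (ha : ∑ e, a e ^ 2 ≤ 2)
    (hL : 0 < L) :
    Integrable (fun ω => |∑ e, a e * w e ω| ^ L) μ ∧
      ∫ ω, |∑ e, a e * w e ω| ^ L ∂μ ≤ 2 * (21 * Real.sqrt L) ^ L := by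
  obtain ⟨i1, h1⟩ := h.subgaussian hw ha (Real.sqrt L)
  obtain ⟨i2, h2⟩ := h.subgaussian hw ha (-Real.sqrt L)
  have hbd := fun ω => pow_le_sqrt_pow_mul_exp (∑ e, a e * w e ω) hL
  have hint := (i1.add i2).const_mul (Real.sqrt L ^ L)
  have hi : Integrable (fun ω => |∑ e, a e * w e ω| ^ L) μ := by
    refine hint.mono' ?_ (ae_of_all _ fun ω => ?_)
    · refine Measurable.aestronglyMeasurable ?_
      have : Measurable fun ω => ∑ e, a e * w e ω :=
        Finset.measurable_sum _ fun e _ => (h.meas e).const_mul _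
      exact (this.norm).pow_const L
    · rw [Real.norm_eq_abs, abs_of_nonneg (by positivity)]
      exact hbd ω
  refine ⟨hi, (integral_mono hi hint hbd).trans ?_⟩
  simp only [Pi.add_apply]
  rw [integral_const_mul, integral_add i1 i2, mul_pow]
  rw [neg_sq] at h2
  rw [Real.sq_sqrt (Nat.cast_nonneg L)] at h1 h2
  have h3 := exp_nine_fourths_pow_le L
  have h4 : 0 ≤ Real.sqrt L ^ L := by positivity
  have h5 := mul_le_mul_of_nonneg_left (add_le_add (h1.trans h3) (h2.trans h3)) h4
  linarith

lemma trace_pow_le (M : Matrix (Fin r) (Fin r) ℝ) (hL : 0 < L) :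
    Matrix.trace (M ^ L) ≤ r * opNorm M ^ L := by
  have h1 : opNorm (M ^ L) ≤ opNorm M ^ L := by
    obtain ⟨l, rfl⟩ : ∃ l, L = l + 1 := ⟨_, (Nat.succ_pred_eq_of_pos hL).symm⟩
    clear hL
    induction l with
    | zero => simp
    | succ l ih =>
      rw [pow_succ, pow_succ _ (l + 1)]
      exact (opNorm_mul_le _ _).trans (mul_le_mul_of_nonneg_right ih (opNorm_nonneg M))
  have h2 : ∀ i, (M ^ L) i i ≤ opNorm (M ^ L) := by
    intro i
    have := (le_abs_self _).trans (abs_quadForm_le (M ^ L) (Pi.single i 1) (Pi.single i 1))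
    simpa [Pi.single_apply, ite_pow] using this
  calc Matrix.trace (M ^ L) = ∑ i, (M ^ L) i i := rfl
    _ ≤ ∑ _i : Fin r, opNorm M ^ L := Finset.sum_le_sum fun i _ => (h2 i).trans h1
    _ = _ := by simp

/-- High moments of the norm of a dense random matrix. -/
lemma CenteredEntries.integral_trace_le_of_mem_Icc {w : Edge r → Ω → ℝ} (h : CenteredEntries μ w)
    (hw : ∀ e ω, w e ω ∈ Set.Icc (-1 : ℝ) 2) (hr : 0 < r) :
    ∫ ω, Matrix.trace (symMatrix (fun e => w e ω) ^ r) ∂μ ≤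
      2 * r * (2100 * Real.sqrt r) ^ r := by
  obtain ⟨S, hcard, hS1, hS⟩ := exists_net r
  have hform : ∀ c ∈ S, ∀ d ∈ S,
      Integrable (fun ω => |d.ofLp ⬝ᵥ (symMatrix (fun e => w e ω) *ᵥ c.ofLp)| ^ r) μ ∧
      ∫ ω, |d.ofLp ⬝ᵥ (symMatrix (fun e => w e ω) *ᵥ c.ofLp)| ^ r ∂μ ≤
        2 * (21 * Real.sqrt r) ^ r := by
    intro c hc d hd
    simp_rw [dotProduct_symMatrix]
    exact h.integral_abs_form_pow_le hw (sum_edge_coeff_sq_le c d (hS1 c hc) (hS1 d hd)) hr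
  have hint : Integrable (fun ω => r * (4 ^ r * ∑ c ∈ S, ∑ d ∈ S,
      |d.ofLp ⬝ᵥ (symMatrix (fun e => w e ω) *ᵥ c.ofLp)| ^ r)) μ :=
    ((integrable_finsetSum _ fun c hc => integrable_finsetSum _ fun d hd =>
      (hform c hc d hd).1).const_mul _).const_mul _
  have h1 := integral_mono (h.integrable_trace r) hint fun ω =>
    (trace_pow_le (symMatrix fun e => w e ω) hr).trans (mul_le_mul_of_nonneg_left
      (opNorm_pow_le_sum_net hS (symMatrix fun e => w e ω) r) (Nat.cast_nonneg r))
  refine h1.trans ?_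
  rw [integral_const_mul, integral_const_mul, integral_finsetSum _ fun c hc =>
    integrable_finsetSum _ fun d hd => (hform c hc d hd).1]
  have h2 : ∑ c ∈ S, ∫ ω, ∑ d ∈ S,
      |d.ofLp ⬝ᵥ (symMatrix (fun e => w e ω) *ᵥ c.ofLp)| ^ r ∂μ ≤
      S.card * (S.card * (2 * (21 * Real.sqrt r) ^ r)) := by
    rw [← nsmul_eq_mul]
    refine Finset.sum_le_card_nsmul _ _ _ fun c hc => ?_
    rw [integral_finsetSum _ fun d hd => (hform c hc d hd).1, ← nsmul_eq_mul]
    exact Finset.sum_le_card_nsmul _ _ _ fun d hd => (hform c hc d hd).2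
  have h3 : (S.card : ℝ) ≤ 5 ^ r := by exact_mod_cast hcard
  have h4 : (S.card : ℝ) * (S.card * (2 * (21 * Real.sqrt r) ^ r)) ≤
      5 ^ r * (5 ^ r * (2 * (21 * Real.sqrt r) ^ r)) := by gcongr
  -- Taking the exponent equal to the dimension absorbs the net sizes: 4 comes from discretizing, 5
  -- from each of the two nets, 21 from the subgaussian moment.
  have e : 2 * (r : ℝ) * (2100 * Real.sqrt r) ^ r =
      r * (4 ^ r * (5 ^ r * (5 ^ r * (2 * (21 * Real.sqrt r) ^ r)))) := by
    have : (2100 : ℝ) = 4 * (5 * (5 * 21)) := by norm_num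
    rw [this]
    simp only [mul_pow]
    ring
  rw [e]
  have := h2.trans h4
  gcongr

/-- The two-point law with mean zero whose higher moments are all at least one. -/
def twoPoint : Measure Bool :=
  ENNReal.ofReal (1 / 3) • Measure.dirac true + ENNReal.ofReal (2 / 3) • Measure.dirac false

instance : IsProbabilityMeasure twoPoint := ⟨by
  rw [twoPoint, Measure.add_apply, Measure.smul_apply, Measure.smul_apply]
  simp only [measure_univ, smul_eq_mul, mul_one]
  rw [← ENNReal.ofReal_add (by norm_num) (by norm_num)]
  norm_num⟩

lemma integral_twoPoint (f : Bool → ℝ) :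
    ∫ b, f b ∂twoPoint = 1 / 3 * f true + 2 / 3 * f false := by
  rw [twoPoint, integral_add_measure
    (Integrable.of_finite.smul_measure ENNReal.ofReal_ne_top)
    (Integrable.of_finite.smul_measure ENNReal.ofReal_ne_top), integral_smul_measure,
    integral_smul_measure, integral_dirac, integral_dirac, ENNReal.toReal_ofReal (by norm_num),
    ENNReal.toReal_ofReal (by norm_num)]
  rfl

/-- The values of the two-point law. -/
def twoPointValue (b : Bool) : ℝ := if b then 2 else -1

lemma integral_twoPointValue_pow (e : Edge r) (s : ℕ) :
    ∫ ω : Edge r → Bool, twoPointValue (ω e) ^ s ∂(Measure.pi fun _ => twoPoint) =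
      1 / 3 * 2 ^ s + 2 / 3 * (-1) ^ s := by
  have hp := measurePreserving_eval (fun _ : Edge r => twoPoint) e
  have h := integral_map (μ := Measure.pi fun _ : Edge r => twoPoint) hp.measurable.aemeasurable
    (f := fun b => twoPointValue b ^ s) (measurable_of_finite _).aestronglyMeasurable
  rw [hp.map_eq, integral_twoPoint] at h
  simpa [twoPointValue] using h.symm

lemma centeredEntries_twoPoint :
    CenteredEntries (Measure.pi fun _ : Edge r => twoPoint)
      (fun e (ω : Edge r → Bool) => twoPointValue (ω e)) where
  indep := iIndepFun_pi (X := fun (_ : Edge r) b => twoPointValue b)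
    fun _ => (measurable_of_finite _).aemeasurable
  meas e := (measurable_of_finite twoPointValue).comp (measurable_pi_apply e)
  bdd := ⟨2, fun e ω => by rw [twoPointValue]; split_ifs <;> norm_num⟩
  mean e := by
    have := integral_twoPointValue_pow e 1
    simp only [pow_one] at this
    rw [this]; norm_num

lemma one_le_integral_twoPointValue_pow (e : Edge r) {s : ℕ} (hs : 2 ≤ s) :
    1 ≤ ∫ ω : Edge r → Bool, twoPointValue (ω e) ^ s ∂(Measure.pi fun _ => twoPoint) := by
  rw [integral_twoPointValue_pow]
  rcases Nat.even_or_odd s with h | h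
  · have : (2 : ℝ) ^ 2 ≤ 2 ^ s := pow_le_pow_right₀ one_le_two hs
    rw [h.neg_one_pow]
    linarith
  · have h3 : 3 ≤ s := by rcases h with ⟨l, rfl⟩; omega
    have : (2 : ℝ) ^ 3 ≤ 2 ^ s := pow_le_pow_right₀ one_le_two h3
    rw [h.neg_one_pow]
    linarith

/-- High moments of a sparse symmetric random matrix. -/
lemma CenteredEntries.integral_trace_le_sparse {n m : ℕ} {w : Edge n → Ω → ℝ}
    (h : CenteredEntries μ w) (hm : 0 < m) {p : ℝ} (hp : 0 ≤ p) (hp1 : p ≤ 1) (hnp : n * p ≤ m)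
    (hw : ∀ e, ∀ s, 2 ≤ s → |∫ ω, w e ω ^ s ∂μ| ≤ p) :
    ∫ ω, Matrix.trace (symMatrix (fun e => w e ω) ^ (2 * m)) ∂μ ≤
      4 * n * (2100 * Real.sqrt (2 * m)) ^ (2 * m) := by
  have h1 := integral_trace_pow_le_comparator hm hp hp1 hnp h hw
    (centeredEntries_twoPoint (r := 2 * m)) fun e s hs => one_le_integral_twoPointValue_pow e hs
  have h2 := (centeredEntries_twoPoint (r := 2 * m)).integral_trace_le_of_mem_Icc
    (fun e ω => by rw [twoPointValue]; split_ifs <;> norm_num) (by omega)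
  have h3 := h1.trans (mul_le_mul_of_nonneg_left h2 (Nat.cast_nonneg n))
  push_cast at h3
  have hm' : (0 : ℝ) < m := by exact_mod_cast hm
  refine le_of_mul_le_mul_left (h3.trans (le_of_eq ?_)) hm'
  ring

end Comparator

/-! ### The noise of the random graph -/

section Noise

variable {n : ℕ} {Ω : Type*} [MeasurableSpace Ω] {μ : Measure Ω} [IsProbabilityMeasure μ]

/-- If the squared centered variables have mean at most `p`, so have linear combinations. -/
lemma CenteredEntries.integral_sum_sq_le {w : Edge n → Ω → ℝ} (h : CenteredEntries μ w) {p : ℝ}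
    (hw : ∀ e, ∫ ω, w e ω ^ 2 ∂μ ≤ p) (a : Edge n → ℝ) :
    Integrable (fun ω => (∑ e, a e * w e ω) ^ 2) μ ∧
      ∫ ω, (∑ e, a e * w e ω) ^ 2 ∂μ ≤ p * ∑ e, a e ^ 2 := by
  obtain ⟨B, hB⟩ := h.bdd
  have hmem : ∀ e, MemLp (fun ω => a e * w e ω) 2 μ := fun e =>
    MemLp.of_bound ((h.meas e).const_mul _).aestronglyMeasurable (|a e| * B)
      (ae_of_all _ fun ω => by
        rw [Real.norm_eq_abs, abs_mul]
        exact mul_le_mul_of_nonneg_left (hB e ω) (abs_nonneg _))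
  have hsum : MemLp (fun ω => ∑ e, a e * w e ω) 2 μ := memLp_finsetSum _ fun e _ => hmem e
  refine ⟨hsum.integrable_sq, ?_⟩
  have h2 : iIndepFun (fun e ω => a e * w e ω) μ :=
    h.indep.comp (fun e x => a e * x) fun e => measurable_const_mul (a e)
  have hmean : ∀ e, ∫ ω, a e * w e ω ∂μ = 0 := fun e => by
    rw [integral_const_mul, h.mean, mul_zero]
  have h0 : ∫ ω, ∑ e, a e * w e ω ∂μ = 0 := by
    rw [integral_finsetSum _ fun e _ => (hmem e).integrable one_le_two]
    exact Finset.sum_eq_zero fun e _ => hmean e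
  have h3 := IndepFun.variance_sum (μ := μ) (s := Finset.univ)
    (X := fun e ω => a e * w e ω) (fun e _ => hmem e) fun e _ f _ hef => h2.indepFun hef
  have e1 : (∑ e, fun ω => a e * w e ω) = fun ω => ∑ e, a e * w e ω := by
    ext ω; simp
  rw [e1, variance_of_integral_eq_zero hsum.aestronglyMeasurable.aemeasurable h0] at h3
  rw [h3, Finset.mul_sum]
  refine Finset.sum_le_sum fun e _ => ?_
  rw [variance_of_integral_eq_zero (hmem e).aestronglyMeasurable.aemeasurable (hmean e)]
  simp only [mul_pow]
  rw [integral_const_mul, mul_comm]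
  exact mul_le_mul_of_nonneg_right (hw e) (sq_nonneg _)

/-- For symmetric M, tr M^{2·2^j} = ‖M^{2^j}‖_F², which dominates the squared operator norm of
M^{2^j}. -/
lemma opNorm_pow_le_trace {M : Matrix (Fin n) (Fin n) ℝ} (hM : M.IsSymm) (j : ℕ) :
    opNorm M ^ (2 * 2 ^ j) ≤ Matrix.trace (M ^ (2 * 2 ^ j)) := by
  have h1 := opNorm_le_frob (M ^ 2 ^ j)
  rw [opNorm_pow_two_pow hM] at h1
  have h2 := pow_le_pow_left₀ (pow_nonneg (opNorm_nonneg M) _) h1 2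
  have h3 : (M ^ 2 ^ j)ᵀ = M ^ 2 ^ j := by rw [Matrix.transpose_pow, hM.eq]
  rw [← pow_mul, ← mInner_self, mInner, h3, ← pow_add, ← two_mul, mul_comm (2 ^ j)] at h2
  exact h2

/-- The norm of a sparse symmetric random matrix with centered entries. -/
lemma CenteredEntries.measure_opNorm_gt_le {w : Edge n → Ω → ℝ} (h : CenteredEntries μ w)
    (hn : 0 < n) {p : ℝ} (hp : 0 ≤ p) (hp1 : p ≤ 1) (hnp : Real.log n ≤ n * p) (hnp1 : 1 ≤ n * p)
    (hw : ∀ e, ∀ s, 2 ≤ s → |∫ ω, w e ω ^ s ∂μ| ≤ p) :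
    μ.real {ω | 42000 * Real.sqrt (n * p) ≤ opNorm (symMatrix fun e => w e ω)} ≤
      4 / (n : ℝ) ^ 3 := by
  -- The power of two m = 2^{j+1} lies between np and 2np: large enough for the comparison of walks,
  -- small enough that √m is of order √(np).
  obtain ⟨j, hj1, hj2⟩ := exists_nat_pow_near hnp1 one_lt_two
  set m : ℕ := 2 ^ (j + 1) with hm
  have hm0 : 0 < m := by positivity
  have hmc : (m : ℝ) = 2 ^ (j + 1) := by rw [hm]; push_cast; rfl
  have hQm : n * p ≤ m := by rw [hmc]; exact hj2.le
  have hmQ : (m : ℝ) ≤ 2 * (n * p) := by rw [hmc, pow_succ]; linarith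
  have h1 := h.integral_trace_le_sparse hm0 hp hp1 hQm hw
  -- The threshold is ten times the bound 2 · 2100 √(np) coming from the trace moment, so Markov's
  -- inequality gains 10^{−2m}.
  set t := 42000 * Real.sqrt (n * p) with ht
  have ht0 : 0 < t := by positivity
  have hsq : 2100 * Real.sqrt (2 * m) ≤ t * (1 / 10) := by
    have : Real.sqrt (2 * m) ≤ 2 * Real.sqrt (n * p) := by
      have e2 : 2 * Real.sqrt (n * p) = Real.sqrt (4 * (n * p)) := by
        rw [Real.sqrt_mul (by norm_num) (n * p), show (4 : ℝ) = 2 ^ 2 by norm_num,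
          Real.sqrt_sq zero_le_two]
      rw [e2]
      exact Real.sqrt_le_sqrt (by linarith)
    rw [ht]; linarith
  have htr : ∀ ω, opNorm (symMatrix fun e => w e ω) ^ (2 * m) ≤
      Matrix.trace (symMatrix (fun e => w e ω) ^ (2 * m)) := fun ω =>
    opNorm_pow_le_trace (symMatrix_isSymm _) (j + 1)
  have h2 := mul_meas_ge_le_integral_of_nonneg
    (ae_of_all μ fun ω => (pow_nonneg (opNorm_nonneg _) _).trans (htr ω))
    (h.integrable_trace (2 * m)) (t ^ (2 * m))
  have h3 : μ.real {ω | t ≤ opNorm (symMatrix fun e => w e ω)} ≤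
      μ.real {ω | t ^ (2 * m) ≤ Matrix.trace (symMatrix (fun e => w e ω) ^ (2 * m))} :=
    measureReal_mono fun ω hω => (pow_le_pow_left₀ ht0.le hω _).trans (htr ω)
  have hn0 : (0 : ℝ) < n := by exact_mod_cast hn
  -- Since m ≥ np ≥ log n and e² ≤ 10, 10^{2m} ≥ n⁴; one power of n is then lost to the trace.
  have h4 : (1 / 10 : ℝ) ^ (2 * m) ≤ 1 / (n : ℝ) ^ 4 := by
    have h5 : (n : ℝ) ^ 4 ≤ 10 ^ (2 * m) := by
      have h6 : (n : ℝ) ^ 4 = Real.exp (4 * Real.log n) := by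
        rw [mul_comm, Real.exp_mul, Real.exp_log hn0]
        norm_cast
      have h7 : Real.exp 2 ≤ 10 := by
        have h8 : Real.exp 2 = Real.exp 1 ^ 2 := by rw [← Real.exp_nat_mul]; norm_num
        have h9 := pow_le_pow_left₀ (Real.exp_pos 1).le Real.exp_one_lt_d9.le 2
        rw [h8]
        refine h9.trans ?_
        norm_num
      have h10 : Real.exp 2 ^ (2 * m) ≤ 10 ^ (2 * m) :=
        pow_le_pow_left₀ (Real.exp_pos 2).le h7 _
      rw [h6]
      refine le_trans (Real.exp_le_exp.2 ?_) (le_of_eq_of_le (Real.exp_nat_mul 2 (2 * m)) h10)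
      push_cast
      linarith
    rw [one_div_pow]
    exact one_div_le_one_div_of_le (by positivity) h5
  have h5 : (2100 * Real.sqrt (2 * m)) ^ (2 * m) ≤ t ^ (2 * m) * (1 / (n : ℝ) ^ 4) := by
    refine (pow_le_pow_left₀ (by positivity) hsq _).trans ?_
    rw [mul_pow]
    exact mul_le_mul_of_nonneg_left h4 (by positivity)
  have h6 : t ^ (2 * m) * μ.real {ω | t ≤ opNorm (symMatrix fun e => w e ω)} ≤
      t ^ (2 * m) * (4 / (n : ℝ) ^ 3) := by
    calc _ ≤ _ := mul_le_mul_of_nonneg_left h3 (by positivity)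
      _ ≤ _ := h2
      _ ≤ _ := h1
      _ ≤ 4 * n * (t ^ (2 * m) * (1 / (n : ℝ) ^ 4)) :=
        mul_le_mul_of_nonneg_left h5 (by positivity)
      _ = _ := by field_simp
  exact le_of_mul_le_mul_left h6 (by positivity)

variable {A : Ω → Matrix (Fin n) (Fin n) ℝ} {T : Matrix (Fin n) (Fin n) ℝ}

/-- The centered edge indicators. -/
def edgeNoise (A : Ω → Matrix (Fin n) (Fin n) ℝ) (T : Matrix (Fin n) (Fin n) ℝ) (e : Edge n)
    (ω : Ω) : ℝ := A ω e.1.1 e.1.2 - Real.sigmoid (T e.1.1 e.1.2)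

omit [IsProbabilityMeasure μ] in
lemma IsModel.integral_entry (h : IsModel μ A T) (e : Edge n) :
    ∫ ω, A ω e.1.1 e.1.2 ∂μ = Real.sigmoid (T e.1.1 e.1.2) := by
  have h1 : (fun ω => A ω e.1.1 e.1.2) = Set.indicator {ω | A ω e.1.1 e.1.2 = 1} 1 := by
    ext ω
    by_cases hA : A ω e.1.1 e.1.2 = 1
    · simp [hA]
    · rcases (h.adj ω).2.2 e.1.1 e.1.2 with h0 | h0
      · simp [h0]
      · exact absurd h0 hA
  have hms : MeasurableSet {ω | A ω e.1.1 e.1.2 = 1} :=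
    h.meas e.1.1 e.1.2 (measurableSet_singleton 1)
  rw [h1]
  refine (integral_indicator_one hms).trans ?_
  rw [measureReal_def, h.prob _ _ e.2, ENNReal.toReal_ofReal (Real.sigmoid_pos _).le]

omit [IsProbabilityMeasure μ] in
lemma IsModel.abs_edgeNoise_le (h : IsModel μ A T) (e : Edge n) (ω : Ω) :
    |edgeNoise A T e ω| ≤ 1 := by
  have h1 := Real.sigmoid_pos (T e.1.1 e.1.2)
  have h2 := Real.sigmoid_le_one (T e.1.1 e.1.2)
  rw [edgeNoise, abs_le]
  rcases (h.adj ω).2.2 e.1.1 e.1.2 with h0 | h0 <;> rw [h0] <;> constructor <;> linarith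

lemma IsModel.integrable_entry (h : IsModel μ A T) (i j : Fin n) :
    Integrable (fun ω => A ω i j) μ :=
  Integrable.of_bound (h.meas i j).aestronglyMeasurable 1 (ae_of_all _ fun ω => by
    rcases (h.adj ω).2.2 i j with h0 | h0 <;> simp [h0])

lemma IsModel.centeredEntries (h : IsModel μ A T) : CenteredEntries μ (edgeNoise A T) where
  indep := h.indep.comp (fun e x => x - Real.sigmoid (T e.1.1 e.1.2))
    fun e => measurable_id.sub_const _
  meas e := (h.meas _ _).sub_const _
  bdd := ⟨1, h.abs_edgeNoise_le⟩
  mean e := by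
    simp only [edgeNoise]
    rw [integral_sub (h.integrable_entry _ _) (integrable_const _), h.integral_entry]
    simp

lemma IsModel.integral_edgeNoise_sq_le (h : IsModel μ A T) (e : Edge n) :
    ∫ ω, edgeNoise A T e ω ^ 2 ∂μ ≤ Real.sigmoid (T e.1.1 e.1.2) := by
  set σ := Real.sigmoid (T e.1.1 e.1.2) with hσ
  have h1 : ∀ ω, edgeNoise A T e ω ^ 2 = (1 - 2 * σ) * A ω e.1.1 e.1.2 + σ ^ 2 := by
    intro ω
    rw [edgeNoise, ← hσ]
    rcases (h.adj ω).2.2 e.1.1 e.1.2 with h0 | h0 <;> rw [h0] <;> ring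
  simp_rw [h1]
  rw [integral_add ((h.integrable_entry _ _).const_mul _) (integrable_const _),
    integral_const_mul, h.integral_entry]
  simp only [integral_const, probReal_univ, one_smul]
  rw [← hσ]
  have := sq_nonneg σ
  linarith

lemma IsModel.abs_integral_edgeNoise_pow_le (h : IsModel μ A T) (e : Edge n) {s : ℕ}
    (hs : 2 ≤ s) : |∫ ω, edgeNoise A T e ω ^ s ∂μ| ≤ Real.sigmoid (T e.1.1 e.1.2) := by
  have hm := h.centeredEntries.meas e
  have hint : ∀ s : ℕ, Integrable (fun ω => edgeNoise A T e ω ^ s) μ := fun s =>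
    Integrable.of_bound (hm.pow_const s).aestronglyMeasurable 1 (ae_of_all _ fun ω => by
      rw [Real.norm_eq_abs, abs_pow]
      exact pow_le_one₀ (abs_nonneg _) (h.abs_edgeNoise_le e ω))
  refine (abs_integral_le_integral_abs).trans (le_trans ?_ (h.integral_edgeNoise_sq_le e))
  refine integral_mono (hint s).abs (hint 2) fun ω => ?_
  simp only [abs_pow]
  rw [← sq_abs (edgeNoise A T e ω)]
  exact pow_le_pow_of_le_one (abs_nonneg _) (h.abs_edgeNoise_le e ω) hs

omit [IsProbabilityMeasure μ] in
-- The graph has no loops but the fitted probabilities have a diagonal; it is split off, and its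
-- operator norm is at most 1.
lemma IsModel.sub_eq (h : IsModel μ A T) (hT : T.IsSymm) (ω : Ω) :
    A ω - sigmoidM T = symMatrix (fun e => edgeNoise A T e ω) -
      Matrix.diagonal fun i => Real.sigmoid (T i i) := by
  have hS : (A ω - sigmoidM T + Matrix.diagonal fun i => Real.sigmoid (T i i)).IsSymm :=
    ((h.adj ω).1.sub (sigmoidM_isSymm hT)).add (Matrix.isSymm_diagonal _)
  have h0 := eq_symMatrix hS fun i => by simp [(h.adj ω).2.1 i, sigmoidM]
  rw [eq_sub_iff_add_eq, h0]
  congr 1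
  ext e
  simp [edgeNoise, sigmoidM, Matrix.diagonal_apply_ne _ e.2.ne]

lemma opNorm_diagonal_le {d : Fin n → ℝ} (h : ∀ i, |d i| ≤ 1) : opNorm (Matrix.diagonal d) ≤ 1 := by
  refine opNorm_le_of_forall zero_le_one fun x => ?_
  rw [one_pow, one_mul]
  refine Finset.sum_le_sum fun i _ => ?_
  rw [Matrix.mulVec_diagonal, mul_pow]
  exact mul_le_of_le_one_left (sq_nonneg _) ((sq_le_one_iff_abs_le_one _).2 (h i))

omit [IsProbabilityMeasure μ] in
lemma IsModel.mInner_eq_sum (h : IsModel μ A T) (hT : T.IsSymm) {X : Matrix (Fin n) (Fin n) ℝ}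
    (hX : IsCovariate X) (ω : Ω) :
    mInner (A ω - sigmoidM T) X = ∑ e, (2 * X e.1.1 e.1.2) * edgeNoise A T e ω := by
  have h1 := sum_edge_eq fun i j => (A ω - sigmoidM T) i j * X i j
  have hS : (A ω - sigmoidM T).IsSymm := (h.adj ω).1.sub (sigmoidM_isSymm hT)
  have h2 : ∀ e : Edge n, (A ω - sigmoidM T) e.1.1 e.1.2 * X e.1.1 e.1.2 +
      (A ω - sigmoidM T) e.1.2 e.1.1 * X e.1.2 e.1.1 =
      (2 * X e.1.1 e.1.2) * edgeNoise A T e ω := by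
    intro e
    rw [hS.apply e.1.1 e.1.2, hX.1.apply e.1.1 e.1.2, edgeNoise, Matrix.sub_apply, sigmoidM,
      Matrix.map_apply]
    ring
  rw [Finset.sum_congr rfl fun e _ => h2 e] at h1
  rw [h1, mInner_eq]
  refine Finset.sum_congr rfl fun i _ => Finset.sum_congr rfl fun j _ => ?_
  split_ifs with hij
  · rw [hij, hX.2 j, mul_zero]
  · rfl

lemma IsCovariate.sum_edge_sq {X : Matrix (Fin n) (Fin n) ℝ} (hX : IsCovariate X) :
    ∑ e : Edge n, (2 * X e.1.1 e.1.2) ^ 2 = 2 * frob X ^ 2 := by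
  have h1 := sum_edge_eq fun i j => X i j ^ 2
  have h2 : ∀ e : Edge n, (2 * X e.1.1 e.1.2) ^ 2 =
      2 * (X e.1.1 e.1.2 ^ 2 + X e.1.2 e.1.1 ^ 2) := by
    intro e
    rw [hX.1.apply e.1.1 e.1.2]; ring
  rw [Finset.sum_congr rfl fun e _ => h2 e, ← Finset.mul_sum, h1, frob_sq]
  congr 1
  refine Finset.sum_congr rfl fun i _ => Finset.sum_congr rfl fun j _ => ?_
  split_ifs with hij
  · rw [hij, hX.2 j]; norm_num
  · rfl

/-- Chebyshev's inequality: each edge is counted twice in the inner product, so the second moment is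
at most 2p‖X‖_F². -/
lemma IsModel.measure_mInner_gt_le (h : IsModel μ A T) (hT : T.IsSymm)
    {X : Matrix (Fin n) (Fin n) ℝ} (hX : IsCovariate X) (hX0 : X ≠ 0) {p Q : ℝ}
    (hp : ∀ i j, i ≠ j → Real.sigmoid (T i j) ≤ p) (hQ : 0 < Q) :
    μ.real {ω | 2 * Real.sqrt Q * frob X ≤ |mInner (A ω - sigmoidM T) X|} ≤ p / (2 * Q) := by
  have hf := frob_pos hX0
  obtain ⟨hi, hle⟩ := h.centeredEntries.integral_sum_sq_le
    (fun e => (h.integral_edgeNoise_sq_le e).trans (hp _ _ e.2.ne)) fun e => 2 * X e.1.1 e.1.2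
  rw [hX.sum_edge_sq] at hle
  simp_rw [← h.mInner_eq_sum hT hX] at hi hle
  have hnn : 0 ≤ᵐ[μ] fun ω => mInner (A ω - sigmoidM T) X ^ 2 :=
    ae_of_all μ fun ω => sq_nonneg (mInner (A ω - sigmoidM T) X)
  have h1 := mul_meas_ge_le_integral_of_nonneg hnn hi (4 * Q * frob X ^ 2)
  have h2 : μ.real {ω | 2 * Real.sqrt Q * frob X ≤ |mInner (A ω - sigmoidM T) X|} ≤
      μ.real {ω | 4 * Q * frob X ^ 2 ≤ mInner (A ω - sigmoidM T) X ^ 2} := by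
    refine measureReal_mono fun ω hω => ?_
    have hω' : 2 * Real.sqrt Q * frob X ≤ |mInner (A ω - sigmoidM T) X| := hω
    have h3 := pow_le_pow_left₀ (by positivity) hω' 2
    rw [sq_abs, mul_pow, mul_pow, Real.sq_sqrt hQ.le] at h3
    change 4 * Q * frob X ^ 2 ≤ _
    linarith
  rw [le_div_iff₀ (by positivity)]
  have h3 := mul_le_mul_of_nonneg_left h2 (by positivity : 0 ≤ 4 * Q * frob X ^ 2)
  have h4 := h3.trans (h1.trans hle)
  have h5 : (2 * frob X ^ 2) * (μ.real {ω | 2 * Real.sqrt Q * frob X ≤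
      |mInner (A ω - sigmoidM T) X|} * (2 * Q)) ≤ (2 * frob X ^ 2) * p := by linarith
  exact le_of_mul_le_mul_left h5 (by positivity)

/-- With high probability the noise is of the order of the square root of the expected degree. -/
theorem IsModel.measure_noiseLevel_ge (h : IsModel μ A T) (hn : 3 ≤ n) {k : ℕ} (hk : 1 ≤ k)
    (hT : T.IsSymm) {X : Matrix (Fin n) (Fin n) ℝ} (hX : IsCovariate X) {p : ℝ}
    (hp : ∀ i j, i ≠ j → Real.sigmoid (T i j) ≤ p) (hp1 : p ≤ 1) (hlog : Real.log n ≤ n * p) :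
    ENNReal.ofReal (1 - (n : ℝ)⁻¹) ≤
      μ {ω | NoiseLevel k (A ω - sigmoidM T) X (84002 * Real.sqrt (n * p))} := by
  have hn3 : (3 : ℝ) ≤ n := by exact_mod_cast hn
  have hnp1 : 1 ≤ n * p := by
    refine le_trans ?_ hlog
    rw [Real.le_log_iff_exp_le (by linarith)]
    linarith [Real.exp_one_lt_d9]
  have hp0 : 0 < p := by
    by_contra! hc
    have := mul_nonpos_of_nonneg_of_nonpos (by linarith : (0 : ℝ) ≤ n) hc
    linarith
  set Q := n * p with hQ
  have hQ0 : 0 < Q := by linarith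
  set E₁ := {ω | 42000 * Real.sqrt Q ≤ opNorm (symMatrix fun e => edgeNoise A T e ω)}
  set E₂ := {ω | X ≠ 0 ∧ 2 * Real.sqrt Q * frob X ≤ |mInner (A ω - sigmoidM T) X|}
  have h1 : μ.real E₁ ≤ 4 / (n : ℝ) ^ 3 :=
    h.centeredEntries.measure_opNorm_gt_le (by omega) hp0.le hp1 hlog hnp1
      fun e s hs => (h.abs_integral_edgeNoise_pow_le e hs).trans (hp _ _ e.2.ne)
  have h2 : μ.real E₂ ≤ 1 / (2 * n) := by
    by_cases hX0 : X = 0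
    · have : E₂ = ∅ := by
        ext ω; simp [E₂, hX0]
      rw [this, measureReal_empty]
      positivity
    · have h3 := h.measure_mInner_gt_le hT hX hX0 hp hQ0
      have e1 : p / (2 * Q) = 1 / (2 * n) := by rw [hQ]; field_simp
      rw [e1] at h3
      exact (measureReal_mono fun ω hω => hω.2).trans h3
  set G := {ω | NoiseLevel k (A ω - sigmoidM T) X (84002 * Real.sqrt Q)}
  have hsQ : 1 ≤ Real.sqrt Q := Real.one_le_sqrt.2 hnp1
  have hG : Set.univ ⊆ G ∪ (E₁ ∪ E₂) := by
    intro ω _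
    by_cases h3 : ω ∈ E₁ ∪ E₂
    · exact Or.inr h3
    · left
      rw [Set.mem_union, not_or] at h3
      have h4 : opNorm (symMatrix fun e => edgeNoise A T e ω) < 42000 * Real.sqrt Q :=
        not_le.1 h3.1
      -- The +1 is the diagonal. As np ≥ 1, doubling this bound stays below 84002 √(np).
      have h5 : opNorm (A ω - sigmoidM T) ≤ 42000 * Real.sqrt Q + 1 := by
        rw [h.sub_eq hT]
        refine (opNorm_sub_le _ _).trans (add_le_add h4.le (opNorm_diagonal_le fun i => ?_))
        rw [abs_of_pos (Real.sigmoid_pos _)]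
        exact Real.sigmoid_le_one _
      refine ⟨by linarith, ?_⟩
      by_cases hX0 : X = 0
      · rw [hX0]; simp [mInner, frob]
      · have h6 : |mInner (A ω - sigmoidM T) X| < 2 * Real.sqrt Q * frob X :=
          not_le.1 fun hc => h3.2 ⟨hX0, hc⟩
        refine h6.le.trans (mul_le_mul_of_nonneg_right ?_ (frob_nonneg X))
        have hk1 : 1 ≤ Real.sqrt k := Real.one_le_sqrt.2 (by exact_mod_cast hk)
        have := mul_le_mul_of_nonneg_right hk1 (by positivity : 0 ≤ 84002 * Real.sqrt Q)
        linarith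
  have h3 : μ (E₁ ∪ E₂) ≤ ENNReal.ofReal ((n : ℝ)⁻¹) := by
    have h4 : μ.real (E₁ ∪ E₂) ≤ (n : ℝ)⁻¹ := by
      -- The two failure probabilities satisfy 4/n³ + 1/(2n) ≤ 1/n for n ≥ 3.
      refine (measureReal_union_le E₁ E₂).trans ((add_le_add h1 h2).trans ?_)
      rw [div_add_div _ _ (by positivity) (by positivity), inv_eq_one_div,
        div_le_div_iff₀ (by positivity) (by positivity)]
      have h5 : (n : ℝ) * (3 * 3) ≤ n * (n * n) := by gcongr
      have h6 := mul_le_mul_of_nonneg_left h5 (by linarith : (0 : ℝ) ≤ n)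
      have h7 := sq_nonneg (n : ℝ)
      linarith
    rw [← ofReal_measureReal]
    exact ENNReal.ofReal_le_ofReal h4
  have h4 : (1 : ENNReal) ≤ μ G + ENNReal.ofReal ((n : ℝ)⁻¹) := by
    calc (1 : ENNReal) = μ Set.univ := measure_univ.symm
      _ ≤ μ (G ∪ (E₁ ∪ E₂)) := measure_mono hG
      _ ≤ μ G + μ (E₁ ∪ E₂) := measure_union_le _ _
      _ ≤ _ := add_le_add_right h3 _
  rw [ENNReal.ofReal_sub _ (by positivity), ENNReal.ofReal_one, tsub_le_iff_right]
  exact h4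

end Noise

/-! ### Consequences of the constraints on the true parameter -/

section Truth

variable {n k : ℕ} {M₁ M₂ η : ℝ} {X : Matrix (Fin n) (Fin n) ℝ} {q : Params n k}

lemma radius_le (hM : 0 ≤ M₁) (X : Matrix (Fin n) (Fin n) ℝ) : radius M₁ X ≤ M₁ / 3 := by
  unfold radius; split_ifs <;> linarith

lemma mul_sigmaMin_sq_le (hM : 0 ≤ M₁) (hZ : q.Z ∈ CZ k M₁ X) :
    k * sigmaMin q.Z ^ 2 ≤ n * (M₁ / 3) := by
  have h1 := pow_le_pow_left₀ (mul_nonneg (Real.sqrt_nonneg k) (sigmaMin_nonneg q.Z))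
    (sqrt_mul_sigmaMin_le q.Z) 2
  rw [mul_pow, Real.sq_sqrt (Nat.cast_nonneg k), frob_sq] at h1
  refine h1.trans ?_
  have h2 : ∑ i : Fin n, ∑ j, q.Z i j ^ 2 ≤ ∑ _i : Fin n, M₁ / 3 :=
    Finset.sum_le_sum fun i _ => (hZ.2 i).trans (radius_le hM X)
  simpa using h2

/-- Latent positions are centered, so the average logit is not too negative. -/
lemma Params.InSpace.sparsity_le (hq : q.InSpace M₁ M₂ X) (hM : 0 ≤ M₁) (hn : 3 ≤ n) :
    M₂ ≤ 7 / 8 * M₁ := by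
  obtain ⟨hZ, hα, hβ, hθ⟩ := hq
  have hn3 : (3 : ℝ) ≤ n := by exact_mod_cast hn
  set b := radius M₁ X with hb
  have hb0 : 0 ≤ b := radius_nonneg hM X
  -- By centering, the entries of ZZᵀ sum to zero, while its diagonal entries are at most b. So the
  -- off-diagonal average is at least −b/(n − 1) ≥ −b/2 for n ≥ 3.
  have hgram : ∑ i, ∑ j, (q.Z * q.Zᵀ) i j = 0 := by
    refine Finset.sum_eq_zero fun i _ => ?_
    simp only [Matrix.mul_apply, Matrix.transpose_apply]
    rw [Finset.sum_comm]
    refine Finset.sum_eq_zero fun l _ => ?_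
    rw [← Finset.mul_sum, colSum_eq_zero hZ.1, mul_zero]
  -- The constant 7/8 covers both radii: with a covariate 3M₁/4 + b/2 = 7M₁/8 exactly, and without
  -- one 2M₁/3 + b/2 = 5M₁/6.
  have hlow : ∀ i j, 7 / 8 * M₁ - b / 2 ≥ -(q.α i + q.α j + q.β * X i j) := by
    intro i j
    have h1 := (abs_le.1 (hα i)).1
    have h2 := (abs_le.1 (hα j)).1
    by_cases hX : X = 0
    · rw [radius, if_pos hX] at hb
      rw [hX, Matrix.zero_apply]
      linarith
    · rw [radius, if_neg hX] at hb
      have h3 := hβ i j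
      rw [← abs_mul] at h3
      have h4 := (abs_le.1 h3).1
      linarith
  have hentry : ∀ i j, (if i = j then (0 : ℝ) else (q.Z * q.Zᵀ) i j) ≤
      if i = j then 0 else 7 / 8 * M₁ - b / 2 - M₂ := by
    intro i j
    split_ifs with hij
    · rfl
    · have h1 := hθ i j hij
      have h2 : q.theta X i j = q.α i + q.α j + q.β * X i j + (q.Z * q.Zᵀ) i j := by
        simp [Params.theta, colOnes, Matrix.vecMulVec_apply]
      have := hlow i j
      linarith
  have hsum := Finset.sum_le_sum fun i (_ : i ∈ Finset.univ) =>
    Finset.sum_le_sum fun j (_ : j ∈ Finset.univ) => hentry i j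
  have hsplit : ∀ F : Fin n → Fin n → ℝ, ∑ i, ∑ j, (if i = j then 0 else F i j) =
      ∑ i, ∑ j, F i j - ∑ i, F i i := by
    intro F
    rw [← Finset.sum_sub_distrib]
    refine Finset.sum_congr rfl fun i _ => ?_
    have h1 : ∀ j, (if i = j then 0 else F i j) = F i j - if i = j then F i j else 0 := by
      intro j; split_ifs <;> ring
    simp_rw [h1]
    rw [Finset.sum_sub_distrib, Finset.sum_ite_eq]
    simp
  rw [hsplit fun i j => (q.Z * q.Zᵀ) i j, hsplit fun _ _ => 7 / 8 * M₁ - b / 2 - M₂, hgram] at hsum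
  have hdiag : ∑ i, (q.Z * q.Zᵀ) i i ≤ ∑ _i : Fin n, b :=
    Finset.sum_le_sum fun i _ => (le_abs_self _).trans (gram_apply_le hZ.2 i i)
  simp only [Finset.sum_const, Finset.card_univ, Fintype.card_fin, nsmul_eq_mul] at hsum hdiag
  set c := 7 / 8 * M₁ - b / 2 - M₂ with hc
  have h1 : (n : ℝ) * (-b) ≤ n * ((n - 1) * c) := by linarith
  have h2 : -b ≤ (n - 1) * c := le_of_mul_le_mul_left h1 (by linarith)
  have h3 : -(b / 2) ≤ c := by
    by_contra! hcon
    have h4 : (n - 1) * c < (n - 1) * -(b / 2) := mul_lt_mul_of_pos_left hcon (by linarith)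
    have h5 : 2 * (b / 2) ≤ (n - 1) * (b / 2) :=
      mul_le_mul_of_nonneg_right (by linarith) (by linarith)
    linarith
  linarith

/-- The signal condition of the probabilistic guarantee bounds the sparsity of the graph. -/
lemma Setting.log_le {M₀ cη : ℝ} (h : Setting M₀ cη n k M₁ M₂ η X q)
    (hsig : 6 * kappa q.Z ^ 2 * Real.sqrt n * Real.exp (M₁ - M₂ / 2) ≤ opNorm q.Z ^ 2) :
    3 ≤ n ∧ Real.log n ≤ 8 * (n * Real.exp (-M₂)) := by
  have ha : 0 < opNorm q.Z := h.fullRank.trans_le (sigmaMin_le_opNorm h.k_pos q.Z)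
  have hM : 0 ≤ M₁ := h.M₂_nonneg.trans h.M₂_le
  have hn0 := h.n_pos
  have hnR : (0 : ℝ) < n := by exact_mod_cast hn0
  have hk : (1 : ℝ) ≤ k := by exact_mod_cast h.k_pos
  have h1 : 6 * Real.sqrt n * Real.exp (M₁ - M₂ / 2) ≤ sigmaMin q.Z ^ 2 :=
    kappa_sq_mul h.fullRank _ (by linarith) ha
  have h2 := mul_sigmaMin_sq_le hM h.truth.1
  have h3 : sigmaMin q.Z ^ 2 ≤ n * (M₁ / 3) :=
    (le_mul_of_one_le_left (sq_nonneg _) hk).trans h2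
  have hs : 0 < Real.sqrt n := Real.sqrt_pos.2 hnR
  have h4 : 18 * Real.exp (M₁ - M₂ / 2) ≤ Real.sqrt n * M₁ := by
    have h5 : Real.sqrt n * (18 * Real.exp (M₁ - M₂ / 2)) ≤ Real.sqrt n * (Real.sqrt n * M₁) := by
      rw [← mul_assoc (Real.sqrt n) (Real.sqrt n), Real.mul_self_sqrt hnR.le]
      linarith
    exact le_of_mul_le_mul_left h5 hs
  -- For n ≤ 2 the previous bound would give 18e^x ≤ 2M₁ with x = M₁ − M₂/2 ≥ M₁/2, against e^x ≥ 1
  -- + x.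
  have hn3 : 3 ≤ n := by
    by_contra! hcon
    have h5 : Real.sqrt n ≤ 2 := by
      rw [Real.sqrt_le_left (by norm_num)]
      have : (n : ℝ) ≤ 2 := by exact_mod_cast Nat.lt_succ_iff.1 hcon
      linarith
    have h6 := mul_le_mul_of_nonneg_right h5 hM
    have h7 := Real.add_one_le_exp (M₁ - M₂ / 2)
    have := h.M₂_le
    linarith
  refine ⟨hn3, ?_⟩
  have h5 := h.truth.sparsity_le hM hn3
  -- By M₂ ≤ 7M₁/8 the exponent M₁ − M₂/2 is at least M₁/2 + M₁/16; the spare e^{M₁/16} cancels the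
  -- factor M₁ on the right, leaving e^{M₁} ≤ n.
  have h6 : Real.exp (M₁ / 2) * (18 * (M₁ / 16)) ≤ Real.sqrt n * M₁ := by
    have h7 : Real.exp (M₁ / 2) * (M₁ / 16) ≤ Real.exp (M₁ - M₂ / 2) := by
      have h8 : Real.exp (M₁ / 2) * Real.exp (M₁ / 16) ≤ Real.exp (M₁ - M₂ / 2) := by
        rw [← Real.exp_add]
        exact Real.exp_le_exp.2 (by linarith)
      have h9 := Real.add_one_le_exp (M₁ / 16)
      refine le_trans (mul_le_mul_of_nonneg_left ?_ (Real.exp_pos _).le) h8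
      linarith
    linarith
  have hM0 : 0 < M₁ := by
    have := Real.exp_pos (M₁ - M₂ / 2)
    have h7 : 0 < Real.sqrt n * M₁ := by linarith
    exact pos_of_mul_pos_right h7 hs.le
  have h7 : Real.exp (M₁ / 2) ≤ Real.sqrt n := by
    have h8 : M₁ * (Real.exp (M₁ / 2) * (18 / 16)) ≤ M₁ * Real.sqrt n := by linarith
    have h9 := le_of_mul_le_mul_left h8 hM0
    have := Real.exp_pos (M₁ / 2)
    linarith
  have h8 : M₁ ≤ Real.log n := by
    rw [Real.le_log_iff_exp_le hnR]
    have h9 := pow_le_pow_left₀ (Real.exp_pos _).le h7 2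
    have e1 : ((2 : ℕ) : ℝ) * (M₁ / 2) = M₁ := by push_cast; ring
    rwa [Real.sq_sqrt hnR.le, ← Real.exp_nat_mul, e1] at h9
  have h9 : (n : ℝ) * Real.exp (-M₂) = Real.exp (Real.log n - M₂) := by
    rw [sub_eq_add_neg, Real.exp_add, Real.exp_log hnR]
  rw [h9]
  have h10 := Real.add_one_le_exp (Real.log n - M₂)
  have h11 : Real.log n / 8 ≤ Real.log n - M₂ := by linarith
  linarith

/-- After `iterT0` steps the initial error has become smaller than the statistical error. -/
lemma Setting.rate_pow_mul_le (h : Setting 64 (1 / 1000) n k M₁ M₂ η X q) {p₀ : Params n k}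
    (hinit : GoodInit (1 / 100000) M₁ X q p₀) {T : ℕ}
    (hT : iterT0 n k M₁ M₂ (kappa q.Z) η (1 / 256) < T) :
    rate M₁ (kappa q.Z) η (1 / 256) ^ T * errMetric X q p₀ ≤
      kappa q.Z ^ 2 * psiSq n k M₁ M₂ := by
  have hs := h.fullRank
  have ha : 0 < opNorm q.Z := hs.trans_le (sigmaMin_le_opNorm h.k_pos q.Z)
  have hM : 0 ≤ M₁ := h.M₂_nonneg.trans h.M₂_le
  have hnR : (0 : ℝ) < n := by exact_mod_cast h.n_pos
  have hk : (1 : ℝ) ≤ k := by exact_mod_cast h.k_pos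
  have hk0 : (0 : ℝ) < k := by linarith
  have h2 := mul_sigmaMin_sq_le hM h.truth.1
  have hM0 : 0 < M₁ := by
    have h3 : 0 < (n : ℝ) * (M₁ / 3) := lt_of_lt_of_le (by positivity) h2
    have := pos_of_mul_pos_right h3 hnR.le
    linarith
  have hκ : 0 < kappa q.Z := div_pos ha hs
  have hκ1 : 1 ≤ kappa q.Z := (one_le_div hs).2 (sigmaMin_le_opNorm h.k_pos q.Z)
  set κ := kappa q.Z with hκdef
  set r := rate M₁ κ η (1 / 256) with hr
  have hE := Real.one_le_exp hM
  have hx : 0 < η / (Real.exp M₁ * κ ^ 2) * (1 / 256) := by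
    have := h.η_pos
    positivity
  have hx1 : η / (Real.exp M₁ * κ ^ 2) ≤ 1 := by
    have h4 : 1 ≤ Real.exp M₁ * κ ^ 2 := one_le_mul_of_one_le_of_one_le hE (one_le_pow₀ hκ1)
    rw [div_le_one (by positivity)]
    have := h.η_le
    linarith
  have hr0 : 0 < r := by rw [hr, rate]; linarith
  have hr1 : r < 1 := by rw [hr, rate]; linarith
  have he0 := errMetric_nonneg X q p₀
  set Q := M₁ ^ 2 / (κ ^ 2 * Real.exp (4 * M₁ - M₂)) * (n / (k : ℝ) ^ 2) with hQ
  have hQ0 : 0 < Q := by positivity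
  have hrQ : r ^ T * Q ≤ 1 := by
    -- Because the denominator of T₀ is positive, T > T₀ says log Q < log(r^{−T}), whatever the sign
    -- of log Q.
    have h4 : 0 < Real.log (1 / r) := Real.log_pos ((one_lt_div hr0).2 hr1)
    rw [iterT0, div_lt_iff₀ h4, ← Real.log_pow, one_div, inv_pow] at hT
    have h5 := (Real.log_lt_log_iff hQ0 (by positivity)).1 hT
    have h6 := mul_le_mul_of_nonneg_left h5.le (pow_nonneg hr0.le T)
    rwa [mul_inv_cancel₀ (by positivity)] at h6
  have h4 : Real.exp M₁ ^ 2 * errMetric X q p₀ ≤ sigmaMin q.Z ^ 4 := by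
    have h5 := hinit.bound hs ha
    have h6 : 0 ≤ Real.exp M₁ ^ 2 * errMetric X q p₀ := by positivity
    linarith
  have h5 : (k : ℝ) ^ 2 * sigmaMin q.Z ^ 4 ≤ (n * (M₁ / 3)) ^ 2 := by
    have h6 := pow_le_pow_left₀ (by positivity) h2 2
    have e : ((k : ℝ) * sigmaMin q.Z ^ 2) ^ 2 = k ^ 2 * sigmaMin q.Z ^ 4 := by ring
    rwa [e] at h6
  have h6 : (k : ℝ) ^ 2 * (Real.exp M₁ ^ 2 * errMetric X q p₀) ≤ (n * M₁) ^ 2 := by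
    have h7 := mul_le_mul_of_nonneg_left h4 (by positivity : (0 : ℝ) ≤ k ^ 2)
    have h8 := sq_nonneg ((n : ℝ) * M₁)
    linarith
  -- The quantity Q inside the logarithm of T₀ is chosen so that the right side equals
  -- (nM₁)²/(k²e^{2M₁}), which bounds the initial error through kσ_min² ≤ nM₁/3.
  have h7 : errMetric X q p₀ ≤ Q * (κ ^ 2 * (Real.exp (2 * M₁ - M₂) * n)) := by
    have e1 : Real.exp (4 * M₁ - M₂) = Real.exp M₁ ^ 2 * Real.exp (2 * M₁ - M₂) := by
      rw [← Real.exp_nat_mul, ← Real.exp_add]; congr 1; push_cast; ring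
    have e2 : Q * (κ ^ 2 * (Real.exp (2 * M₁ - M₂) * n)) =
        (n * M₁) ^ 2 / ((k : ℝ) ^ 2 * Real.exp M₁ ^ 2) := by
      rw [hQ, e1]; field_simp
    rw [e2, le_div_iff₀ (by positivity)]
    linarith
  have h8 : r ^ T * errMetric X q p₀ ≤ κ ^ 2 * (Real.exp (2 * M₁ - M₂) * n) := by
    have h9 := mul_le_mul_of_nonneg_left h7 (pow_nonneg hr0.le T)
    have h10 := mul_le_mul_of_nonneg_right hrQ
      (by positivity : 0 ≤ κ ^ 2 * (Real.exp (2 * M₁ - M₂) * n))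
    linarith
  refine h8.trans (mul_le_mul_of_nonneg_left ?_ (sq_nonneg κ))
  rw [psiSq, sub_eq_add_neg, Real.exp_add]
  calc Real.exp (2 * M₁) * Real.exp (-M₂) * n = Real.exp (2 * M₁) * n * 1 * Real.exp (-M₂) := by
        ring
    _ ≤ _ := by gcongr; exact le_max_left _ _

lemma errG_le_compErr (X : Matrix (Fin n) (Fin n) ℝ) (q p : Params n k) :
    errG q p ≤ compErr X q p := by
  have h1 : 0 ≤ ∑ i, (p.α i - q.α i) ^ 2 := Finset.sum_nonneg fun _ _ => sq_nonneg _
  have h2 : 0 ≤ 2 * (n * ∑ i, (p.α i - q.α i) ^ 2) + (p.β - q.β) ^ 2 * frob X ^ 2 := by positivity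
  rw [compErr]; linarith

/-- The guarantees of the theorem on the event that the noise is small. -/
theorem Setting.iterates_of_sparse (h : Setting 64 (1 / 1000) n k M₁ M₂ η X q)
    (hsig : 3000000000 * kappa q.Z ^ 2 * Real.sqrt n * Real.exp (M₁ - M₂ / 2)
      * max (Real.sqrt (η * k * Real.exp M₁)) 1 ≤ opNorm q.Z ^ 2)
    (hlog : Real.log n ≤ 8 * (n * Real.exp (-M₂))) {A : Matrix (Fin n) (Fin n) ℝ} (hA : A.IsSymm)
    (hζ : NoiseLevel k (A - sigmoidM (q.theta X)) X
      (84002 * Real.sqrt (n * max (Real.exp (-M₂)) (Real.log n / n))))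
    {p : ℕ → Params n k} (hp : IsPGD A X M₁ η p) (hinit : GoodInit (1 / 100000) M₁ X q (p 0)) :
    (∀ t : ℕ, errMetric X q (p t) ≤ 2 * rate M₁ (kappa q.Z) η (1 / 256) ^ t * errMetric X q (p 0)
      + 10 ^ 16 * kappa q.Z ^ 2 / (1 / 256) * psiSq n k M₁ M₂) ∧
    ∀ T : ℕ, iterT0 n k M₁ M₂ (kappa q.Z) η (1 / 256) < T →
      errG q (p T) ≤ 10 ^ 18 * kappa q.Z ^ 2 * psiSq n k M₁ M₂ ∧
      errTheta X q (p T) ≤ 10 ^ 18 * kappa q.Z ^ 2 * psiSq n k M₁ M₂ := by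
  have hnR : (0 : ℝ) < n := by exact_mod_cast h.n_pos
  set m := max (Real.exp (-M₂)) (Real.log n / n) with hm
  have hm0 : 0 < m := (Real.exp_pos _).trans_le (le_max_left _ _)
  have hm8 : m ≤ 8 * Real.exp (-M₂) := by
    refine max_le (by linarith [Real.exp_pos (-M₂)]) ?_
    rw [div_le_iff₀ hnR]; linarith
  -- Here the bound on log n enters: the noise level is expressed by √n e^{−M₂/2} alone, as in the
  -- signal condition.
  have hζle : 84002 * Real.sqrt (n * m) ≤ 300000 * (Real.sqrt n * Real.exp (-(M₂ / 2))) := by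
    have h1 : Real.sqrt (n * m) ≤ 3 * (Real.sqrt n * Real.exp (-(M₂ / 2))) := by
      refine Real.sqrt_le_iff.2 ⟨by positivity, ?_⟩
      have e1 : (3 * (Real.sqrt n * Real.exp (-(M₂ / 2)))) ^ 2 = 9 * (n * Real.exp (-M₂)) := by
        rw [mul_pow, mul_pow, Real.sq_sqrt hnR.le, ← Real.exp_nat_mul]
        push_cast
        ring_nf
      rw [e1]
      have h2 := mul_le_mul_of_nonneg_left hm8 hnR.le
      have h3 := mul_pos hnR (Real.exp_pos (-M₂))
      linarith
    have h4 : 0 ≤ Real.sqrt n * Real.exp (-(M₂ / 2)) := by positivity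
    linarith
  -- The constant 3·10⁹ of the signal condition is the 10⁴ of the deterministic part times this
  -- 3·10⁵.
  have hgap : 10000 * kappa q.Z ^ 2 * Real.exp M₁ * (84002 * Real.sqrt (n * m))
      * max (Real.sqrt (η * k * Real.exp M₁)) 1 ≤ opNorm q.Z ^ 2 := by
    refine le_trans ?_ hsig
    refine mul_le_mul_of_nonneg_right ?_ (zero_le_one.trans (le_max_right _ _))
    have h1 := mul_le_mul_of_nonneg_left hζle
      (by positivity : 0 ≤ 10000 * kappa q.Z ^ 2 * Real.exp M₁)
    refine h1.trans (le_of_eq ?_)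
    rw [sub_eq_add_neg, Real.exp_add]
    ring
  have hψ : kappa q.Z ^ 2 * Real.exp (2 * M₁) * (84002 * Real.sqrt (n * m)) ^ 2 * k =
      84002 ^ 2 * (kappa q.Z ^ 2 * psiSq n k M₁ M₂) := by
    rw [mul_pow, Real.sq_sqrt (by positivity), psiSq, ← hm]
    ring
  have hψ0 : 0 ≤ kappa q.Z ^ 2 * psiSq n k M₁ M₂ := by
    rw [psiSq, ← hm]; positivity
  have hit := h.iterates hA hζ hgap hp hinit
  rw [hψ] at hit
  refine ⟨fun t => (hit t).1.trans ?_, fun T hT => ?_⟩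
  · rw [div_div_eq_mul_div, div_one]
    linarith
  · have h1 := (hit T).2
    have h2 := h.rate_pow_mul_le hinit hT
    have h3 := errG_le_compErr X q (p T)
    have h4 := errTheta_le X q (p T)
    constructor <;> linarith

end Truth

end LatentSpace

end

/-! ### The deterministic and the probabilistic guarantee -/

theorem theorem4p2 :
    ∃ M₀ c cη : ℝ, 0 < M₀ ∧ 0 < c ∧ 0 < cη ∧
      -- deterministic errors of iterates
      (∃ C₁ ρ C : ℝ, 0 < C₁ ∧ 0 < ρ ∧ cη * ρ < 1 ∧ 0 < C ∧
        ∀ (n k : ℕ) (M₁ M₂ η : ℝ) (X : Matrix (Fin n) (Fin n) ℝ) (q : LatentSpace.Params n k),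
          LatentSpace.Setting M₀ cη n k M₁ M₂ η X q →
          ∀ A : Matrix (Fin n) (Fin n) ℝ, LatentSpace.IsAdjacency A →
          C₁ * LatentSpace.kappa q.Z ^ 2 * Real.exp M₁
              * LatentSpace.zeta k A (LatentSpace.sigmoidM (q.theta X)) X
              * max (Real.sqrt (η * k * Real.exp M₁)) 1 ≤ LatentSpace.opNorm q.Z ^ 2 →
          ∀ p : ℕ → LatentSpace.Params n k, LatentSpace.IsPGD A X M₁ η p →
          LatentSpace.GoodInit c M₁ X q (p 0) →
          ∀ t : ℕ, LatentSpace.errMetric X q (p t) ≤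
            2 * LatentSpace.rate M₁ (LatentSpace.kappa q.Z) η ρ ^ t
                * LatentSpace.errMetric X q (p 0)
              + C * LatentSpace.kappa q.Z ^ 2 / ρ * Real.exp (2 * M₁)
                * LatentSpace.zeta k A (LatentSpace.sigmoidM (q.theta X)) X ^ 2 * k) ∧
      -- probabilistic errors of iterates
      (∃ C₁ ρ c₀ C C' : ℝ, 0 < C₁ ∧ 0 < ρ ∧ cη * ρ < 1 ∧ 0 < c₀ ∧ 0 < C ∧ 0 < C' ∧
        ∀ (n k : ℕ) (M₁ M₂ η : ℝ) (X : Matrix (Fin n) (Fin n) ℝ) (q : LatentSpace.Params n k),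
          LatentSpace.Setting M₀ cη n k M₁ M₂ η X q →
          C₁ * LatentSpace.kappa q.Z ^ 2 * Real.sqrt n * Real.exp (M₁ - M₂ / 2)
              * max (Real.sqrt (η * k * Real.exp M₁)) 1 ≤ LatentSpace.opNorm q.Z ^ 2 →
          ∀ (Ω : Type*) [MeasurableSpace Ω] (μ : MeasureTheory.Measure Ω)
            [MeasureTheory.IsProbabilityMeasure μ] (A : Ω → Matrix (Fin n) (Fin n) ℝ),
          LatentSpace.IsModel μ A (q.theta X) →
          ENNReal.ofReal (1 - (n : ℝ) ^ (-c₀)) ≤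
            μ {ω | ∀ p : ℕ → LatentSpace.Params n k, LatentSpace.IsPGD (A ω) X M₁ η p →
              LatentSpace.GoodInit c M₁ X q (p 0) →
              (∀ t : ℕ, LatentSpace.errMetric X q (p t) ≤
                2 * LatentSpace.rate M₁ (LatentSpace.kappa q.Z) η ρ ^ t
                    * LatentSpace.errMetric X q (p 0)
                  + C * LatentSpace.kappa q.Z ^ 2 / ρ * LatentSpace.psiSq n k M₁ M₂) ∧
              (∀ T : ℕ, LatentSpace.iterT0 n k M₁ M₂ (LatentSpace.kappa q.Z) η ρ < T →
                LatentSpace.errG q (p T)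
                    ≤ C' * LatentSpace.kappa q.Z ^ 2 * LatentSpace.psiSq n k M₁ M₂ ∧
                LatentSpace.errTheta X q (p T)
                    ≤ C' * LatentSpace.kappa q.Z ^ 2 * LatentSpace.psiSq n k M₁ M₂)}) := by
  -- The stable rank constant 64 is the square of the 8 in `compErr_le_errTheta`, and c₀ = 1 comes
  -- from the failure probability 1/n. The last two constants leave room for the square of 84002.
  refine ⟨64, 1 / 100000, 1 / 1000, by norm_num, by norm_num, by norm_num,
    ⟨10000, 1 / 256, 1000000, by norm_num, by norm_num, by norm_num, by norm_num, ?_⟩,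
    ⟨3000000000, 1 / 256, 1, 10 ^ 16, 10 ^ 18, by norm_num, by norm_num, by norm_num, by norm_num,
      by norm_num, by norm_num, ?_⟩⟩
  · intro n k M₁ M₂ η X q hset A hA hgap p hp hinit t
    have h1 := (hset.iterates hA.1 (LatentSpace.noiseLevel_zeta hset.k_pos A
      (LatentSpace.sigmoidM (q.theta X)) X) hgap hp hinit t).1
    refine h1.trans ?_
    rw [div_div_eq_mul_div, div_one]
    set ζ := LatentSpace.zeta k A (LatentSpace.sigmoidM (q.theta X)) X
    have h2 : 0 ≤ LatentSpace.kappa q.Z ^ 2 * Real.exp (2 * M₁) * ζ ^ 2 * k := by positivity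
    linarith
  · intro n k M₁ M₂ η X q hset hsig Ω _ μ _ A hA
    have hsig' : 6 * LatentSpace.kappa q.Z ^ 2 * Real.sqrt n * Real.exp (M₁ - M₂ / 2) ≤
        LatentSpace.opNorm q.Z ^ 2 := by
      refine le_trans ?_ hsig
      have h1 : 0 ≤ LatentSpace.kappa q.Z ^ 2 * Real.sqrt n * Real.exp (M₁ - M₂ / 2) := by
        positivity
      refine le_trans ?_ (le_mul_of_one_le_right (by positivity) (le_max_right _ _))
      linarith
    obtain ⟨hn, hlog⟩ := hset.log_le hsig'
    have hnR : (0 : ℝ) < n := by exact_mod_cast hset.n_pos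
    have hprob := hA.measure_noiseLevel_ge hn hset.k_pos
      (LatentSpace.theta_isSymm hset.cov.1 q) hset.cov
      (p := max (Real.exp (-M₂)) (Real.log n / n))
      (fun i j hij => ((LatentSpace.sigmoid_le_exp _).trans
        (Real.exp_le_exp.2 (hset.truth.2.2.2 i j hij))).trans (le_max_left _ _))
      (max_le (Real.exp_le_one_iff.2 (neg_nonpos.2 hset.M₂_nonneg))
        ((div_le_one hnR).2 (Real.log_le_self hnR.le)))
      (by rw [mul_comm, ← div_le_iff₀ hnR]; exact le_max_right _ _)
    rw [Real.rpow_neg_one]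
    -- The noise event concerns A alone, so the bounds on it hold simultaneously for all starting
    -- points, including those chosen depending on A.
    refine hprob.trans (MeasureTheory.measure_mono fun ω hω p hp hinit => ?_)
    exact hset.iterates_of_sparse hsig hlog (hA.adj ω).1 hω hp hinit
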